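/- Let $d\ge 0$ be an integer. For $n\in\mathbf N$, $s>0$ and $h>0$, let $\mathcal S_{s,h}(\mathbf R^n)$ be the set of all $f\in C^\infty(\mathbf R^n)$ (complex-valued) such that $$\sup_{\alpha,\beta\in\mathbf N^n,\ x\in\mathbf R^n}\frac{|x^\beta\partial^\alpha f(x)|}{h^{|\alpha|+|\beta|}(\alpha!\,\beta!)^s}<\infty ,$$ and let $$\mathcal S_s(\mathbf R^n)=\bigcup_{h>0}\mathcal S_{s,h}(\mathbf R^n),\qquad \Sigma_s(\mathbf R^n)=\bigcap_{h>0}\mathcal S_{s,h}(\mathbf R^n)$$ be the Gelfand–Shilov spaces. For $t\in\mathbf R$ and a symbol $a$ on $\mathbf R^{2d}$ belonging to $\mathcal S_s(\mathbf R^{2d})$ for some $s\ge 1/2$, let $\operatorname{Op}_t(a)$ be the pseudo-differential operator $$(\operatorname{Op}_t(a)f)(x)=(2\pi)^{-d}\iint_{\mathbf R^d\times\mathbf R^d} a((1-t)x+ty,\xi)\,f(y)\,e^{i\langle x-y,\xi\rangle}\,dy\,d\xi ,\qquad x\in\mathbf R^d .$$ For such symbols $a,a_1,a_2$, write $a=a_1\#_t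 a_2$ if, for every $f\in\mathcal S_{1/2}(\mathbf R^d)$, the integrals defining $\operatorname{Op}_t(a)f$, $\operatorname{Op}_t(a_2)f$ and $\operatorname{Op}_t(a_1)(\operatorname{Op}_t(a_2)f)$ converge absolutely at every point, and $$\operatorname{Op}_t(a)f=\operatorname{Op}_t(a_1)\bigl(\operatorname{Op}_t(a_2)f\bigr).$$ **Theorem.** Let $t\in\mathbf R$, $s_1\ge 1/2$ and $s_2>1/2$. Then the following is true: 1. if $a\in\mathcal S_{s_1}(\mathbf R^{2d})$, then there are $a_1,a_2\in\mathcal S_{s_1}(\mathbf R^{2d})$ such that $a=a_1\#_t a_2$; 2. if $a\in\Sigma_{s_2}(\mathbf R^{2d})$, then there are $a_1,a_2\in\Sigma_{s_2}(\mathbf R^{2d})$ such that $a=a_1\#_t a_2$. -/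

import Mathlib

open MeasureTheory
open scoped ContDiff

noncomputable section

/-- The partial derivative `∂f/∂xᵢ` of a function on `ℝⁿ`. -/
def partialDeriv {n : ℕ} (i : Fin n) (f : EuclideanSpace ℝ (Fin n) → ℂ) :
    EuclideanSpace ℝ (Fin n) → ℂ :=
  fun x => fderiv ℝ f x (EuclideanSpace.single i 1)

/-- The mixed partial derivative `∂^α f = ∂₁^{α₁} ⋯ ∂ₙ^{αₙ} f` for a multi-index `α ∈ ℕⁿ`. -/
def multiDeriv {n : ℕ} (α : Fin n → ℕ) (f : EuclideanSpace ℝ (Fin n) → ℂ) :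
    EuclideanSpace ℝ (Fin n) → ℂ :=
  (List.finRange n).foldr (fun i g => (partialDeriv i)^[α i] g) f

/-- The monomial `x^β = x₁^{β₁} ⋯ xₙ^{βₙ}`. -/
def multiPow {n : ℕ} (x : EuclideanSpace ℝ (Fin n)) (β : Fin n → ℕ) : ℝ :=
  ∏ i, x i ^ β i

/-- The length `|α| = α₁ + ⋯ + αₙ` of a multi-index. -/
def multiLength {n : ℕ} (α : Fin n → ℕ) : ℕ := ∑ i, α i

/-- The factorial `α! = α₁! ⋯ αₙ!` of a multi-index. -/
def multiFactorial {n : ℕ} (α : Fin n → ℕ) : ℕ := ∏ i, (α i).factorial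

/-- The space `𝓢_{s,h}(ℝⁿ)`: all smooth `f` for which
`|x^β ∂^α f(x)| / (h^{|α|+|β|} (α! β!)^s)` is bounded uniformly in `α`, `β` and `x`. -/
def gelfandShilovStep (n : ℕ) (s h : ℝ) : Set (EuclideanSpace ℝ (Fin n) → ℂ) :=
  {f | ContDiff ℝ ∞ f ∧ ∃ C : ℝ, ∀ (α β : Fin n → ℕ) (x : EuclideanSpace ℝ (Fin n)),
    ‖(multiPow x β : ℂ) * multiDeriv α f x‖ /
      (h ^ (multiLength α + multiLength β) *
        ((multiFactorial α : ℝ) * (multiFactorial β : ℝ)) ^ s) ≤ C}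

/-- The Gelfand–Shilov space `𝓢_s(ℝⁿ) = ⋃_{h>0} 𝓢_{s,h}(ℝⁿ)` (Roumieu type). -/
def gelfandShilovS (n : ℕ) (s : ℝ) : Set (EuclideanSpace ℝ (Fin n) → ℂ) :=
  {f | ∃ h : ℝ, 0 < h ∧ f ∈ gelfandShilovStep n s h}

/-- The Gelfand–Shilov space `Σ_s(ℝⁿ) = ⋂_{h>0} 𝓢_{s,h}(ℝⁿ)` (Beurling type). -/
def gelfandShilovSigma (n : ℕ) (s : ℝ) : Set (EuclideanSpace ℝ (Fin n) → ℂ) :=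
  {f | ∀ h : ℝ, 0 < h → f ∈ gelfandShilovStep n s h}

/-- The point `(x, ξ) ∈ ℝ^{2d}` for `x, ξ ∈ ℝᵈ`. -/
def phasePoint {d : ℕ} (x ξ : EuclideanSpace ℝ (Fin d)) : EuclideanSpace ℝ (Fin (d + d)) :=
  WithLp.toLp 2 (Fin.append (fun i => x i) (fun i => ξ i))

/-- The integrand `(y, ξ) ↦ a((1-t)x + ty, ξ) f(y) e^{i⟨x-y, ξ⟩}`. -/
def opIntegrand {d : ℕ} (t : ℝ) (a : EuclideanSpace ℝ (Fin (d + d)) → ℂ)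
    (f : EuclideanSpace ℝ (Fin d) → ℂ) (x : EuclideanSpace ℝ (Fin d)) :
    EuclideanSpace ℝ (Fin d) × EuclideanSpace ℝ (Fin d) → ℂ :=
  fun p => a (phasePoint ((1 - t) • x + t • p.1) p.2) * f p.1 *
    Complex.exp (Complex.I * ((inner ℝ (x - p.1) p.2 : ℝ) : ℂ))

/-- The integral defining `Op_t(a) f` converges absolutely at every point. -/
def OpConverges {d : ℕ} (t : ℝ) (a : EuclideanSpace ℝ (Fin (d + d)) → ℂ)
    (f : EuclideanSpace ℝ (Fin d) → ℂ) : Prop :=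
  ∀ x, Integrable (opIntegrand t a f x)

/-- The pseudo-differential operator
`(Op_t(a) f)(x) = (2π)^{-d} ∬ a((1-t)x + ty, ξ) f(y) e^{i⟨x-y, ξ⟩} dy dξ`. -/
def pseudoOp {d : ℕ} (t : ℝ) (a : EuclideanSpace ℝ (Fin (d + d)) → ℂ)
    (f : EuclideanSpace ℝ (Fin d) → ℂ) : EuclideanSpace ℝ (Fin d) → ℂ :=
  fun x => (((2 * Real.pi) ^ d : ℝ) : ℂ)⁻¹ * ∫ p, opIntegrand t a f x p

/-- `c = a #_t b`: the operators `Op_t(c)`, `Op_t(b)` on `𝓢_{1/2}(ℝᵈ)`, and `Op_t(a)` on the range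
of `Op_t(b)`, are all given by absolutely convergent integrals, and
`Op_t(c) = Op_t(a) ∘ Op_t(b)` on `𝓢_{1/2}(ℝᵈ)`. -/
def IsSharpProduct {d : ℕ} (t : ℝ) (a b c : EuclideanSpace ℝ (Fin (d + d)) → ℂ) : Prop :=
  ∀ f ∈ gelfandShilovS d (1 / 2),
    OpConverges t b f ∧ OpConverges t a (pseudoOp t b f) ∧ OpConverges t c f ∧
      pseudoOp t c f = pseudoOp t a (pseudoOp t b f)

end

open scoped SchwartzMap LineDeriv FourierTransform

noncomputable section

/-! Let `N` be the number operator of the harmonic oscillator on `ℝᵈ`, with the Hermite functions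
`ψ_k` as eigenvectors of eigenvalue `|k|`. For a positive function `P` one has, formally, `Op_t(a) =
(Op_t(a) P(N)) ∘ P(N)⁻¹`. So `a₁` is to be the symbol of `Op_t(a) P(N)` and `a₂` that of `P(N)⁻¹`.
The point is to choose `P` growing slowly enough for `a₁` to stay in the class of `a`, and fast
enough for `a₂` to lie in it (`exists_factorization`).

Regularity is measured by words: `WordBound f M` bounds all products of `m` generators `xᵢ`, `∂ᵢ`
applied to `f` by `M m`, in any order. Membership in a Gelfand–Shilov space amounts to word bounds
of size `C h^m (m!)^s`. Normal ordering a word produces commutator terms, and `s ≥ 1/2` (with `h`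
not small when `s = 1/2`) is what absorbs them (`wordBound_of_orderedBound`,
`mem_gelfandShilovStep_of_wordBound`).

Composition of `Op_t(b)` with `xⱼ` or `∂ⱼ` on either side acts on `b` by a first-order operator on
phase space. These operators form a second oscillator, on `ℝ^{2d}`, whose excited states are, up to
a constant, the symbols of the rank-one operators `f ↦ ⟨ψ_k, f⟩ ψ_j` (`pseudoOp_phaseState`). In
particular right composition with `N` is a differential operator `rightNumber` of Weyl order two,
with some constant `A`.

Suppose the words of `a` are bounded by `M` with `M (m + k) ≤ R m * R k`. With `P(λ) = ∑ λ^m /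
((2A)^m R_{2m})` the series for `a₁` converges geometrically and its words are bounded by `2 R m`.
The symbol `a₂` is a series of diagonal states weighted by `1 / P(|k|)`. A word of length `m` costs
a power of `|k|` of order `m / 2` on such a state (`exists_wordBound_state`), and dividing by `P`
turns it into `R` at an index about `m`, provided `R m ≥ δ √(m!)` (`inv_growthWeight_mul_sqrt_le`).

In the Roumieu case `R m = C h^m (m!)^s` works. In the Beurling case `R` must beat every `h` at
once, and is built from the infimum over `h` of the bounds for `a` (`geometricEnvelope`), which is
submultiplicative. -/

/-- The ordered monomial `c₁^{k₁} ⋯ cₙ^{kₙ}` in a noncommutative ring. -/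
def orderedPow {R : Type*} [Ring R] {n : ℕ} (c : Fin n → R) (k : Fin n → ℕ) : R :=
  ((List.finRange n).map fun i => c i ^ k i).prod

/-! ### Normal ordering under canonical commutation relations -/

section OrderedPow

variable {R : Type*} [Ring R] {n : ℕ} {c : Fin n → R}

lemma list_prod_pow_congr (l : List (Fin n)) {k k' : Fin n → ℕ} (h : ∀ i ∈ l, k i = k' i) :
    (l.map fun i => c i ^ k i).prod = (l.map fun i => c i ^ k' i).prod := by
  congr 1
  exact List.map_congr_left fun i hi => by rw [h i hi]

lemma mul_list_prod_pow (hc : ∀ i j, Commute (c i) (c j)) {j : Fin n} (k : Fin n → ℕ)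
    (l : List (Fin n)) (hl : l.Nodup) (hj : j ∈ l) :
    c j * (l.map fun i => c i ^ k i).prod =
      (l.map fun i => c i ^ (k + Pi.single j 1 : Fin n → ℕ) i).prod := by
  induction l with
  | nil => simp at hj
  | cons i l ih =>
    rw [List.nodup_cons] at hl
    simp only [List.map_cons, List.prod_cons]
    by_cases hij : i = j
    · subst hij
      rw [list_prod_pow_congr l (k' := k) (k := k + Pi.single i 1), ← mul_assoc, ← pow_succ']
      · simp
      · intro m hm
        have : m ≠ i := fun h => hl.1 (h ▸ hm)
        simp [this]
    · have hj' : j ∈ l := by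
        rcases List.mem_cons.1 hj with h | h
        · exact absurd h.symm hij
        · exact h
      rw [← ih hl.2 hj', ← mul_assoc, ((hc j i).pow_right (k i)).eq, mul_assoc]
      simp [hij]

lemma mul_orderedPow (hc : ∀ i j, Commute (c i) (c j)) (j : Fin n) (k : Fin n → ℕ) :
    c j * orderedPow c k = orderedPow c (k + Pi.single j 1) :=
  mul_list_prod_pow hc k _ (List.nodup_finRange n) (List.mem_finRange j)

lemma orderedPow_zero (c : Fin n → R) : orderedPow c 0 = 1 := by
  simp [orderedPow]

/-- Commutation with `b` acts as differentiation in `b`. The truncated exponent at `m = 0` is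
harmless because its coefficient vanishes. -/
lemma mul_pow_of_commutator {a b : R} (h : a * b = b * a + 1) (m : ℕ) :
    a * b ^ m = b ^ m * a + m • b ^ (m - 1) := by
  induction m with
  | zero => simp
  | succ m ih =>
    rw [pow_succ, ← mul_assoc, ih, add_mul, mul_assoc, h]
    rcases m with _ | m
    · simp
    · simp only [Nat.add_sub_cancel, smul_mul_assoc, ← pow_succ]
      rw [mul_add, ← mul_assoc, ← pow_succ, add_assoc, mul_one, succ_nsmul _ (m + 1),
        add_comm (b ^ (m + 1))]

lemma commute_list_prod_pow {a : R} {j : Fin n} (h : ∀ i, i ≠ j → Commute a (c i))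
    (k : Fin n → ℕ) (l : List (Fin n)) (hj : j ∉ l) :
    Commute a (l.map fun i => c i ^ k i).prod := by
  refine Commute.list_prod_right _ _ ?_
  simp only [List.mem_map]
  rintro x ⟨i, hi, rfl⟩
  exact (h i fun hij => hj (hij ▸ hi)).pow_right _

lemma annihilate_list_prod_pow {a : R} {j : Fin n} (h : ∀ i, i ≠ j → Commute a (c i))
    (hj : a * c j = c j * a + 1) (k : Fin n → ℕ)
    (l : List (Fin n)) (hl : l.Nodup) (hjl : j ∈ l) :
    a * (l.map fun i => c i ^ k i).prod = (l.map fun i => c i ^ k i).prod * a +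
      k j • (l.map fun i => c i ^ (k - Pi.single j 1 : Fin n → ℕ) i).prod := by
  induction l with
  | nil => simp at hjl
  | cons i l ih =>
    rw [List.nodup_cons] at hl
    simp only [List.map_cons, List.prod_cons]
    by_cases hij : i = j
    · subst hij
      rw [list_prod_pow_congr l (k' := k) (k := k - Pi.single i 1), ← mul_assoc,
        mul_pow_of_commutator hj, add_mul, mul_assoc,
        (commute_list_prod_pow h k l hl.1).eq, ← mul_assoc]
      · simp [mul_assoc]
      · intro m hm
        have : m ≠ i := fun h => hl.1 (h ▸ hm)
        simp [this]
    · have hj' : j ∈ l := by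
        rcases List.mem_cons.1 hjl with h | h
        · exact absurd h.symm hij
        · exact h
      rw [← mul_assoc, ((h i hij).pow_right (k i)).eq, mul_assoc, ih hl.2 hj', mul_add,
        mul_smul_comm, mul_assoc]
      simp [hij]

/-- The commutator with `a` is a derivation that sees only the `j`-th factor. This serves twice: for
annihilators acting on excited states, and for moving `∂ᵢ` through `x^β`. -/
lemma annihilate_orderedPow {a : R} {j : Fin n} (h : ∀ i, i ≠ j → Commute a (c i))
    (hj : a * c j = c j * a + 1) (k : Fin n → ℕ) :
    a * orderedPow c k = orderedPow c k * a + k j • orderedPow c (k - Pi.single j 1) :=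
  annihilate_list_prod_pow h hj k _ (List.nodup_finRange n) (List.mem_finRange j)

end OrderedPow

/-! ### The generators of the Weyl algebra on the Schwartz space -/

/-- Schwartz functions on `ℝⁿ`. -/
abbrev Schw (n : ℕ) := 𝓢(EuclideanSpace ℝ (Fin n), ℂ)

/-- Continuous linear operators on the Schwartz space of `ℝⁿ`. -/
abbrev SchwOp (n : ℕ) := Schw n →L[ℂ] Schw n

/-- Multiplication by the coordinate `xᵢ`. -/
def coordMul {n : ℕ} (i : Fin n) : SchwOp n :=
  SchwartzMap.smulLeftCLM ℂ fun x : EuclideanSpace ℝ (Fin n) => (x i : ℂ)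

/-- The partial derivative `∂ᵢ`. -/
def coordDeriv {n : ℕ} (i : Fin n) : SchwOp n :=
  LineDeriv.lineDerivOpCLM ℂ (Schw n) (EuclideanSpace.single i (1 : ℝ))

/-- The generators `xᵢ`, `∂ᵢ` of the algebra of differential operators with polynomial
coefficients. -/
def weylGen {n : ℕ} : Fin n ⊕ Fin n → SchwOp n :=
  Sum.elim coordMul coordDeriv

/-- The operator given by a word in the generators `xᵢ`, `∂ᵢ`. -/
def weylWord {n : ℕ} (w : List (Fin n ⊕ Fin n)) : SchwOp n := (w.map weylGen).prod

lemma hasTemperateGrowth_coord {n : ℕ} (i : Fin n) :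
    (fun x : EuclideanSpace ℝ (Fin n) => (x i : ℂ)).HasTemperateGrowth := by
  exact (Complex.ofRealCLM ∘L
    (EuclideanSpace.proj i : EuclideanSpace ℝ (Fin n) →L[ℝ] ℝ)).hasTemperateGrowth

@[simp] lemma coordMul_apply {n : ℕ} (i : Fin n) (f : Schw n) (x : EuclideanSpace ℝ (Fin n)) :
    coordMul i f x = (x i : ℂ) * f x := by
  simp [coordMul, SchwartzMap.smulLeftCLM_apply_apply (hasTemperateGrowth_coord i)]

lemma coordDeriv_eq {n : ℕ} (i : Fin n) (f : Schw n) :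
    coordDeriv i f = ∂_{EuclideanSpace.single i (1 : ℝ)} f := rfl

lemma coordDeriv_apply {n : ℕ} (i : Fin n) (f : Schw n) (x : EuclideanSpace ℝ (Fin n)) :
    coordDeriv i f x = fderiv ℝ f x (EuclideanSpace.single i 1) := by
  rw [coordDeriv_eq, SchwartzMap.lineDerivOp_apply_eq_fderiv]

lemma partialDeriv_coe {n : ℕ} (i : Fin n) (f : Schw n) :
    partialDeriv i f = coordDeriv i f := by
  ext x
  rw [coordDeriv_apply]; rfl

lemma coordMul_comm {n : ℕ} (i j : Fin n) :
    Commute (coordMul i : SchwOp n) (coordMul j) := by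
  ext f x
  change coordMul i (coordMul j f) x = coordMul j (coordMul i f) x
  simp only [coordMul_apply]
  ring

lemma coordDeriv_comm {n : ℕ} (i j : Fin n) :
    Commute (coordDeriv i : SchwOp n) (coordDeriv j) := by
  ext f x
  have key : ∀ i j : Fin n, coordDeriv i (coordDeriv j f) x =
      fderiv ℝ (fderiv ℝ f) x (EuclideanSpace.single i 1) (EuclideanSpace.single j 1) := by
    intro i j
    rw [coordDeriv_apply]
    have h : (coordDeriv j f : EuclideanSpace ℝ (Fin n) → ℂ) =
        fun y => fderiv ℝ f y (EuclideanSpace.single j 1) := by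
      ext y; rw [coordDeriv_apply]
    have hd : DifferentiableAt ℝ (fderiv ℝ f) x :=
      (((f.smooth 2).fderiv_right (m := 1) (by norm_num)).differentiable (by norm_num)) x
    rw [h, fderiv_clm_apply hd (differentiableAt_const _)]
    simp
  have hs : IsSymmSndFDerivAt ℝ f x := by
    refine (f.smooth 2).contDiffAt.isSymmSndFDerivAt ?_
    simp
  change coordDeriv i (coordDeriv j f) x = coordDeriv j (coordDeriv i f) x
  rw [key, key, hs.eq]

lemma coordDeriv_mul_coordMul {n : ℕ} (i j : Fin n) :
    (coordDeriv i * coordMul j : SchwOp n) =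
      coordMul j * coordDeriv i + if i = j then 1 else 0 := by
  ext f x
  have h1 : HasFDerivAt (fun x : EuclideanSpace ℝ (Fin n) => (x j : ℂ))
      (Complex.ofRealCLM ∘L (EuclideanSpace.proj j : EuclideanSpace ℝ (Fin n) →L[ℝ] ℝ)) x :=
    (Complex.ofRealCLM ∘L
      (EuclideanSpace.proj j : EuclideanSpace ℝ (Fin n) →L[ℝ] ℝ)).hasFDerivAt
  have h2 := h1.mul (f.differentiableAt (x := x)).hasFDerivAt
  have h3 : (coordMul j f : EuclideanSpace ℝ (Fin n) → ℂ) = fun x => (x j : ℂ) * f x := by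
    ext; simp
  change coordDeriv i (coordMul j f) x =
    coordMul j (coordDeriv i f) x + ((if i = j then 1 else 0 : SchwOp n) f) x
  rw [show (fun x : EuclideanSpace ℝ (Fin n) => (x j : ℂ)) * (f : EuclideanSpace ℝ (Fin n) → ℂ)
    = coordMul j f from h3.symm] at h2
  rw [coordDeriv_apply, h2.fderiv, coordMul_apply, coordDeriv_apply]
  by_cases h : i = j
  · subst h
    simp
  · have : j ≠ i := fun h' => h h'.symm
    simp [h, this]

lemma weylWord_cons {n : ℕ} (l : Fin n ⊕ Fin n) (w : List (Fin n ⊕ Fin n)) (f : Schw n) :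
    weylWord (l :: w) f = weylGen l (weylWord w f) := by
  simp [weylWord]

lemma weylWord_append {n : ℕ} (u w : List (Fin n ⊕ Fin n)) (f : Schw n) :
    weylWord (u ++ w) f = weylWord u (weylWord w f) := by
  simp [weylWord]

@[simp] lemma weylWord_nil {n : ℕ} (f : Schw n) : weylWord [] f = f := by
  simp [weylWord]

/-! ### Word bounds, Schwartz seminorms and convergent series -/

/-- All words of length `m` applied to `f` are bounded by `M m`. -/
def WordBound {n : ℕ} (f : Schw n) (M : ℕ → ℝ) : Prop :=
  ∀ (w : List (Fin n ⊕ Fin n)) (x : EuclideanSpace ℝ (Fin n)), ‖weylWord w f x‖ ≤ M w.length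

lemma contDiff_partialDeriv {n : ℕ} {f : EuclideanSpace ℝ (Fin n) → ℂ} (hf : ContDiff ℝ ∞ f)
    (i : Fin n) : ContDiff ℝ ∞ (partialDeriv i f) := by
  have h : ContDiff ℝ ∞ (fderiv ℝ f) := hf.fderiv_right (by simp)
  exact h.clm_apply contDiff_const

lemma fderiv_eq_sum_partialDeriv {n : ℕ} (f : EuclideanSpace ℝ (Fin n) → ℂ) :
    fderiv ℝ f = fun x => ∑ i : Fin n, ((ContinuousLinearMap.smulRightL ℝ
      (EuclideanSpace ℝ (Fin n)) ℂ (EuclideanSpace.proj i)) ∘ partialDeriv i f) x := by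
  ext x v
  have hv : v = ∑ i, v i • EuclideanSpace.single i (1 : ℝ) := by
    have := ((EuclideanSpace.basisFun (Fin n) ℝ).sum_repr v).symm
    simpa using this
  conv_lhs => rw [hv]
  simp [partialDeriv, map_sum]

/-- The differential is the sum of the partial derivatives tensored with coordinate forms, and
tensoring with a coordinate form is a contraction. -/
lemma norm_iteratedFDeriv_succ_le {n : ℕ} {f : EuclideanSpace ℝ (Fin n) → ℂ}
    (hf : ContDiff ℝ ∞ f) (m : ℕ) (x : EuclideanSpace ℝ (Fin n)) :
    ‖iteratedFDeriv ℝ (m + 1) f x‖ ≤ ∑ i, ‖iteratedFDeriv ℝ m (partialDeriv i f) x‖ := by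
  rw [← norm_iteratedFDeriv_fderiv, fderiv_eq_sum_partialDeriv, iteratedFDeriv_sum]
  · rw [Finset.sum_apply]
    refine (norm_sum_le _ _).trans (Finset.sum_le_sum fun i _ => ?_)
    refine (ContinuousLinearMap.norm_iteratedFDeriv_comp_left _
      ((contDiff_partialDeriv hf i).of_le (m := (m : WithTop ℕ∞)) (mod_cast le_top)).contDiffAt
      le_rfl).trans ?_
    refine mul_le_of_le_one_left (norm_nonneg _) ?_
    refine (ContinuousLinearMap.le_opNorm _ _).trans ?_
    refine mul_le_one₀ ContinuousLinearMap.norm_smulRightL_le (norm_nonneg _) ?_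
    refine ContinuousLinearMap.opNorm_le_bound _ zero_le_one fun v => ?_
    simpa using PiLp.norm_apply_le v i
  · intro i _
    exact (ContinuousLinearMap.contDiff _).comp
      ((contDiff_partialDeriv hf i).of_le (mod_cast le_top))

lemma norm_iteratedFDeriv_le_of_partialDeriv {n : ℕ} (m : ℕ) (B : ℝ)
    (x : EuclideanSpace ℝ (Fin n)) {f : EuclideanSpace ℝ (Fin n) → ℂ} (hf : ContDiff ℝ ∞ f)
    (h : ∀ l : List (Fin n), l.length = m → ‖l.foldr partialDeriv f x‖ ≤ B) :
    ‖iteratedFDeriv ℝ m f x‖ ≤ (n : ℝ) ^ m * B := by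
  induction m generalizing f with
  | zero => simpa using h [] rfl
  | succ m ih =>
    refine (norm_iteratedFDeriv_succ_le hf m x).trans ?_
    calc ∑ i, ‖iteratedFDeriv ℝ m (partialDeriv i f) x‖
        ≤ ∑ _i : Fin n, (n : ℝ) ^ m * B := by
          refine Finset.sum_le_sum fun i _ => ih (contDiff_partialDeriv hf i) fun l hl => ?_
          -- In `foldr` the last list entry acts first, so the derivative just split off goes to the
          -- end.
          have := h (l ++ [i]) (by simp [hl])
          simpa using this
      _ = (n : ℝ) ^ (m + 1) * B := by
          simp [pow_succ]; ring

lemma norm_le_sum_coord {n : ℕ} (x : EuclideanSpace ℝ (Fin n)) : ‖x‖ ≤ ∑ i, |x i| := by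
  have hv : x = ∑ i, x i • EuclideanSpace.single i (1 : ℝ) := by
    have := ((EuclideanSpace.basisFun (Fin n) ℝ).sum_repr x).symm
    simpa using this
  conv_lhs => rw [hv]
  refine (norm_sum_le _ _).trans (Finset.sum_le_sum fun i _ => ?_)
  simp [norm_smul]

/-- The largest coordinate satisfies `‖x‖ ≤ n |xᵢ|`. The hypothesis `T ≤ B` and the summand `1` take
care of dimension zero, where there is no coordinate to use. -/
lemma norm_pow_mul_le_of_coord {n : ℕ} (x : EuclideanSpace ℝ (Fin n)) (k : ℕ) {T B : ℝ}
    (hT : 0 ≤ T) (h0 : T ≤ B) (h : ∀ i, |x i| ^ k * T ≤ B) :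
    ‖x‖ ^ k * T ≤ ((n : ℝ) ^ k + 1) * B := by
  have hB : 0 ≤ B := hT.trans h0
  rcases Nat.eq_zero_or_pos n with rfl | hn
  · have : x = 0 := Subsingleton.elim _ _
    subst this
    have : ‖(0 : EuclideanSpace ℝ (Fin 0))‖ ^ k ≤ 1 := by
      rw [norm_zero]; exact pow_le_one₀ le_rfl zero_le_one
    have h1 : ‖(0 : EuclideanSpace ℝ (Fin 0))‖ ^ k * T ≤ 1 * B := by gcongr
    refine h1.trans ?_
    gcongr
    simp only [le_add_iff_nonneg_left]; positivity
  · have : Nonempty (Fin n) := ⟨⟨0, hn⟩⟩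
    obtain ⟨i, hi⟩ := Finite.exists_max fun i => |x i|
    have h1 : ‖x‖ ≤ n * |x i| := by
      refine (norm_le_sum_coord x).trans ?_
      refine (Finset.sum_le_sum fun j _ => hi j).trans ?_
      simp
    calc ‖x‖ ^ k * T ≤ (n * |x i|) ^ k * T := by gcongr
      _ = n ^ k * (|x i| ^ k * T) := by rw [mul_pow]; ring
      _ ≤ n ^ k * B := by gcongr; exact h i
      _ ≤ _ := by nlinarith

lemma weylWord_inr_coe {n : ℕ} (l : List (Fin n)) (f : Schw n) :
    (weylWord (l.map Sum.inr) f : EuclideanSpace ℝ (Fin n) → ℂ) = l.foldr partialDeriv f := by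
  induction l with
  | nil => simp
  | cons i l ih =>
    rw [List.map_cons, weylWord_cons, List.foldr_cons, ← ih, partialDeriv_coe]
    rfl

lemma weylWord_replicate_inl {n : ℕ} (k : ℕ) (i : Fin n) (f : Schw n)
    (x : EuclideanSpace ℝ (Fin n)) :
    weylWord (List.replicate k (Sum.inl i)) f x = (x i : ℂ) ^ k * f x := by
  induction k with
  | zero => simp
  | succ k ih =>
    rw [List.replicate_succ, weylWord_cons]
    change coordMul i _ x = _
    rw [coordMul_apply, ih, pow_succ']
    ring

lemma WordBound.seminorm_le {n : ℕ} {f : Schw n} {M : ℕ → ℝ} (h : WordBound f M)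
    (hM : ∀ m, 0 ≤ M m) (k m : ℕ) :
    SchwartzMap.seminorm ℂ k m f ≤ ((n : ℝ) ^ k + 1) * ((n : ℝ) ^ m * (M (k + m) + M m)) := by
  have hM' := hM (k + m)
  have hM'' := hM m
  refine SchwartzMap.seminorm_le_bound ℂ k m f (by positivity) fun x => ?_
  -- For fixed `x` the weight `|xᵢ|^k` is just a constant `C`, so the estimate of the iterated
  -- derivative can be applied with its bound divided by `C`.
  have key : ∀ C : ℝ, 0 ≤ C →
      (∀ l : List (Fin n), l.length = m → C * ‖l.foldr partialDeriv f x‖ ≤ M (k + m) + M m) →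
      C * ‖iteratedFDeriv ℝ m f x‖ ≤ (n : ℝ) ^ m * (M (k + m) + M m) := by
    intro C hC hl
    rcases hC.eq_or_lt with rfl | hC
    · rw [zero_mul]; positivity
    · have := norm_iteratedFDeriv_le_of_partialDeriv m ((M (k + m) + M m) / C) x
        (f.smooth ⊤) fun l hl' => by rw [le_div_iff₀ hC, mul_comm]; exact hl l hl'
      rw [mul_div_assoc', le_div_iff₀ hC] at this
      rwa [mul_comm]
  refine norm_pow_mul_le_of_coord x k (norm_nonneg _) ?_ fun i => ?_
  · have := key 1 zero_le_one fun l hl => ?_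
    · simpa using this
    · rw [one_mul, ← weylWord_inr_coe]
      have := h (l.map Sum.inr) x
      rw [List.length_map, hl] at this
      linarith
  · refine key _ (by positivity) fun l hl => ?_
    rw [← weylWord_inr_coe]
    have := h (List.replicate k (Sum.inl i) ++ l.map Sum.inr) x
    rw [weylWord_append, weylWord_replicate_inl, List.length_append, List.length_map, hl,
      List.length_replicate, norm_mul, norm_pow, Complex.norm_real, Real.norm_eq_abs] at this
    linarith

/-- Absolute convergence in every Schwartz seminorm implies summability. -/
lemma SchwartzMap.exists_hasSum_of_summable_seminorm {ι : Type*} {n : ℕ} (u : ι → Schw n)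
    (h : ∀ k m, Summable fun i => SchwartzMap.seminorm ℂ k m (u i)) :
    ∃ U : Schw n, HasSum u U := by
  have hb : ∀ (m : ℕ) (i : ι) (x : EuclideanSpace ℝ (Fin n)), (m : ℕ∞) ≤ ⊤ →
      ‖iteratedFDeriv ℝ m (u i) x‖ ≤ SchwartzMap.seminorm ℂ 0 m (u i) := fun m i x _ =>
    SchwartzMap.norm_iteratedFDeriv_le_seminorm ℂ (u i) m x
  have hsm : ∀ i, ContDiff ℝ ((⊤ : ℕ∞) : WithTop ℕ∞) (u i) := fun i => (u i).smooth ⊤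
  have hcd := contDiff_tsum (f := fun i => (u i : EuclideanSpace ℝ (Fin n) → ℂ))
    hsm (fun k _ => h 0 k) hb
  have hit := fun k => iteratedFDeriv_tsum_apply
    (f := fun i => (u i : EuclideanSpace ℝ (Fin n) → ℂ)) hsm (fun k _ => h 0 k) hb
    (k := k) le_top
  have hs : ∀ m x, Summable fun i => iteratedFDeriv ℝ m (u i) x := fun m x =>
    Summable.of_norm_bounded (h 0 m) fun i => hb m i x le_top
  -- This weighted tail estimate does double duty: with `s = ∅` it gives the decay of the sum, and
  -- as `s` grows it gives convergence in each seminorm.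
  have htail : ∀ (s : Finset ι) (k m : ℕ) (x : EuclideanSpace ℝ (Fin n)),
      ‖x‖ ^ k * ‖∑ i ∈ s, iteratedFDeriv ℝ m (u i) x - ∑' i, iteratedFDeriv ℝ m (u i) x‖ ≤
        ∑' i : {i // i ∉ s}, SchwartzMap.seminorm ℂ k m (u i) := by
    intro s k m x
    rw [← (hs m x).sum_add_tsum_subtype_compl s, sub_add_cancel_left, norm_neg,
      ← Real.norm_of_nonneg (pow_nonneg (norm_nonneg x) k), ← norm_smul]
    have e : ‖x‖ ^ k • ∑' i : {i // i ∉ s}, iteratedFDeriv ℝ m (u i) x =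
        ∑' i : {i // i ∉ s}, ‖x‖ ^ k • iteratedFDeriv ℝ m (u i) x :=
      (Summable.tsum_const_smul (‖x‖ ^ k) ((hs m x).subtype {i | i ∉ s})).symm
    rw [e]
    refine tsum_of_norm_bounded ((h k m).subtype _).hasSum fun i => ?_
    rw [norm_smul, Real.norm_of_nonneg (pow_nonneg (norm_nonneg x) k)]
    exact SchwartzMap.le_seminorm ℂ k m (u i) x
  refine ⟨⟨fun x => ∑' i, u i x, hcd, fun k m => ?_⟩, ?_⟩
  · refine ⟨∑' i : {i // i ∉ (∅ : Finset ι)}, SchwartzMap.seminorm ℂ k m (u i), fun x => ?_⟩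
    rw [hit]
    simpa using htail ∅ k m x
  · rw [HasSum, (schwartz_withSeminorms ℂ (EuclideanSpace ℝ (Fin n)) ℂ).tendsto_nhds]
    rintro ⟨k, m⟩ ε hε
    have h0 := tendsto_tsum_compl_atTop_zero fun i => SchwartzMap.seminorm ℂ k m (u i)
    filter_upwards [h0.eventually (gt_mem_nhds hε)] with s hs'
    refine lt_of_le_of_lt ?_ hs'
    refine SchwartzMap.seminorm_le_bound ℂ k m _ (tsum_nonneg fun i => by positivity) fun x => ?_
    refine le_trans (le_of_eq ?_) (htail s k m x)
    congr 2
    rw [show ((∑ i ∈ s, u i - ⟨fun x => ∑' i, u i x, hcd, _⟩ : Schw n) :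
      EuclideanSpace ℝ (Fin n) → ℂ) = (fun x => ∑ i ∈ s, u i x) - fun x => ∑' i, u i x from ?_]
    · rw [iteratedFDeriv_sub, Pi.sub_apply, hit, iteratedFDeriv_sum, Finset.sum_apply]
      · exact fun i _ => (u i).smooth _
      · exact (ContDiff.sum fun i _ => (u i).smooth m)
      · exact hcd.of_le (m := (m : WithTop ℕ∞)) (mod_cast le_top)
    · ext y
      simp
      rfl

/-- Summation of Schwartz functions with summable bounds on all words. -/
lemma exists_hasSum_of_wordBound {ι : Type*} {n : ℕ} (u : ι → Schw n) (B : ι → ℕ → ℝ)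
    (hu : ∀ i, WordBound (u i) (B i)) (hB0 : ∀ i m, 0 ≤ B i m)
    (hB : ∀ m, Summable fun i => B i m) :
    ∃ U : Schw n, HasSum u U ∧ WordBound U fun m => ∑' i, B i m := by
  obtain ⟨U, hU⟩ := SchwartzMap.exists_hasSum_of_summable_seminorm u fun k m =>
    Summable.of_nonneg_of_le (fun i => by positivity) (fun i => (hu i).seminorm_le (hB0 i) k m)
      ((((hB (k + m)).add (hB m)).mul_left _).mul_left _)
  refine ⟨U, hU, fun w x => ?_⟩
  have h1 : HasSum (fun i => weylWord w (u i) x) (weylWord w U x) := by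
    have h2 := (weylWord w).hasSum hU
    have h3 := (BoundedContinuousFunction.evalCLM ℂ x).hasSum
      ((SchwartzMap.toBoundedContinuousFunctionCLM ℂ (EuclideanSpace ℝ (Fin n)) ℂ).hasSum h2)
    exact h3
  rw [← h1.tsum_eq]
  exact tsum_of_norm_bounded (hB _).hasSum fun i => hu i w x

/-! ### The `L²` embedding and a Sobolev inequality -/

/-- The embedding of Schwartz functions into `L²`. -/
def toL2 {n : ℕ} : Schw n →L[ℂ] Lp ℂ 2 (volume : Measure (EuclideanSpace ℝ (Fin n))) :=
  SchwartzMap.toLpCLM ℂ ℂ 2 volume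

lemma toL2_apply {n : ℕ} (f : Schw n) : toL2 f = f.toLp 2 volume := rfl

lemma inner_toL2 {n : ℕ} (f g : Schw n) :
    inner ℂ (toL2 f) (toL2 g) = ∫ x, (starRingEnd ℂ) (f x) * g x := by
  have h := SchwartzMap.inner_toL2_toL2_eq f g volume
  rw [toL2_apply, toL2_apply, h]
  simp [mul_comm]

lemma norm_toL2_sq {n : ℕ} (f : Schw n) : ‖toL2 f‖ ^ 2 = ∫ x, ‖f x‖ ^ 2 := by
  have h := inner_self_eq_norm_sq_to_K (𝕜 := ℂ) (toL2 f)
  rw [inner_toL2] at h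
  have h2 : ∀ x, (starRingEnd ℂ) (f x) * f x = ((‖f x‖ ^ 2 : ℝ) : ℂ) := fun x => by
    rw [Complex.conj_mul', Complex.ofReal_pow]
  simp_rw [h2] at h
  rw [integral_complex_ofReal] at h
  refine Complex.ofReal_injective ?_
  rw [Complex.ofReal_pow]
  exact h.symm

lemma integrable_norm_sq {n : ℕ} (f : Schw n) : Integrable fun x => ‖f x‖ ^ 2 :=
  (memLp_two_iff_integrable_sq_norm f.continuous.aestronglyMeasurable).1 (f.memLp 2)

/-- Cauchy–Schwarz applied to `(1 + ‖x‖)^(-K) · (1 + ‖x‖)^K ‖f‖`. The choice `K = n + 1` makes the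
square of the first factor integrable, and the second is controlled by the powers `xᵢ^K f`. -/
lemma exists_norm_toLp_one_le (n : ℕ) : ∃ (C : ℝ) (K : ℕ), 0 ≤ C ∧ 1 ≤ K ∧ ∀ f : Schw n,
    ∫ x, ‖f x‖ ≤ C * (‖toL2 f‖ + ∑ i, ‖toL2 (weylWord (List.replicate K (Sum.inl i)) f)‖) := by
  set K := n + 1 with hK
  set A : ℝ := ∫ x : EuclideanSpace ℝ (Fin n), (1 + ‖x‖) ^ (-((2 * K : ℕ) : ℝ)) with hA
  -- The power of two comes from `(1 + r)^(2K) ≤ 2^(2K) (1 + r^(2K))`, the bracket from bounding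
  -- `‖x‖^(2K)` by coordinate powers.
  set D : ℝ := 2 ^ (2 * K) * (1 + ((n : ℝ) ^ (2 * K) + 1)) with hD
  have hA0 : 0 ≤ A := integral_nonneg fun x => by positivity
  have hAi : Integrable fun x : EuclideanSpace ℝ (Fin n) => (1 + ‖x‖) ^ (-((2 * K : ℕ) : ℝ)) := by
    refine integrable_one_add_norm ?_
    simp only [finrank_euclideanSpace, Fintype.card_fin, hK]
    exact_mod_cast (by omega)
  refine ⟨A ^ (1 / 2 : ℝ) * D ^ (1 / 2 : ℝ), K, by positivity, by omega, fun f => ?_⟩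
  set g : Fin n → Schw n := fun i => weylWord (List.replicate K (Sum.inl i)) f with hg
  set S : EuclideanSpace ℝ (Fin n) → ℝ := fun x => ‖f x‖ ^ 2 + ∑ i, ‖g i x‖ ^ 2 with hS
  have hSi : Integrable S := (integrable_norm_sq f).add
    (integrable_finsetSum _ fun i _ => integrable_norm_sq (g i))
  have hpt : ∀ x, ((1 + ‖x‖) ^ K * ‖f x‖) ^ 2 ≤ D * S x := by
    intro x
    have h1 : ‖x‖ ^ (2 * K) * ‖f x‖ ^ 2 ≤ ((n : ℝ) ^ (2 * K) + 1) * S x := by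
      refine norm_pow_mul_le_of_coord x (2 * K) (by positivity) ?_ fun i => ?_
      · simp only [hS, le_add_iff_nonneg_right]; positivity
      · have h2 : |x i| ^ (2 * K) * ‖f x‖ ^ 2 = ‖g i x‖ ^ 2 := by
          simp only [hg, weylWord_replicate_inl, norm_mul, norm_pow, Complex.norm_real,
            Real.norm_eq_abs]
          ring
        rw [h2]
        have := Finset.single_le_sum (f := fun i => ‖g i x‖ ^ 2) (fun i _ => by positivity)
          (Finset.mem_univ i)
        simp only [hS]
        have h3 : 0 ≤ ‖f x‖ ^ 2 := by positivity
        linarith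
    have h2 : (1 + ‖x‖) ^ (2 * K) ≤ 2 ^ (2 * K) * (1 + ‖x‖ ^ (2 * K)) := by
      have := add_pow_le zero_le_one (norm_nonneg x) (2 * K)
      rw [one_pow] at this
      refine this.trans ?_
      gcongr
      · norm_num
      · omega
    have h3 : ‖f x‖ ^ 2 ≤ S x := by
      simp only [hS, le_add_iff_nonneg_right]; positivity
    calc ((1 + ‖x‖) ^ K * ‖f x‖) ^ 2 = (1 + ‖x‖) ^ (2 * K) * ‖f x‖ ^ 2 := by ring
      _ ≤ 2 ^ (2 * K) * (1 + ‖x‖ ^ (2 * K)) * ‖f x‖ ^ 2 := by gcongr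
      _ = 2 ^ (2 * K) * (‖f x‖ ^ 2 + ‖x‖ ^ (2 * K) * ‖f x‖ ^ 2) := by ring
      _ ≤ 2 ^ (2 * K) * (S x + ((n : ℝ) ^ (2 * K) + 1) * S x) := by gcongr
      _ = D * S x := by rw [hD]; ring
  have hpow : ∀ x : EuclideanSpace ℝ (Fin n),
      ((1 + ‖x‖) ^ (-(K : ℝ))) ^ 2 = (1 + ‖x‖) ^ (-((2 * K : ℕ) : ℝ)) := by
    intro x
    rw [← Real.rpow_natCast, ← Real.rpow_mul (by positivity)]
    congr 1
    push_cast
    ring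
  have hcont1 : Continuous fun x : EuclideanSpace ℝ (Fin n) => (1 + ‖x‖) ^ (-(K : ℝ)) :=
    Continuous.rpow_const (by fun_prop) fun x => Or.inl (by positivity)
  have hcont2 : Continuous fun x : EuclideanSpace ℝ (Fin n) => (1 + ‖x‖) ^ K * ‖f x‖ := by
    have := f.continuous
    fun_prop
  have hi2 : Integrable fun x => ((1 + ‖x‖) ^ K * ‖f x‖) ^ 2 := by
    refine (hSi.const_mul D).mono' (hcont2.pow 2).aestronglyMeasurable
      (Filter.Eventually.of_forall fun x => ?_)
    rw [Real.norm_of_nonneg (by positivity)]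
    exact hpt x
  have hH := integral_mul_le_Lp_mul_Lq_of_nonneg (μ := (volume : Measure
    (EuclideanSpace ℝ (Fin n)))) Real.HolderConjugate.two_two
    (f := fun x => (1 + ‖x‖) ^ (-(K : ℝ))) (g := fun x => (1 + ‖x‖) ^ K * ‖f x‖)
    (Filter.Eventually.of_forall fun x => by positivity)
    (Filter.Eventually.of_forall fun x => by positivity)
    (by
      rw [ENNReal.ofReal_ofNat, memLp_two_iff_integrable_sq hcont1.aestronglyMeasurable]
      simpa only [hpow] using hAi)
    (by
      rw [ENNReal.ofReal_ofNat, memLp_two_iff_integrable_sq hcont2.aestronglyMeasurable]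
      exact hi2)
  have hl : ∀ x : EuclideanSpace ℝ (Fin n),
      (1 + ‖x‖) ^ (-(K : ℝ)) * ((1 + ‖x‖) ^ K * ‖f x‖) = ‖f x‖ := by
    intro x
    rw [Real.rpow_neg (by positivity), Real.rpow_natCast, ← mul_assoc,
      inv_mul_cancel₀ (by positivity), one_mul]
  simp only [hl, Real.rpow_two, hpow] at hH
  refine hH.trans ?_
  rw [mul_assoc]
  refine mul_le_mul_of_nonneg_left ?_ (by positivity)
  have hint : ∫ x, ((1 + ‖x‖) ^ K * ‖f x‖) ^ 2 ≤ D * (‖toL2 f‖ ^ 2 + ∑ i, ‖toL2 (g i)‖ ^ 2) := by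
    refine (integral_mono hi2 (hSi.const_mul D) hpt).trans (le_of_eq ?_)
    rw [integral_const_mul, hS, integral_add (integrable_norm_sq f)
      (integrable_finsetSum _ fun i _ => integrable_norm_sq (g i)),
      integral_finsetSum _ fun i _ => integrable_norm_sq (g i)]
    simp only [norm_toL2_sq]
  have hsq : ‖toL2 f‖ ^ 2 + ∑ i, ‖toL2 (g i)‖ ^ 2 ≤ (‖toL2 f‖ + ∑ i, ‖toL2 (g i)‖) ^ 2 := by
    have h1 : ∑ i, ‖toL2 (g i)‖ ^ 2 ≤ (∑ i, ‖toL2 (g i)‖) ^ 2 :=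
      Finset.sum_sq_le_sq_sum_of_nonneg fun i _ => norm_nonneg _
    have h2 : 0 ≤ ∑ i, ‖toL2 (g i)‖ := by positivity
    nlinarith [norm_nonneg (toL2 f), mul_nonneg (norm_nonneg (toL2 f)) h2]
  calc (∫ x, ((1 + ‖x‖) ^ K * ‖f x‖) ^ 2) ^ (1 / 2 : ℝ)
      ≤ (D * (‖toL2 f‖ + ∑ i, ‖toL2 (g i)‖) ^ 2) ^ (1 / 2 : ℝ) := by
        refine Real.rpow_le_rpow (integral_nonneg fun x => by positivity) ?_ (by norm_num)
        exact hint.trans (mul_le_mul_of_nonneg_left hsq (by positivity))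
    _ = D ^ (1 / 2 : ℝ) * (‖toL2 f‖ + ∑ i, ‖toL2 (g i)‖) := by
        rw [Real.mul_rpow (by positivity) (by positivity)]
        congr 1
        rw [← Real.sqrt_eq_rpow, Real.sqrt_sq (by positivity)]

lemma fourier_coordDeriv {n : ℕ} (i : Fin n) (f : Schw n) :
    𝓕 (coordDeriv i f) = (2 * Real.pi * Complex.I) • coordMul i (𝓕 f) := by
  rw [coordDeriv_eq, SchwartzMap.fourier_lineDerivOp_eq]
  congr 1
  ext x
  rw [SchwartzMap.smulLeftCLM_apply_apply (by fun_prop), coordMul_apply]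
  simp [EuclideanSpace.inner_single_right]

lemma fourier_iterate_coordDeriv {n : ℕ} (i : Fin n) (f : Schw n) (K : ℕ) :
    𝓕 (weylWord (List.replicate K (Sum.inr i)) f) =
      (2 * Real.pi * Complex.I) ^ K • weylWord (List.replicate K (Sum.inl i)) (𝓕 f) := by
  induction K with
  | zero => simp
  | succ K ih =>
    rw [List.replicate_succ, List.replicate_succ, weylWord_cons, weylWord_cons]
    change 𝓕 (coordDeriv i _) = _ • coordMul i _
    rw [fourier_coordDeriv, ih, map_smul, smul_smul, pow_succ']

/-- A Sobolev inequality for Schwartz functions. -/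
lemma exists_sobolev (n : ℕ) : ∃ (C : ℝ) (K : ℕ), 0 ≤ C ∧ 1 ≤ K ∧ ∀ (f : Schw n) x,
    ‖f x‖ ≤ C * (‖toL2 f‖ + ∑ i, ‖toL2 (weylWord (List.replicate K (Sum.inr i)) f)‖) := by
  obtain ⟨C, K, hC, hK, h⟩ := exists_norm_toLp_one_le n
  refine ⟨C, K, hC, hK, fun f x => ?_⟩
  -- Fourier inversion bounds `|f x|` by the `L¹` norm of `𝓕 f`. By Plancherel the coordinate powers
  -- of `𝓕 f` become derivatives of `f`; the factor `(2π)^K ≥ 1` is dropped.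
  have h1 : f x = 𝓕 (𝓕 f) (-x) := by
    have : f = 𝓕⁻ (𝓕 f) := (FourierTransform.fourierInv_fourier_eq f).symm
    conv_lhs => rw [this, SchwartzMap.fourierInv_apply_eq]
    simp
  rw [h1]
  refine (SchwartzMap.norm_fourier_apply_le_toLp_one _ _).trans ?_
  rw [SchwartzMap.norm_toLp_one]
  refine (h (𝓕 f)).trans ?_
  have hp : ∀ g : Schw n, ‖toL2 (𝓕 g)‖ = ‖toL2 g‖ := fun g =>
    SchwartzMap.norm_fourier_toL2_eq g
  rw [hp]
  gcongr with i
  rw [← hp (weylWord (List.replicate K (Sum.inr i)) f), fourier_iterate_coordDeriv, map_smul,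
    norm_smul]
  refine le_mul_of_one_le_left (norm_nonneg _) ?_
  rw [norm_pow]
  refine one_le_pow₀ ?_
  simp only [norm_mul, Complex.norm_ofNat, Complex.norm_real, Complex.norm_I, mul_one,
    Real.norm_eq_abs, abs_of_pos Real.pi_pos]
  linarith [Real.pi_gt_three]

/-! ### Abstract oscillators and bounds for their excited states -/

/-- A family of creation and annihilation operators on the Schwartz space of `ℝⁿ` together with a
vacuum vector, in terms of which the generators `xᵢ`, `∂ᵢ` are linear combinations. -/
structure Oscillator (n : ℕ) where
  create : Fin n → SchwOp n
  annih : Fin n → SchwOp n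
  vacuum : Schw n
  create_comm : ∀ i j, Commute (create i) (create j)
  annih_create : ∀ i j, annih i * create j = create j * annih i + if i = j then 1 else 0
  adjoint : ∀ i f g, inner ℂ (toL2 (annih i f)) (toL2 g) = inner ℂ (toL2 f) (toL2 (create i g))
  annih_vacuum : ∀ i, annih i vacuum = 0
  genCoeff : Fin n ⊕ Fin n → Fin n ⊕ Fin n → ℂ
  weylGen_eq : ∀ l, weylGen l = ∑ j, genCoeff l (Sum.inl j) • create j +
    ∑ j, genCoeff l (Sum.inr j) • annih j

namespace Oscillator

variable {n : ℕ} (O : Oscillator n)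

/-- The product of factorials of a multi-index, as a real number. -/
abbrev fact (k : Fin n → ℕ) : ℝ := (multiFactorial k : ℝ)

lemma fact_pos (k : Fin n → ℕ) : 0 < fact k := by
  have : 0 < multiFactorial k := Finset.prod_pos fun i _ => Nat.factorial_pos _
  exact_mod_cast this

lemma fact_add_single (k : Fin n → ℕ) (i : Fin n) :
    fact (k + Pi.single i 1) = (k i + 1) * fact k := by
  have : multiFactorial (k + Pi.single i 1) = (k i + 1) * multiFactorial k := by
    simp only [multiFactorial]
    rw [← Finset.mul_prod_erase _ _ (Finset.mem_univ i),
      ← Finset.mul_prod_erase Finset.univ (fun i => (k i).factorial) (Finset.mem_univ i),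
      ← mul_assoc]
    congr 1
    · simp [Nat.factorial_succ]
    · refine Finset.prod_congr rfl fun j hj => ?_
      simp [Finset.ne_of_mem_erase hj]
  rw [fact, this]
  push_cast
  rfl

/-- The excited states (normalised like the vacuum). -/
def state (k : Fin n → ℕ) : Schw n :=
  ((Real.sqrt (fact k))⁻¹ : ℂ) • orderedPow O.create k O.vacuum

lemma create_state (i : Fin n) (k : Fin n → ℕ) :
    O.create i (O.state k) = (Real.sqrt (k i + 1) : ℂ) • O.state (k + Pi.single i 1) := by
  have h := congrArg (fun T : SchwOp n => T O.vacuum) (mul_orderedPow O.create_comm i k)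
  simp only [mul_apply_eq_comp] at h
  rw [state, map_smul, h, state, smul_smul, fact_add_single, Real.sqrt_mul (by positivity)]
  congr 1
  have h1 : (Real.sqrt (k i + 1) : ℂ) ≠ 0 := by
    exact_mod_cast (Real.sqrt_pos.2 (by positivity)).ne'
  push_cast
  rw [mul_inv, ← mul_assoc, mul_inv_cancel₀ h1, one_mul]

/-- The annihilator kills the vacuum, so only the commutator term survives. When `k i = 0` the
truncated index does not matter, the coefficient being zero. -/
lemma annih_state (i : Fin n) (k : Fin n → ℕ) :
    O.annih i (O.state k) = (Real.sqrt (k i) : ℂ) • O.state (k - Pi.single i 1) := by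
  have h := congrArg (fun T : SchwOp n => T O.vacuum) (annihilate_orderedPow (a := O.annih i)
    (j := i) (c := O.create) (fun j hj => by
      have := O.annih_create i j
      rw [if_neg fun h => hj h.symm, add_zero] at this
      exact this) (by simpa using O.annih_create i i) k)
  simp only [mul_apply_eq_comp, add_apply] at h
  rw [O.annih_vacuum, map_zero, zero_add] at h
  rw [state, map_smul]
  rcases Nat.eq_zero_or_pos (k i) with h0 | h0
  · rw [h, h0]; simp
  · rw [h]
    set k' := k - Pi.single i 1 with hk'
    have hk : k = k' + Pi.single i 1 := by
      ext j
      by_cases hj : j = i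
      · subst hj; simp [hk']; omega
      · simp [hk', hj]
    have hki : k i = k' i + 1 := by rw [hk]; simp
    have hf : fact k = k i * fact k' := by
      conv_lhs => rw [hk, fact_add_single]
      rw [hki]; push_cast; rfl
    rw [state, hf, Real.sqrt_mul (by positivity)]
    change _ • (k i • orderedPow O.create k' O.vacuum) = _
    rw [← Nat.cast_smul_eq_nsmul ℂ, smul_smul, smul_smul]
    congr 1
    have h1 : (Real.sqrt (k i) : ℂ) ≠ 0 := by
      exact_mod_cast (Real.sqrt_pos.2 (by exact_mod_cast h0)).ne'
    have h2 : (Real.sqrt (k i) : ℂ) * (Real.sqrt (k i) : ℂ) = k i := by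
      rw [← Complex.ofReal_mul, Real.mul_self_sqrt (by positivity)]; simp
    have h3 : (Real.sqrt (fact k') : ℂ) ≠ 0 := by
      exact_mod_cast (Real.sqrt_pos.2 (fact_pos k')).ne'
    push_cast
    rw [← h2]
    field_simp

lemma number_state (i : Fin n) (k : Fin n → ℕ) :
    O.create i (O.annih i (O.state k)) = (k i : ℂ) • O.state k := by
  rw [annih_state, map_smul]
  rcases Nat.eq_zero_or_pos (k i) with h0 | h0
  · simp [h0]
  · rw [create_state, smul_smul]
    have hk : k - Pi.single i 1 + Pi.single i 1 = k := by
      ext j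
      by_cases hj : j = i
      · subst hj; simp; omega
      · simp [hj]
    rw [hk]
    congr 1
    simp only [Pi.sub_apply, Pi.single_eq_same, Nat.cast_sub h0]
    rw [Nat.cast_one, sub_add_cancel, ← Complex.ofReal_mul, Real.mul_self_sqrt (by positivity)]
    simp

@[elab_as_elim]
lemma multiIndex_induction {p : (Fin n → ℕ) → Prop} (h0 : p 0)
    (hs : ∀ k i, p k → p (k + Pi.single i 1)) (k : Fin n → ℕ) : p k := by
  induction hN : multiLength k generalizing k with
  | zero =>
    have : k = 0 := by
      ext i
      have := Finset.sum_eq_zero_iff.1 hN i (Finset.mem_univ i)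
      simpa using this
    exact this ▸ h0
  | succ N ih =>
    obtain ⟨i, hi⟩ : ∃ i, k i ≠ 0 := by
      by_contra! h
      simp [multiLength, h] at hN
    have hk : k - Pi.single i 1 + Pi.single i 1 = k := by
      ext j
      by_cases hj : j = i
      · subst hj; simp; omega
      · simp [hj]
    rw [← hk]
    refine hs _ i (ih _ ?_)
    rw [← hk] at hN
    simp only [multiLength, Pi.add_apply, Finset.sum_add_distrib, Finset.sum_pi_single',
      Finset.mem_univ, if_true] at hN ⊢
    omega

lemma state_zero : O.state 0 = O.vacuum := by
  simp [state, orderedPow_zero, fact, multiFactorial]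

/-- By adjointness the squared norm of the created state is the matrix element of annihilator times
creator, which acts as `k i + 1`. This is exactly what the square root in `create_state` normalises
away. -/
lemma norm_state (k : Fin n → ℕ) : ‖toL2 (O.state k)‖ = ‖toL2 O.vacuum‖ := by
  induction k using multiIndex_induction with
  | h0 => rw [state_zero]
  | hs k i ih =>
    have hpos : 0 < (k i + 1 : ℝ) := by positivity
    have h1 : inner ℂ (toL2 (O.create i (O.state k))) (toL2 (O.create i (O.state k))) =
        (k i + 1 : ℂ) * inner ℂ (toL2 (O.state k)) (toL2 (O.state k)) := by
      rw [← O.adjoint, create_state, map_smul, annih_state, smul_smul]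
      have : k + Pi.single i 1 - Pi.single i 1 = k := by ext j; simp
      rw [this, map_smul, inner_smul_left]
      congr 1
      simp only [Pi.add_apply, Pi.single_eq_same, Nat.cast_add, Nat.cast_one]
      rw [← Complex.ofReal_mul, Real.mul_self_sqrt hpos.le, Complex.conj_ofReal]
      push_cast; rfl
    rw [create_state, map_smul, inner_smul_left, inner_smul_right, ← mul_assoc,
      Complex.conj_ofReal, ← Complex.ofReal_mul, Real.mul_self_sqrt hpos.le,
      Complex.ofReal_add, Complex.ofReal_natCast, Complex.ofReal_one] at h1
    have h2 := mul_left_cancel₀ (by exact_mod_cast hpos.ne') h1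
    rw [inner_self_eq_norm_sq_to_K, inner_self_eq_norm_sq_to_K] at h2
    rw [← ih]
    have h3 : ‖toL2 (O.state (k + Pi.single i 1))‖ ^ 2 = ‖toL2 (O.state k)‖ ^ 2 := by
      refine Complex.ofReal_injective ?_
      rw [Complex.ofReal_pow, Complex.ofReal_pow]
      exact h2
    exact (sq_eq_sq₀ (norm_nonneg _) (norm_nonneg _)).1 h3

/-- The states are eigenvectors of the symmetric operators `create i ∘ annih i` with eigenvalues `k
i`, and some eigenvalue differs. -/
lemma inner_state_of_ne {j k : Fin n → ℕ} (h : j ≠ k) :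
    inner ℂ (toL2 (O.state j)) (toL2 (O.state k)) = 0 := by
  obtain ⟨i, hi⟩ := Function.ne_iff.1 h
  have h1 : inner ℂ (toL2 (O.state j)) (toL2 (O.create i (O.annih i (O.state k)))) =
      inner ℂ (toL2 (O.create i (O.annih i (O.state j)))) (toL2 (O.state k)) := by
    rw [← O.adjoint, ← inner_conj_symm _ (toL2 (O.state k)), ← O.adjoint, inner_conj_symm]
  rw [number_state, number_state, map_smul, map_smul, inner_smul_left, inner_smul_right] at h1
  by_contra hne
  have h2 := mul_right_cancel₀ hne h1
  rw [Complex.conj_natCast] at h2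
  exact hi (by exact_mod_cast h2.symm)

/-- A common bound for the coefficients of the generators. -/
def coeffBound : ℝ := 1 + ∑ l, ∑ j, ‖O.genCoeff l j‖

lemma one_le_coeffBound : 1 ≤ O.coeffBound := by
  rw [coeffBound, le_add_iff_nonneg_right]; positivity

lemma sum_coeff_le (l : Fin n ⊕ Fin n) :
    ∑ j, ‖O.genCoeff l (Sum.inl j)‖ + ∑ j, ‖O.genCoeff l (Sum.inr j)‖ ≤ O.coeffBound := by
  rw [← Fintype.sum_sum_type (fun j => ‖O.genCoeff l j‖), coeffBound]
  have := Finset.single_le_sum (f := fun l => ∑ j, ‖O.genCoeff l j‖)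
    (fun i _ => by positivity) (Finset.mem_univ l)
  linarith

lemma multiLength_add_single (k : Fin n → ℕ) (i : Fin n) :
    multiLength (k + Pi.single i 1) = multiLength k + 1 := by
  simp [multiLength, Finset.sum_add_distrib]

lemma multiLength_sub_single_le (k : Fin n → ℕ) (i : Fin n) :
    multiLength (k - Pi.single i 1) ≤ multiLength k :=
  Finset.sum_le_sum fun j _ => by simp

lemma le_multiLength (k : Fin n → ℕ) (i : Fin n) : k i ≤ multiLength k :=
  Finset.single_le_sum (f := k) (fun _ _ => Nat.zero_le _) (Finset.mem_univ i)

/-- Each letter moves a state to neighbouring states with coefficients at most the square root of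
`|k| + 1`. After `m` letters these square roots multiply to at most `√((|k| + m)^m)`; only half a
power of `|k|` is lost per letter. The induction removes the last letter, the one that acts on the
state itself. -/
lemma norm_weylWord_state_le (w : List (Fin n ⊕ Fin n)) (k : Fin n → ℕ) :
    ‖toL2 (weylWord w (O.state k))‖ ≤ ‖toL2 O.vacuum‖ * O.coeffBound ^ w.length *
      Real.sqrt ((multiLength k + w.length : ℝ) ^ w.length) := by
  have hτ := O.one_le_coeffBound
  induction w using List.reverseRecOn generalizing k with
  | nil => simp [norm_state]
  | append_singleton w l ih =>
    set m := w.length with hm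
    set T := ‖toL2 O.vacuum‖ * O.coeffBound ^ m *
      Real.sqrt ((multiLength k + (m + 1) : ℝ) ^ (m + 1)) with hT
    -- One estimate covers both creation and annihilation: the new index has length at most `|k| +
    -- 1` and the coefficient is the square root of some `c ≤ |k| + 1`.
    have hmono : ∀ k' : Fin n → ℕ, multiLength k' ≤ multiLength k + 1 → ∀ c : ℝ, 0 ≤ c →
        c ≤ multiLength k + 1 →
        Real.sqrt c * ‖toL2 (weylWord w (O.state k'))‖ ≤ T := by
      intro k' hk' c hc0 hc
      have hk'' : (multiLength k' : ℝ) ≤ multiLength k + 1 := by exact_mod_cast hk'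
      have h1 : Real.sqrt c ≤ Real.sqrt (multiLength k + (m + 1)) :=
        Real.sqrt_le_sqrt (by linarith [Nat.cast_nonneg (α := ℝ) m])
      have h2 : Real.sqrt ((multiLength k' + m : ℝ) ^ m) ≤
          Real.sqrt ((multiLength k + (m + 1) : ℝ) ^ m) := by
        refine Real.sqrt_le_sqrt ?_
        gcongr ?_ ^ m
        linarith
      calc Real.sqrt c * ‖toL2 (weylWord w (O.state k'))‖
          ≤ Real.sqrt (multiLength k + (m + 1)) * (‖toL2 O.vacuum‖ * O.coeffBound ^ m *
            Real.sqrt ((multiLength k + (m + 1) : ℝ) ^ m)) := by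
            refine mul_le_mul h1 ((ih k').trans ?_) (norm_nonneg _) (Real.sqrt_nonneg _)
            gcongr
        _ = T := by
            rw [hT, pow_succ (multiLength k + (m + 1) : ℝ), Real.sqrt_mul (by positivity)]
            ring
    have hT0 : 0 ≤ T := by positivity
    rw [weylWord_append]
    have h1 : weylWord [l] (O.state k) = ∑ j, O.genCoeff l (Sum.inl j) • O.create j (O.state k) +
        ∑ j, O.genCoeff l (Sum.inr j) • O.annih j (O.state k) := by
      rw [weylWord_cons, weylWord_nil, O.weylGen_eq]
      simp
    rw [h1]
    simp only [create_state, annih_state, map_add, map_sum, map_smul]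
    refine (norm_add_le _ _).trans ?_
    calc _ ≤ ∑ j, ‖O.genCoeff l (Sum.inl j)‖ * T + ∑ j, ‖O.genCoeff l (Sum.inr j)‖ * T := by
          refine add_le_add ((norm_sum_le _ _).trans (Finset.sum_le_sum fun j _ => ?_))
            ((norm_sum_le _ _).trans (Finset.sum_le_sum fun j _ => ?_))
          · rw [norm_smul, norm_smul, Complex.norm_real, Real.norm_of_nonneg (Real.sqrt_nonneg _)]
            refine mul_le_mul_of_nonneg_left (hmono _ (multiLength_add_single k j).le _
              (by positivity) ?_) (norm_nonneg _)
            have : (k j : ℝ) ≤ multiLength k := by exact_mod_cast le_multiLength k j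
            linarith
          · rw [norm_smul, norm_smul, Complex.norm_real, Real.norm_of_nonneg (Real.sqrt_nonneg _)]
            refine mul_le_mul_of_nonneg_left (hmono _
              ((multiLength_sub_single_le k j).trans (Nat.le_succ _)) _
              (by positivity) ?_) (norm_nonneg _)
            have : (k j : ℝ) ≤ multiLength k := by exact_mod_cast le_multiLength k j
            linarith
      _ = (∑ j, ‖O.genCoeff l (Sum.inl j)‖ + ∑ j, ‖O.genCoeff l (Sum.inr j)‖) * T := by
          rw [add_mul, Finset.sum_mul, Finset.sum_mul]
      _ ≤ O.coeffBound * T := by gcongr; exact O.sum_coeff_le l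
      _ = _ := by
          rw [hT]
          simp only [List.length_append, List.length_singleton, ← hm]
          push_cast
          ring

/-- The excited states satisfy uniform bounds on all words. -/
lemma exists_wordBound_state : ∃ (C : ℝ) (K : ℕ), 0 ≤ C ∧ ∀ k, WordBound (O.state k)
    fun m => C * O.coeffBound ^ m * Real.sqrt ((multiLength k + m + K : ℝ) ^ (m + K)) := by
  obtain ⟨C, K, hC, hK, hS⟩ := exists_sobolev n
  have hτ := O.one_le_coeffBound
  refine ⟨C * (1 + n) * ‖toL2 O.vacuum‖ * O.coeffBound ^ K, K, by positivity, fun k w x => ?_⟩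
  refine (hS _ x).trans ?_
  set T := ‖toL2 O.vacuum‖ * O.coeffBound ^ (w.length + K) *
    Real.sqrt ((multiLength k + w.length + K : ℝ) ^ (w.length + K)) with hT
  have h1 : ‖toL2 (weylWord w (O.state k))‖ ≤ T := by
    refine (O.norm_weylWord_state_le w k).trans ?_
    -- Here `K ≥ 1` is needed: with base at least one the exponent may be raised from the word
    -- length to the word length plus `K`.
    have hb : (1 : ℝ) ≤ multiLength k + w.length + K := by
      have : (1 : ℝ) ≤ K := by exact_mod_cast hK
      have h2 : (0 : ℝ) ≤ multiLength k + w.length := by positivity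
      linarith
    have h3 : ((multiLength k + w.length : ℝ)) ^ w.length ≤
        (multiLength k + w.length + K : ℝ) ^ (w.length + K) := by
      calc ((multiLength k + w.length : ℝ)) ^ w.length
          ≤ (multiLength k + w.length + K : ℝ) ^ w.length := by
            gcongr ?_ ^ _
            simp
        _ ≤ _ := pow_le_pow_right₀ hb (by omega)
    have h4 : O.coeffBound ^ w.length ≤ O.coeffBound ^ (w.length + K) :=
      pow_le_pow_right₀ hτ (by omega)
    rw [hT]
    gcongr
  have h2 : ∀ i, ‖toL2 (weylWord (List.replicate K (Sum.inr i))
      (weylWord w (O.state k)))‖ ≤ T := by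
    intro i
    rw [← weylWord_append]
    refine (O.norm_weylWord_state_le _ k).trans (le_of_eq ?_)
    rw [hT, List.length_append, List.length_replicate, add_comm K]
    push_cast
    rw [add_assoc]
  calc _ ≤ C * (T + ∑ _i : Fin n, T) := by gcongr with i; exact h2 i
    _ = _ := by
      rw [hT]
      simp only [Finset.sum_const, Finset.card_univ, Fintype.card_fin, nsmul_eq_mul, pow_add]
      ring

end Oscillator

/-! ### Gaussian-type functions in the Schwartz space -/

lemma norm_iteratedFDeriv_cexp_le (m : ℕ) (z : ℂ) :
    ‖iteratedFDeriv ℝ m Complex.exp z‖ ≤ Real.exp z.re := by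
  induction m with
  | zero => simp [Complex.norm_exp]
  | succ m ih =>
    set L : ℂ →L[ℝ] (ℂ →L[ℝ] ℂ) := ContinuousLinearMap.mul ℝ ℂ with hL
    have h : fderiv ℝ Complex.exp = L ∘ Complex.exp := by
      ext z w
      have := ((Complex.hasDerivAt_exp z).hasFDerivAt.restrictScalars ℝ).fderiv
      rw [this]
      simp [hL, mul_comm]
    rw [← norm_iteratedFDeriv_fderiv, h]
    refine (ContinuousLinearMap.norm_iteratedFDeriv_comp_left L (N := m)
      (Complex.contDiff_exp.contDiffAt) le_rfl).trans ?_
    refine (mul_le_of_le_one_left (norm_nonneg _) ?_).trans ih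
    exact ContinuousLinearMap.opNorm_mul_le ℝ ℂ

/-- From `y^N / N! ≤ exp y` at `y = b (1 + r²)`. -/
lemma one_add_pow_mul_exp_le {b : ℝ} (hb : 0 < b) (N : ℕ) {r : ℝ} (hr : 0 ≤ r) :
    (1 + r) ^ N * Real.exp (-b * r ^ 2) ≤ 2 ^ N * (N.factorial / b ^ N * Real.exp b) := by
  have h1 : (1 + r) ≤ 2 * (1 + r ^ 2) := by nlinarith [sq_nonneg (r - 1)]
  have h2 : (1 + r) ^ N ≤ 2 ^ N * (1 + r ^ 2) ^ N := by
    rw [← mul_pow]; gcongr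
  have h3 := Real.pow_div_factorial_le_exp (b * (1 + r ^ 2)) (by positivity) N
  have h4 : (1 + r ^ 2) ^ N ≤ N.factorial / b ^ N * Real.exp (b * (1 + r ^ 2)) := by
    rw [div_mul_eq_mul_div, le_div_iff₀ (by positivity)]
    rw [div_le_iff₀ (by positivity), mul_pow] at h3
    linarith
  calc (1 + r) ^ N * Real.exp (-b * r ^ 2)
      ≤ 2 ^ N * (N.factorial / b ^ N * Real.exp (b * (1 + r ^ 2))) * Real.exp (-b * r ^ 2) := by
        gcongr
        exact h2.trans (by gcongr)
    _ = 2 ^ N * (N.factorial / b ^ N * (Real.exp (b * (1 + r ^ 2)) * Real.exp (-b * r ^ 2))) := by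
        ring
    _ = _ := by
        rw [← Real.exp_add]
        congr 4
        ring

/-- The exponential of a function of temperate growth with real part at most `-b|x|²` is a
Schwartz function. -/
def expSchwartz {n : ℕ} (q : EuclideanSpace ℝ (Fin n) → ℂ) (hq : q.HasTemperateGrowth) {b : ℝ}
    (hb : 0 < b) (hre : ∀ x, (q x).re ≤ -b * ‖x‖ ^ 2) : Schw n where
  toFun := fun x => Complex.exp (q x)
  smooth' := Complex.contDiff_exp.comp hq.1
  decay' := by
    intro k m
    obtain ⟨l, C, hC, hD⟩ := hq.norm_iteratedFDeriv_le_uniform m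
    refine ⟨m.factorial * (C + 1) ^ m * (2 ^ (k + l * m) *
      ((k + l * m).factorial / b ^ (k + l * m) * Real.exp b)), fun x => ?_⟩
    -- A Faà di Bruno estimate. The constant `C + 1` keeps the bound for the derivatives of `q` at
    -- least one, hence below its own positive powers, as the estimate requires.
    have h1 := norm_iteratedFDeriv_comp_le (𝕜 := ℝ) (g := Complex.exp) (f := q) (n := m)
      (N := ∞) Complex.contDiff_exp hq.1 (mod_cast le_top) x (C := Real.exp (q x).re)
      (D := (C + 1) * (1 + ‖x‖) ^ l) (fun i _ => norm_iteratedFDeriv_cexp_le i _)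
      (fun i hi1 hi2 => by
        refine (hD i hi2 x).trans ?_
        have h2 : C * (1 + ‖x‖) ^ l ≤ (C + 1) * (1 + ‖x‖) ^ l := by gcongr; linarith
        have h3 : 1 ≤ (C + 1) * (1 + ‖x‖) ^ l := by
          refine one_le_mul_of_one_le_of_one_le (by linarith) (one_le_pow₀ ?_)
          simp
        exact h2.trans (le_self_pow₀ h3 (by omega)))
    have h4 : ‖x‖ ^ k ≤ (1 + ‖x‖) ^ k := by gcongr; simp
    calc ‖x‖ ^ k * ‖iteratedFDeriv ℝ m (fun x => Complex.exp (q x)) x‖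
        ≤ (1 + ‖x‖) ^ k * (m.factorial * Real.exp (-b * ‖x‖ ^ 2) *
          ((C + 1) * (1 + ‖x‖) ^ l) ^ m) := by
          refine mul_le_mul h4 (h1.trans ?_) (norm_nonneg _) (by positivity)
          gcongr
          exact hre x
      _ = m.factorial * (C + 1) ^ m * ((1 + ‖x‖) ^ (k + l * m) * Real.exp (-b * ‖x‖ ^ 2)) := by
          rw [mul_pow, pow_add, pow_mul]; ring
      _ ≤ _ := by
          exact mul_le_mul_of_nonneg_left (one_add_pow_mul_exp_le hb _ (norm_nonneg x))
            (by positivity)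

@[simp] lemma expSchwartz_apply {n : ℕ} (q : EuclideanSpace ℝ (Fin n) → ℂ)
    (hq : q.HasTemperateGrowth) {b : ℝ} (hb : 0 < b) (hre : ∀ x, (q x).re ≤ -b * ‖x‖ ^ 2)
    (x : EuclideanSpace ℝ (Fin n)) : expSchwartz q hq hb hre x = Complex.exp (q x) := rfl

lemma coordDeriv_expSchwartz {n : ℕ} {q : EuclideanSpace ℝ (Fin n) → ℂ}
    (hq : q.HasTemperateGrowth) {b : ℝ} (hb : 0 < b) (hre : ∀ x, (q x).re ≤ -b * ‖x‖ ^ 2)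
    (i : Fin n) (x : EuclideanSpace ℝ (Fin n)) :
    coordDeriv i (expSchwartz q hq hb hre) x =
      fderiv ℝ q x (EuclideanSpace.single i 1) * Complex.exp (q x) := by
  have h := ((hq.1.differentiable (by simp)) x).hasFDerivAt.cexp
  rw [coordDeriv_apply]
  change fderiv ℝ (fun x => Complex.exp (q x)) x _ = _
  rw [h.fderiv]
  simp [mul_comm]

lemma inner_coordMul {n : ℕ} (i : Fin n) (f g : Schw n) :
    inner ℂ (toL2 (coordMul i f)) (toL2 g) = inner ℂ (toL2 f) (toL2 (coordMul i g)) := by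
  rw [inner_toL2, inner_toL2]
  congr 1
  ext x
  simp
  ring

lemma inner_coordDeriv {n : ℕ} (i : Fin n) (f g : Schw n) :
    inner ℂ (toL2 (coordDeriv i f)) (toL2 g) = -inner ℂ (toL2 f) (toL2 (coordDeriv i g)) := by
  rw [inner_toL2, inner_toL2]
  have := SchwartzMap.integral_bilinear_lineDerivOp_right_eq_neg_left (μ := volume) f g
    ((ContinuousLinearMap.mul ℝ ℂ).comp (Complex.conjCLE : ℂ →L[ℝ] ℂ))
    (EuclideanSpace.single i (1 : ℝ))
  simp only [coordDeriv_eq]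
  simp only [ContinuousLinearMap.comp_apply, ContinuousLinearMap.mul_apply'] at this
  rw [eq_neg_iff_add_eq_zero, add_comm, ← eq_neg_iff_add_eq_zero]
  exact this

/-! ### From canonical pairs to oscillators; the harmonic oscillator -/

namespace Oscillator

/-- The two cross terms each contribute one `δ`, and `α² = 1/2` cancels the resulting factor two.
The same `δ` may occur in both relations because the Kronecker delta is symmetric. -/
lemma ofCanonical_comm_aux {R : Type*} [Ring R] [Algebra ℂ R] {P Q P' Q' δ : R} (α : ℂ)
    (hα : α * α = 1 / 2)
    (hP : Commute P P') (hQ : Commute Q Q') (h1 : Q * P' = P' * Q + δ) (h2 : Q' * P = P * Q' + δ) :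
    (α • (P + Q)) * (α • (P' - Q')) = (α • (P' - Q')) * (α • (P + Q)) + δ := by
  have h3 : (P + Q) * (P' - Q') = (P' - Q') * (P + Q) + (2 : ℂ) • δ := by
    have e1 : (P + Q) * (P' - Q') = P * P' + Q * P' - P * Q' - Q * Q' := by noncomm_ring
    have e2 : (P' - Q') * (P + Q) = P' * P + P' * Q - Q' * P - Q' * Q := by noncomm_ring
    rw [e1, e2, h1, h2, hP.eq, hQ.eq, two_smul]
    abel
  rw [smul_mul_smul_comm, smul_mul_smul_comm, hα, h3, smul_add, smul_smul]
  norm_num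

lemma ofCanonical_create_comm_aux {R : Type*} [Ring R] [Algebra ℂ R] {P Q P' Q' δ : R} (α : ℂ)
    (hP : Commute P P') (hQ : Commute Q Q') (h1 : Q * P' = P' * Q + δ) (h2 : Q' * P = P * Q' + δ) :
    Commute (α • (P - Q)) (α • (P' - Q')) := by
  refine Commute.smul_left (Commute.smul_right ?_ _) _
  have e1 : (P - Q) * (P' - Q') = P * P' - Q * P' - P * Q' + Q * Q' := by noncomm_ring
  have e2 : (P' - Q') * (P - Q) = P' * P - P' * Q - Q' * P + Q' * Q := by noncomm_ring
  rw [Commute, SemiconjBy, e1, e2, h1, h2, hP.eq, hQ.eq]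
  abel

lemma inv_sqrt_two_mul_self : ((Real.sqrt 2 : ℂ)⁻¹) * (Real.sqrt 2 : ℂ)⁻¹ = 1 / 2 := by
  rw [← mul_inv, ← Complex.ofReal_mul, Real.mul_self_sqrt (by norm_num)]
  norm_num

/-- The oscillator of a canonical system of symmetric operators `Pᵢ` and antisymmetric operators
`Qᵢ` with `[Qᵢ, Pⱼ] = δᵢⱼ`. -/
def ofCanonical {n : ℕ} (P Q : Fin n → SchwOp n) (vacuum : Schw n)
    (hP : ∀ i j, Commute (P i) (P j)) (hQ : ∀ i j, Commute (Q i) (Q j))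
    (hQP : ∀ i j, Q i * P j = P j * Q i + if i = j then 1 else 0)
    (hPadj : ∀ i f g, inner ℂ (toL2 (P i f)) (toL2 g) = inner ℂ (toL2 f) (toL2 (P i g)))
    (hQadj : ∀ i f g, inner ℂ (toL2 (Q i f)) (toL2 g) = -inner ℂ (toL2 f) (toL2 (Q i g)))
    (hvac : ∀ i, P i vacuum + Q i vacuum = 0)
    (hgen : ∀ l, ∃ p q : Fin n → ℂ, weylGen l = ∑ j, p j • P j + ∑ j, q j • Q j) :
    Oscillator n where
  create := fun i => (Real.sqrt 2 : ℂ)⁻¹ • (P i - Q i)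
  annih := fun i => (Real.sqrt 2 : ℂ)⁻¹ • (P i + Q i)
  vacuum := vacuum
  create_comm := fun i j => by
    refine ofCanonical_create_comm_aux _ (hP i j) (hQ i j) (hQP i j) ?_
    rw [hQP]
    simp only [eq_comm]
  annih_create := fun i j => by
    refine ofCanonical_comm_aux _ inv_sqrt_two_mul_self (hP i j) (hQ i j) (hQP i j) ?_
    rw [hQP]
    simp only [eq_comm]
  adjoint := fun i f g => by
    simp only [smul_apply, add_apply, sub_apply, map_smul, map_add, map_sub]
    rw [inner_smul_left, inner_smul_right, inner_add_left, inner_sub_right, hPadj, hQadj,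
      ← Complex.ofReal_inv, Complex.conj_ofReal, sub_eq_add_neg]
  annih_vacuum := fun i => by
    rw [smul_apply, add_apply, hvac, smul_zero]
  -- Obtained by inverting the definition: `P` is the sum of annihilator and creator over `√2`, and
  -- `Q` is annihilator minus creator over `√2`.
  genCoeff := fun l => Sum.elim
    (fun j => (Real.sqrt 2 : ℂ)⁻¹ * ((hgen l).choose j - (hgen l).choose_spec.choose j))
    (fun j => (Real.sqrt 2 : ℂ)⁻¹ * ((hgen l).choose j + (hgen l).choose_spec.choose j))
  weylGen_eq := fun l => by
    conv_lhs => rw [(hgen l).choose_spec.choose_spec]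
    rw [← Finset.sum_add_distrib, ← Finset.sum_add_distrib]
    refine Finset.sum_congr rfl fun j _ => ?_
    set p := (hgen l).choose j
    set q := (hgen l).choose_spec.choose j
    set α := (Real.sqrt 2 : ℂ)⁻¹ with hα
    have h2 : α * α = 1 / 2 := inv_sqrt_two_mul_self
    simp only [Sum.elim_inl, Sum.elim_inr, smul_smul]
    have e1 : α * (p - q) * α = (p - q) / 2 := by
      rw [mul_right_comm, h2]; ring
    have e2 : α * (p + q) * α = (p + q) / 2 := by
      rw [mul_right_comm, h2]; ring
    rw [e1, e2]
    module

end Oscillator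

lemma hasFDerivAt_const_mul_norm_sq {n : ℕ} (x : EuclideanSpace ℝ (Fin n)) (c : ℂ) :
    HasFDerivAt (fun x : EuclideanSpace ℝ (Fin n) => c * ((‖x‖ ^ 2 : ℝ) : ℂ))
      (c • (Complex.ofRealCLM ∘L (2 • innerSL ℝ x))) x := by
  have h := (Complex.ofRealCLM.hasFDerivAt.comp x (hasStrictFDerivAt_norm_sq x).hasFDerivAt)
  exact h.const_mul c

lemma hasTemperateGrowth_const_mul_norm_sq {n : ℕ} (c : ℂ) :
    (fun x : EuclideanSpace ℝ (Fin n) => c * ((‖x‖ ^ 2 : ℝ) : ℂ)).HasTemperateGrowth :=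
  (Function.HasTemperateGrowth.const c).mul (Function.HasTemperateGrowth.comp
    Function.Complex.hasTemperateGrowth_ofReal (Function.hasTemperateGrowth_norm_sq _))

/-- The Gaussian `exp (-|x|² / 2)`. -/
def stdGaussian (n : ℕ) : Schw n :=
  expSchwartz (fun x => (-1 / 2 : ℂ) * ((‖x‖ ^ 2 : ℝ) : ℂ))
    (hasTemperateGrowth_const_mul_norm_sq _) (b := 1 / 2) (by norm_num) fun x => by
      rw [show (-1 / 2 : ℂ) = ((-1 / 2 : ℝ) : ℂ) by push_cast; rfl, Complex.re_ofReal_mul,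
        Complex.ofReal_re]
      linarith

/-- The harmonic oscillator on `ℝⁿ`. -/
def stdOscillator (n : ℕ) : Oscillator n :=
  Oscillator.ofCanonical coordMul coordDeriv (stdGaussian n) coordMul_comm coordDeriv_comm
    coordDeriv_mul_coordMul inner_coordMul inner_coordDeriv
    (fun i => by
      ext x
      rw [add_apply, coordMul_apply, stdGaussian, coordDeriv_expSchwartz,
        (hasFDerivAt_const_mul_norm_sq x _).fderiv, expSchwartz_apply]
      simp [EuclideanSpace.inner_single_right]
      ring)
    (fun l => by
      rcases l with i | i
      · refine ⟨Pi.single i 1, 0, ?_⟩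
        simp [weylGen, Pi.single_apply]
      · refine ⟨0, Pi.single i 1, ?_⟩
        simp [weylGen, Pi.single_apply])

/-! ### Hermite-type expansions and completeness -/

/-- Every finite set of multi-indices lies in a cube, on which the sum factorises. -/
lemma summable_prod_pi {n : ℕ} {g : ℕ → ℝ} (hg : Summable g) (h0 : ∀ m, 0 ≤ g m) :
    Summable fun k : Fin n → ℕ => ∏ i, g (k i) := by
  refine summable_of_sum_le (c := (∑' m, g m) ^ n)
    (fun k => Finset.prod_nonneg fun i _ => h0 _) fun s => ?_
  obtain ⟨N, hN⟩ : ∃ N, ∀ k ∈ s, ∀ i, k i < N := by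
    refine ⟨s.sup (fun k => Finset.univ.sup k) + 1, fun k hk i => Nat.lt_succ_of_le ?_⟩
    exact (Finset.le_sup (f := k) (Finset.mem_univ i)).trans
      (Finset.le_sup (f := fun k => Finset.univ.sup k) hk)
  calc ∑ k ∈ s, ∏ i, g (k i)
      ≤ ∑ k ∈ Fintype.piFinset fun _ : Fin n => Finset.range N, ∏ i, g (k i) := by
        refine Finset.sum_le_sum_of_subset_of_nonneg (fun k hk => ?_)
          fun k _ _ => Finset.prod_nonneg fun i _ => h0 _
        simp only [Fintype.mem_piFinset, Finset.mem_range]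
        exact hN k hk
    _ = (∑ m ∈ Finset.range N, g m) ^ n := by
        rw [← Finset.prod_univ_sum]
        simp
    _ ≤ _ := by
        gcongr
        · exact Finset.sum_nonneg fun i _ => h0 i
        · exact hg.sum_le_tsum _ fun i _ => h0 i

/-- The exponent gives each of the `n` coordinates a power two: `1 + |k|` dominates every `k i + 1`.
-/
lemma summable_one_add_multiLength (n : ℕ) :
    Summable fun k : Fin n → ℕ => (((1 + multiLength k : ℕ) : ℝ) ^ (2 * n))⁻¹ := by
  have hg : Summable fun m : ℕ => (((m + 1 : ℕ) : ℝ) ^ 2)⁻¹ :=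
    (summable_nat_add_iff 1).2 (Real.summable_nat_pow_inv.2 (by norm_num : 1 < 2))
  refine Summable.of_nonneg_of_le (fun k => by positivity) (fun k => ?_)
    (summable_prod_pi (n := n) hg fun m => by positivity)
  rw [Finset.prod_inv_distrib]
  refine inv_anti₀ (Finset.prod_pos fun i _ => by positivity) ?_
  rw [pow_mul]
  calc ∏ i, (((k i + 1 : ℕ) : ℝ)) ^ 2 ≤ ∏ _i : Fin n, (((1 + multiLength k : ℕ) : ℝ)) ^ 2 := by
        refine Finset.prod_le_prod (fun i _ => by positivity) fun i _ => ?_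
        have := Oscillator.le_multiLength k i
        have h2 : ((k i + 1 : ℕ) : ℝ) ≤ ((1 + multiLength k : ℕ) : ℝ) := by
          exact_mod_cast (by omega)
        gcongr
    _ = _ := by simp

namespace Oscillator

variable {n : ℕ} (O : Oscillator n)

/-- The total number operator. -/
def number : SchwOp n := ∑ i, O.create i * O.annih i

lemma number_apply_state (k : Fin n → ℕ) :
    O.number (O.state k) = (multiLength k : ℂ) • O.state k := by
  have h : O.number (O.state k) = ∑ i, O.create i (O.annih i (O.state k)) := by
    simp [number, sum_apply]
  rw [h]
  simp only [number_state, ← Finset.sum_smul, multiLength]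
  push_cast
  rfl

lemma inner_number (f g : Schw n) :
    inner ℂ (toL2 (O.number f)) (toL2 g) = inner ℂ (toL2 f) (toL2 (O.number g)) := by
  have h : ∀ f, O.number f = ∑ i, O.create i (O.annih i f) := fun f => by
    simp [number, sum_apply]
  rw [h, h, map_sum, map_sum, sum_inner, inner_sum]
  refine Finset.sum_congr rfl fun i _ => ?_
  rw [← O.adjoint, ← inner_conj_symm _ (toL2 g), ← O.adjoint, inner_conj_symm]

/-- The coefficients of a Schwartz function with respect to the excited states. -/
def coeff (f : Schw n) (k : Fin n → ℕ) : ℂ := inner ℂ (toL2 (O.state k)) (toL2 f)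

lemma one_add_mul_coeff (f : Schw n) (k : Fin n → ℕ) (r : ℕ) :
    ((1 + multiLength k : ℕ) : ℂ) ^ r * O.coeff f k = O.coeff (((1 + O.number) ^ r) f) k := by
  induction r generalizing f with
  | zero => simp
  | succ r ih =>
    rw [pow_succ, mul_assoc, pow_succ, mul_apply_eq_comp, ← ih]
    congr 1
    rw [coeff, coeff, add_apply, map_add, inner_add_right, ← inner_number, number_apply_state,
      map_smul, inner_smul_left]
    simp
    ring

/-- Rapid decay: the symmetric operator `(1 + N)^r` can be moved onto the state, where it acts as
the scalar `(1 + |k|)^r`; Cauchy–Schwarz does the rest. -/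
lemma exists_coeff_le (f : Schw n) (r : ℕ) :
    ∃ C : ℝ, 0 ≤ C ∧ ∀ k, ‖O.coeff f k‖ ≤ C * (((1 + multiLength k : ℕ) : ℝ) ^ r)⁻¹ := by
  refine ⟨‖toL2 O.vacuum‖ * ‖toL2 (((1 + O.number) ^ r) f)‖, by positivity, fun k => ?_⟩
  have h := congrArg norm (O.one_add_mul_coeff f k r)
  rw [norm_mul, norm_pow, Complex.norm_natCast] at h
  rw [← div_eq_mul_inv, le_div_iff₀ (by positivity), mul_comm, h, coeff, ← O.norm_state k]
  exact norm_inner_le_norm _ _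

lemma sqrt_pow_le (κ m K : ℕ) : Real.sqrt ((κ + m + K : ℝ) ^ (m + K)) ≤
    ((m + K + 1 : ℕ) : ℝ) ^ (m + K) * ((1 + κ : ℕ) : ℝ) ^ (m + K) := by
  have h1 : (κ + m + K : ℝ) ≤ ((m + K + 1 : ℕ) : ℝ) * ((1 + κ : ℕ) : ℝ) := by
    push_cast
    nlinarith [Nat.cast_nonneg (α := ℝ) κ, Nat.cast_nonneg (α := ℝ) m,
      Nat.cast_nonneg (α := ℝ) K, mul_nonneg (Nat.cast_nonneg (α := ℝ) m)
      (Nat.cast_nonneg (α := ℝ) κ), mul_nonneg (Nat.cast_nonneg (α := ℝ) K)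
      (Nat.cast_nonneg (α := ℝ) κ)]
  have h2 : (1 : ℝ) ≤ ((m + K + 1 : ℕ) : ℝ) * ((1 + κ : ℕ) : ℝ) := by
    exact_mod_cast Nat.one_le_iff_ne_zero.2 (by positivity)
  have h3 : (κ + m + K : ℝ) ^ (m + K) ≤ (((m + K + 1 : ℕ) : ℝ) * ((1 + κ : ℕ) : ℝ)) ^ (m + K) := by
    gcongr
  rw [← mul_pow]
  refine (Real.sqrt_le_sqrt h3).trans ?_
  refine Real.sqrt_le_iff.2 ⟨by positivity, ?_⟩
  exact le_self_pow₀ (one_le_pow₀ h2) two_ne_zero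

lemma _root_.WordBound.smul {n : ℕ} {f : Schw n} {M : ℕ → ℝ} (h : WordBound f M) (c : ℂ) :
    WordBound (c • f) fun m => ‖c‖ * M m := by
  intro w x
  rw [map_smul, smul_apply, norm_smul]
  exact mul_le_mul_of_nonneg_left (h w x) (norm_nonneg _)

/-- Series of excited states with rapidly decreasing coefficients converge. -/
lemma exists_hasSum_smul_state (β : (Fin n → ℕ) → ℂ)
    (hβ : ∀ r : ℕ, ∃ C : ℝ, 0 ≤ C ∧ ∀ k, ‖β k‖ ≤ C * (((1 + multiLength k : ℕ) : ℝ) ^ r)⁻¹) :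
    ∃ U : Schw n, HasSum (fun k => β k • O.state k) U := by
  obtain ⟨C, K, hC, hK⟩ := O.exists_wordBound_state
  have hτ : 0 ≤ O.coeffBound := zero_le_one.trans O.one_le_coeffBound
  suffices h : ∀ m : ℕ, Summable fun k => ‖β k‖ * (C * O.coeffBound ^ m *
      Real.sqrt ((multiLength k + m + K : ℝ) ^ (m + K))) by
    obtain ⟨U, hU, -⟩ := exists_hasSum_of_wordBound (fun k => β k • O.state k) _
      (fun k => (hK k).smul (β k)) (fun k m => by positivity) h
    exact ⟨U, hU⟩
  intro m
  obtain ⟨D, hD, hDβ⟩ := hβ (m + K + 2 * n)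
  refine Summable.of_nonneg_of_le (fun k => by positivity) (fun k => ?_)
    ((summable_one_add_multiLength n).mul_left
      (D * (C * O.coeffBound ^ m * ((m + K + 1 : ℕ) : ℝ) ^ (m + K))))
  calc ‖β k‖ * (C * O.coeffBound ^ m * Real.sqrt ((multiLength k + m + K : ℝ) ^ (m + K)))
      ≤ D * (((1 + multiLength k : ℕ) : ℝ) ^ (m + K + 2 * n))⁻¹ * (C * O.coeffBound ^ m *
        (((m + K + 1 : ℕ) : ℝ) ^ (m + K) * ((1 + multiLength k : ℕ) : ℝ) ^ (m + K))) := by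
        gcongr
        · exact hDβ k
        · exact sqrt_pow_le _ _ _
    _ = _ := by
        have h1 : ((1 + multiLength k : ℕ) : ℝ) ^ (m + K) ≠ 0 := by positivity
        rw [pow_add _ (m + K), mul_inv]
        field_simp

lemma coeff_hasSum {β : (Fin n → ℕ) → ℂ} {U : Schw n}
    (hU : HasSum (fun k => β k • O.state k) U) (j : Fin n → ℕ) :
    O.coeff U j = β j * (‖toL2 O.vacuum‖ ^ 2 : ℝ) := by
  have h1 := (innerSL ℂ (toL2 (O.state j))).hasSum (toL2.hasSum hU)
  have h2 : HasSum (fun k => inner ℂ (toL2 (O.state j)) (toL2 (β k • O.state k))) (O.coeff U j) :=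
    h1
  rw [← h2.tsum_eq, tsum_eq_single j]
  · rw [map_smul, inner_smul_right, inner_self_eq_norm_sq_to_K, O.norm_state]
    push_cast
    rfl
  · intro k hk
    rw [map_smul, inner_smul_right, O.inner_state_of_ne hk.symm, mul_zero]

/-- The expansion of a Schwartz function in excited states, if these are complete. -/
lemma hasSum_coeff (hv : O.vacuum ≠ 0)
    (hcomplete : ∀ g : Schw n, (∀ k, O.coeff g k = 0) → g = 0) (f : Schw n) :
    HasSum (fun k => (((‖toL2 O.vacuum‖ ^ 2 : ℝ) : ℂ)⁻¹ * O.coeff f k) • O.state k) f := by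
  have hν : ((‖toL2 O.vacuum‖ ^ 2 : ℝ) : ℂ) ≠ 0 := by
    have h1 : toL2 O.vacuum ≠ 0 := by
      intro h
      refine hv (SchwartzMap.injective_toLp 2 (volume : Measure
        (EuclideanSpace ℝ (Fin n))) ?_)
      change toL2 O.vacuum = toL2 0
      rw [h, map_zero]
    exact_mod_cast (pow_pos (norm_pos_iff.2 h1) 2).ne'
  obtain ⟨U, hU⟩ := O.exists_hasSum_smul_state
    (fun k => ((‖toL2 O.vacuum‖ ^ 2 : ℝ) : ℂ)⁻¹ * O.coeff f k) fun r => by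
      obtain ⟨C, hC, h⟩ := O.exists_coeff_le f r
      refine ⟨‖((‖toL2 O.vacuum‖ ^ 2 : ℝ) : ℂ)⁻¹‖ * C, by positivity, fun k => ?_⟩
      rw [norm_mul, mul_assoc]
      gcongr
      exact h k
  -- The series converges to some `U` by rapid decay; orthogonality shows that `U` has the
  -- coefficients of `f`.
  have h0 : f - U = 0 := hcomplete _ fun k => by
    have h1 := O.coeff_hasSum hU k
    rw [coeff, map_sub, inner_sub_right, sub_eq_zero]
    change O.coeff f k = O.coeff U k
    rw [h1, mul_right_comm, inv_mul_cancel₀ hν, one_mul]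
  rwa [← sub_eq_zero.1 h0] at hU

lemma weylGen_mem_span (l : Fin n ⊕ Fin n) {f : Schw n}
    (hf : f ∈ Submodule.span ℂ (Set.range O.state)) :
    weylGen l f ∈ Submodule.span ℂ (Set.range O.state) := by
  have h : Submodule.span ℂ (Set.range O.state) ≤
      (Submodule.span ℂ (Set.range O.state)).comap (weylGen l).toLinearMap := by
    rw [Submodule.span_le]
    rintro _ ⟨k, rfl⟩
    change weylGen l (O.state k) ∈ Submodule.span ℂ (Set.range O.state)
    rw [O.weylGen_eq]
    simp only [add_apply, sum_apply, smul_apply, create_state, annih_state]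
    refine Submodule.add_mem _ (Submodule.sum_mem _ fun j _ => ?_)
      (Submodule.sum_mem _ fun j _ => ?_) <;>
    exact Submodule.smul_mem _ _ (Submodule.smul_mem _ _ (Submodule.subset_span ⟨_, rfl⟩))
  exact h hf

end Oscillator

lemma stdGaussian_apply {n : ℕ} (x : EuclideanSpace ℝ (Fin n)) :
    stdGaussian n x = (Real.exp (-1 / 2 * ‖x‖ ^ 2) : ℂ) := by
  rw [stdGaussian, expSchwartz_apply]
  push_cast
  rfl

/-- Multiplication by the linear form `⟨ξ, x⟩`. -/
def formMul {n : ℕ} (ξ : EuclideanSpace ℝ (Fin n)) : SchwOp n := ∑ i, (ξ i : ℂ) • coordMul i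

lemma formMul_pow_apply {n : ℕ} (ξ : EuclideanSpace ℝ (Fin n)) (m : ℕ) (f : Schw n)
    (x : EuclideanSpace ℝ (Fin n)) :
    (formMul ξ ^ m) f x = ((inner ℝ x ξ : ℝ) : ℂ) ^ m * f x := by
  have h : ∀ f : Schw n, formMul ξ f x = ((inner ℝ x ξ : ℝ) : ℂ) * f x := by
    intro f
    simp [formMul, sum_apply, PiLp.inner_apply, Finset.sum_mul, mul_assoc]
  induction m with
  | zero => simp
  | succ m ih => rw [pow_succ', mul_apply_eq_comp, h, ih, pow_succ', mul_assoc]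

/-- Completeness of the Hermite functions. -/
lemma stdOscillator_complete {n : ℕ} (g : Schw n)
    (hg : ∀ k, (stdOscillator n).coeff g k = 0) : g = 0 := by
  set O := stdOscillator n with hO
  have hspan : ∀ f ∈ Submodule.span ℂ (Set.range O.state),
      inner ℂ (toL2 f) (toL2 g) = 0 := by
    intro f hf
    induction hf using Submodule.span_induction with
    | mem f hf => obtain ⟨k, rfl⟩ := hf; exact hg k
    | zero => simp
    | add a b _ _ ha hb => rw [map_add, inner_add_left, ha, hb, add_zero]
    | smul c a _ ha => rw [map_smul, inner_smul_left, ha, mul_zero]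
  -- Polynomial multiples of the Gaussian lie in the span of the states, so all moments of the
  -- Gaussian times `g` vanish.
  have hmom : ∀ (ξ : EuclideanSpace ℝ (Fin n)) (m : ℕ),
      ∫ x, ((inner ℝ x ξ : ℝ) : ℂ) ^ m * (stdGaussian n x * g x) = 0 := by
    intro ξ m
    have h1 : (formMul ξ ^ m) (stdGaussian n) ∈ Submodule.span ℂ (Set.range O.state) := by
      induction m with
      | zero =>
        rw [pow_zero, one_apply_eq_self]
        refine Submodule.subset_span ⟨0, ?_⟩
        rw [O.state_zero]; rfl
      | succ m ih =>
        rw [pow_succ', mul_apply_eq_comp]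
        simp only [formMul, sum_apply, smul_apply] at ih ⊢
        refine Submodule.sum_mem _ fun i _ => Submodule.smul_mem _ _ ?_
        exact O.weylGen_mem_span (Sum.inl i) ih
    have h2 := hspan _ h1
    rw [inner_toL2] at h2
    rw [← h2]
    congr 1
    ext x
    rw [formMul_pow_apply, stdGaussian_apply, map_mul, map_pow, Complex.conj_ofReal,
      Complex.conj_ofReal, mul_assoc]
  set u : Schw n := SchwartzMap.smulLeftCLM ℂ (stdGaussian n) g with hu
  have hux : ∀ x, u x = stdGaussian n x * g x := fun x => by
    rw [hu, SchwartzMap.smulLeftCLM_apply_apply (stdGaussian n).hasTemperateGrowth, smul_eq_mul]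
  -- Expanding the exponential under the integral writes the Fourier transform of `u` as a series of
  -- these moments.
  have hF : 𝓕 u = 0 := by
    ext ξ
    rw [SchwartzMap.fourier_coe, Real.fourier_eq']
    have hpt : ∀ x, HasSum (fun m : ℕ => ((-2 * Real.pi * Complex.I) ^ m / (m.factorial : ℂ)) *
        (((inner ℝ x ξ : ℝ) : ℂ) ^ m * u x))
        (Complex.exp (((-2 * Real.pi * inner ℝ x ξ : ℝ) : ℂ) * Complex.I) • u x) := by
      intro x
      have h1 := NormedSpace.expSeries_div_hasSum_exp
        (((-2 * Real.pi * inner ℝ x ξ : ℝ) : ℂ) * Complex.I)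
      rw [← Complex.exp_eq_exp_ℂ] at h1
      have e : (fun m : ℕ => ((-2 * Real.pi * Complex.I) ^ m / (m.factorial : ℂ)) *
          (((inner ℝ x ξ : ℝ) : ℂ) ^ m * u x)) = fun m : ℕ =>
          (((-2 * Real.pi * inner ℝ x ξ : ℝ) : ℂ) * Complex.I) ^ m / (m.factorial : ℂ) * u x := by
        ext m
        push_cast
        rw [← mul_assoc, div_mul_eq_mul_div, ← mul_pow]
        congr 3
        ring
      rw [e]
      exact h1.mul_right (u x)
    have hnorm : ∀ (m : ℕ) x, ‖((-2 * Real.pi * Complex.I) ^ m / (m.factorial : ℂ)) *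
        (((inner ℝ x ξ : ℝ) : ℂ) ^ m * u x)‖ ≤
        (2 * Real.pi * (‖x‖ * ‖ξ‖)) ^ m / m.factorial * ‖u x‖ := by
      intro m x
      rw [← mul_assoc, norm_mul]
      refine mul_le_mul_of_nonneg_right ?_ (norm_nonneg _)
      rw [div_mul_eq_mul_div, norm_div, Complex.norm_natCast, ← mul_pow, norm_pow]
      have h2 := abs_real_inner_le_norm x ξ
      have h3 := Real.pi_pos
      gcongr
      simp only [norm_mul, norm_neg, Complex.norm_ofNat, Complex.norm_real, Complex.norm_I, mul_one,
        Real.norm_eq_abs, abs_of_pos h3]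
      gcongr
    have hsum : ∀ x, HasSum (fun m : ℕ => (2 * Real.pi * (‖x‖ * ‖ξ‖)) ^ m / m.factorial * ‖u x‖)
        (Real.exp (2 * Real.pi * (‖x‖ * ‖ξ‖)) * ‖u x‖) := by
      intro x
      have h1 := NormedSpace.expSeries_div_hasSum_exp (2 * Real.pi * (‖x‖ * ‖ξ‖))
      rw [← Real.exp_eq_exp_ℝ] at h1
      exact h1.mul_right _
    -- The Gaussian in `u` beats the exponential: `2π r ‖ξ‖ - r² / 2` is at most `2 (π ‖ξ‖)²`, with
    -- equality at `r = 2π ‖ξ‖`.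
    have hint : Integrable fun x => Real.exp (2 * Real.pi * (‖x‖ * ‖ξ‖)) * ‖u x‖ := by
      refine (g.integrable.norm.const_mul (Real.exp (2 * (Real.pi * ‖ξ‖) ^ 2))).mono' ?_
        (Filter.Eventually.of_forall fun x => ?_)
      · have := u.continuous
        exact (by fun_prop : Continuous fun x =>
          Real.exp (2 * Real.pi * (‖x‖ * ‖ξ‖)) * ‖u x‖).aestronglyMeasurable
      · rw [Real.norm_of_nonneg (by positivity), hux, stdGaussian_apply, norm_mul,
          Complex.norm_real, Real.norm_of_nonneg (Real.exp_pos _).le, ← mul_assoc, ← Real.exp_add]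
        refine mul_le_mul_of_nonneg_right (Real.exp_le_exp.2 ?_) (norm_nonneg _)
        nlinarith [sq_nonneg (‖x‖ - 2 * (Real.pi * ‖ξ‖))]
    have hfin := hasSum_integral_of_dominated_convergence (μ := volume)
      (fun (m : ℕ) x => (2 * Real.pi * (‖x‖ * ‖ξ‖)) ^ m / m.factorial * ‖u x‖)
      (F := fun m x => ((-2 * Real.pi * Complex.I) ^ m / (m.factorial : ℂ)) *
        (((inner ℝ x ξ : ℝ) : ℂ) ^ m * u x)) (fun m => by
          have := u.continuous
          exact (by fun_prop : Continuous _).aestronglyMeasurable)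
      (fun m => Filter.Eventually.of_forall fun x => hnorm m x)
      (Filter.Eventually.of_forall fun x => (hsum x).summable)
      (by simpa only [fun x => (hsum x).tsum_eq] using hint)
      (Filter.Eventually.of_forall hpt)
    refine hfin.unique ?_
    have hz : ∀ m : ℕ, ∫ x, ((-2 * Real.pi * Complex.I) ^ m / (m.factorial : ℂ)) *
        (((inner ℝ x ξ : ℝ) : ℂ) ^ m * u x) = 0 := by
      intro m
      rw [integral_const_mul]
      simp only [hux, hmom, mul_zero]
    simp only [hz]
    exact hasSum_zero
  have hu0 : u = 0 := by
    have h1 : 𝓕⁻ (𝓕 u) = u := FourierTransform.fourierInv_fourier_eq u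
    rw [← h1, hF]
    exact map_zero (FourierTransform.fourierInvCLM ℂ (Schw n))
  ext x
  have := hux x
  rw [hu0, stdGaussian_apply] at this
  have hne : (Real.exp (-1 / 2 * ‖x‖ ^ 2) : ℂ) ≠ 0 := by
    exact_mod_cast (Real.exp_pos _).ne'
  simpa [hne] using this.symm

/-! ### Phase space coordinates and weights -/

/-- The map `(x, ξ) ↦ (x, ξ)` from `ℝᵈ × ℝᵈ` to `ℝ^{2d}` as a continuous linear map. -/
def phaseCLM (d : ℕ) : EuclideanSpace ℝ (Fin d) × EuclideanSpace ℝ (Fin d) →L[ℝ]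
    EuclideanSpace ℝ (Fin (d + d)) :=
  LinearMap.toContinuousLinearMap
    { toFun := fun p => phasePoint p.1 p.2
      map_add' := fun p q => by
        ext i
        refine Fin.addCases (fun j => ?_) (fun j => ?_) i <;>
        simp [phasePoint, -Fin.natAdd_eq_addNat]
      map_smul' := fun c p => by
        ext i
        refine Fin.addCases (fun j => ?_) (fun j => ?_) i <;>
        simp [phasePoint, -Fin.natAdd_eq_addNat] }

@[simp] lemma phaseCLM_apply {d : ℕ}
    (p : EuclideanSpace ℝ (Fin d) × EuclideanSpace ℝ (Fin d)) :
    phaseCLM d p = phasePoint p.1 p.2 := rfl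

@[simp] lemma phasePoint_castAdd {d : ℕ} (x ξ : EuclideanSpace ℝ (Fin d)) (j : Fin d) :
    phasePoint x ξ (Fin.castAdd d j) = x j := by simp [phasePoint]

@[simp] lemma phasePoint_natAdd {d : ℕ} (x ξ : EuclideanSpace ℝ (Fin d)) (j : Fin d) :
    phasePoint x ξ (Fin.natAdd d j) = ξ j := by
  simp [phasePoint, -Fin.natAdd_eq_addNat]

lemma castAdd_ne_natAdd {d : ℕ} (j k : Fin d) : Fin.castAdd d j ≠ Fin.natAdd d k := by
  intro h
  have := congrArg Fin.val h
  simp only [Fin.val_castAdd, Fin.val_natAdd] at this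
  omega

lemma phasePoint_single_zero {d : ℕ} (j : Fin d) (c : ℝ) :
    phasePoint (EuclideanSpace.single j c) 0 = EuclideanSpace.single (Fin.castAdd d j) c := by
  ext i
  refine Fin.addCases (fun k => ?_) (fun k => ?_) i
  · simp
  · simp [-Fin.natAdd_eq_addNat, (castAdd_ne_natAdd j k).symm]

lemma phasePoint_zero_single {d : ℕ} (j : Fin d) (c : ℝ) :
    phasePoint 0 (EuclideanSpace.single j c) = EuclideanSpace.single (Fin.natAdd d j) c := by
  ext i
  refine Fin.addCases (fun k => ?_) (fun k => ?_) i
  · simp [-Fin.natAdd_eq_addNat, castAdd_ne_natAdd k j]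
  · simp [-Fin.natAdd_eq_addNat]

lemma norm_phasePoint_sq {d : ℕ} (x ξ : EuclideanSpace ℝ (Fin d)) :
    ‖phasePoint x ξ‖ ^ 2 = ‖x‖ ^ 2 + ‖ξ‖ ^ 2 := by
  rw [EuclideanSpace.norm_sq_eq, EuclideanSpace.norm_sq_eq, EuclideanSpace.norm_sq_eq,
    Fin.sum_univ_add]
  simp

lemma norm_le_norm_phasePoint {d : ℕ} (x ξ : EuclideanSpace ℝ (Fin d)) :
    ‖ξ‖ ≤ ‖phasePoint x ξ‖ := by
  refine le_of_sq_le_sq ?_ (norm_nonneg _)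
  rw [norm_phasePoint_sq]
  nlinarith [sq_nonneg ‖x‖]

/-- A weighted supremum bound of a Schwartz function. -/
def weightSup {n : ℕ} (r : ℕ) (f : Schw n) : ℝ :=
  2 ^ r * (Finset.Iic (r, 0)).sup (schwartzSeminormFamily ℂ (EuclideanSpace ℝ (Fin n)) ℂ) f

lemma weightSup_nonneg {n : ℕ} (r : ℕ) (f : Schw n) : 0 ≤ weightSup r f := by
  unfold weightSup; positivity

lemma norm_le_weightSup {n : ℕ} (r : ℕ) (f : Schw n) (x : EuclideanSpace ℝ (Fin n)) :
    ‖f x‖ ≤ weightSup r f * ((1 + ‖x‖) ^ r)⁻¹ := by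
  have h := SchwartzMap.one_add_le_sup_seminorm_apply (𝕜 := ℂ) (m := (r, 0)) (k := r) (n := 0)
    le_rfl le_rfl f x
  rw [norm_iteratedFDeriv_zero] at h
  rw [← div_eq_mul_inv, le_div_iff₀ (by positivity), mul_comm]
  exact h

/-! ### Convergence, continuity and commutation rules of `Op_t` -/

section OpCalculus

variable {d : ℕ}

local notation "V" => EuclideanSpace ℝ (Fin d)

/-- The integrable weight dominating the integrands of pseudo-differential operators. -/
def phaseWeight (d : ℕ) (p : EuclideanSpace ℝ (Fin d) × EuclideanSpace ℝ (Fin d)) : ℝ :=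
  ((1 + ‖p.1‖) ^ (d + 1))⁻¹ * ((1 + ‖p.2‖) ^ (d + 1))⁻¹

lemma phaseWeight_nonneg (p : V × V) : 0 ≤ phaseWeight d p := by
  unfold phaseWeight; positivity

lemma integrable_phaseWeight (d : ℕ) : Integrable (phaseWeight d) := by
  have h : Integrable fun x : EuclideanSpace ℝ (Fin d) => ((1 + ‖x‖) ^ (d + 1))⁻¹ := by
    have := integrable_one_add_norm (E := EuclideanSpace ℝ (Fin d)) (μ := volume)
      (r := ((d + 1 : ℕ) : ℝ)) (by simp)
    refine this.congr (Filter.Eventually.of_forall fun x => ?_)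
    simp only
    rw [Real.rpow_neg (by positivity), Real.rpow_natCast]
  exact h.mul_prod h

/-- Decay in `ξ` comes from the symbol and decay in `y` from `f`. The bound does not depend on `x`,
which later permits differentiation under the integral. -/
lemma norm_opIntegrand_le (t : ℝ) (b : Schw (d + d)) (f : Schw d) (x : V) (p : V × V) :
    ‖opIntegrand t b f x p‖ ≤ weightSup (d + 1) b * weightSup (d + 1) f * phaseWeight d p := by
  have h1 := norm_le_weightSup (d + 1) b (phasePoint ((1 - t) • x + t • p.1) p.2)
  have h2 := norm_le_weightSup (d + 1) f p.1
  have h3 : ‖Complex.exp (Complex.I * ((inner ℝ (x - p.1) p.2 : ℝ) : ℂ))‖ = 1 := by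
    rw [mul_comm, Complex.norm_exp_ofReal_mul_I]
  have h4 : ((1 + ‖phasePoint ((1 - t) • x + t • p.1) p.2‖) ^ (d + 1))⁻¹ ≤
      ((1 + ‖p.2‖) ^ (d + 1))⁻¹ := by
    have := norm_le_norm_phasePoint ((1 - t) • x + t • p.1) p.2
    gcongr
  have h5 := weightSup_nonneg (d + 1) b
  have h6 := weightSup_nonneg (d + 1) f
  rw [opIntegrand, norm_mul, norm_mul, h3, mul_one]
  calc _ ≤ (weightSup (d + 1) b * ((1 + ‖p.2‖) ^ (d + 1))⁻¹) *
        (weightSup (d + 1) f * ((1 + ‖p.1‖) ^ (d + 1))⁻¹) := by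
        refine mul_le_mul (h1.trans ?_) h2 (norm_nonneg _) (by positivity)
        gcongr
    _ = _ := by rw [phaseWeight]; ring

lemma continuous_opIntegrand (t : ℝ) (b : Schw (d + d)) (f : Schw d) (x : V) :
    Continuous (opIntegrand t b f x) := by
  have h1 : Continuous fun p : V × V => phasePoint ((1 - t) • x + t • p.1) p.2 :=
    (phaseCLM d).continuous.comp
      (by fun_prop : Continuous fun p : V × V => ((1 - t) • x + t • p.1, p.2))
  have hb := b.continuous.comp h1
  have hf := f.continuous.comp (continuous_fst (X := V) (Y := V))
  have hi : Continuous fun p : V × V => inner ℝ (x - p.1) p.2 := by fun_prop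
  exact (hb.mul hf).mul (Complex.continuous_exp.comp
    (continuous_const.mul (Complex.continuous_ofReal.comp hi)))

lemma opConverges_schwartz (t : ℝ) (b : Schw (d + d)) (f : Schw d) : OpConverges t b f :=
  fun x => ((integrable_phaseWeight d).const_mul _).mono'
    (continuous_opIntegrand t b f x).aestronglyMeasurable
    (Filter.Eventually.of_forall fun p => norm_opIntegrand_le t b f x p)

lemma norm_pseudoOp_le (t : ℝ) (b : Schw (d + d)) (f : Schw d) (x : V) :
    ‖pseudoOp t b f x‖ ≤ ‖(((2 * Real.pi) ^ d : ℝ) : ℂ)⁻¹‖ * (∫ p, phaseWeight d p) *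
      (weightSup (d + 1) b * weightSup (d + 1) f) := by
  rw [pseudoOp, norm_mul, mul_assoc]
  refine mul_le_mul_of_nonneg_left ?_ (norm_nonneg _)
  refine (norm_integral_le_of_norm_le ((integrable_phaseWeight d).const_mul _)
    (Filter.Eventually.of_forall fun p => norm_opIntegrand_le t b f x p)).trans (le_of_eq ?_)
  rw [integral_const_mul, mul_comm]

lemma pseudoOp_add_symbol (t : ℝ) (b b' : Schw (d + d)) (f : Schw d) (x : V) :
    pseudoOp t (b + b' : Schw (d + d)) f x = pseudoOp t b f x + pseudoOp t b' f x := by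
  simp only [pseudoOp]
  rw [← mul_add, ← integral_add (opConverges_schwartz t b f x) (opConverges_schwartz t b' f x)]
  congr 2
  ext p
  simp [opIntegrand]
  ring

lemma pseudoOp_smul_symbol (t : ℝ) (c : ℂ) (b : Schw (d + d)) (f : Schw d) (x : V) :
    pseudoOp t (c • b : Schw (d + d)) f x = c * pseudoOp t b f x := by
  simp only [pseudoOp]
  rw [mul_left_comm, ← integral_const_mul c]
  congr 1
  refine integral_congr_ae (Filter.Eventually.of_forall fun p => ?_)
  simp [opIntegrand]
  ring

lemma pseudoOp_add_function (t : ℝ) (b : Schw (d + d)) (f f' : Schw d) (x : V) :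
    pseudoOp t b (f + f' : Schw d) x = pseudoOp t b f x + pseudoOp t b f' x := by
  simp only [pseudoOp]
  rw [← mul_add, ← integral_add (opConverges_schwartz t b f x) (opConverges_schwartz t b f' x)]
  congr 2
  ext p
  simp [opIntegrand]
  ring

lemma pseudoOp_smul_function (t : ℝ) (c : ℂ) (b : Schw (d + d)) (f : Schw d) (x : V) :
    pseudoOp t b (c • f : Schw d) x = c * pseudoOp t b f x := by
  simp only [pseudoOp]
  rw [mul_left_comm, ← integral_const_mul c]
  congr 1
  refine integral_congr_ae (Filter.Eventually.of_forall fun p => ?_)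
  simp [opIntegrand]
  ring

/-- `b ↦ (Op_t(b) f)(x)` as a continuous linear functional. -/
def opSymbolCLM (t : ℝ) (f : Schw d) (x : V) : Schw (d + d) →L[ℂ] ℂ :=
  SchwartzMap.mkCLMtoNormedSpace (fun b => pseudoOp t b f x)
    (fun b b' => pseudoOp_add_symbol t b b' f x) (fun c b => pseudoOp_smul_symbol t c b f x)
    ⟨Finset.Iic (d + 1, 0), ‖(((2 * Real.pi) ^ d : ℝ) : ℂ)⁻¹‖ * (∫ p, phaseWeight d p) *
      (2 ^ (d + 1) * weightSup (d + 1) f), by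
        have : 0 ≤ ∫ p, phaseWeight d p := integral_nonneg fun p => phaseWeight_nonneg p
        have := weightSup_nonneg (d + 1) f
        positivity, fun b => by
      refine (norm_pseudoOp_le t b f x).trans (le_of_eq ?_)
      conv_lhs => rw [weightSup]
      ring⟩

@[simp] lemma opSymbolCLM_apply (t : ℝ) (f : Schw d) (x : V) (b : Schw (d + d)) :
    opSymbolCLM t f x b = pseudoOp t b f x := rfl

/-- `f ↦ (Op_t(b) f)(x)` as a continuous linear functional. -/
def opFunctionCLM (t : ℝ) (b : Schw (d + d)) (x : V) : Schw d →L[ℂ] ℂ :=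
  SchwartzMap.mkCLMtoNormedSpace (fun f => pseudoOp t b f x)
    (fun f f' => pseudoOp_add_function t b f f' x) (fun c f => pseudoOp_smul_function t c b f x)
    ⟨Finset.Iic (d + 1, 0), ‖(((2 * Real.pi) ^ d : ℝ) : ℂ)⁻¹‖ * (∫ p, phaseWeight d p) *
      (2 ^ (d + 1) * weightSup (d + 1) b), by
        have : 0 ≤ ∫ p, phaseWeight d p := integral_nonneg fun p => phaseWeight_nonneg p
        have := weightSup_nonneg (d + 1) b
        positivity, fun f => by
      refine (norm_pseudoOp_le t b f x).trans (le_of_eq ?_)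
      conv_lhs => rw [weightSup, weightSup]
      rw [weightSup]
      ring⟩

@[simp] lemma opFunctionCLM_apply (t : ℝ) (b : Schw (d + d)) (x : V) (f : Schw d) :
    opFunctionCLM t b x f = pseudoOp t b f x := rfl

instance isAddHaarMeasure_volume_prod : (volume : Measure (V × V)).IsAddHaarMeasure := by
  rw [Measure.volume_eq_prod]
  infer_instance

/-- The amplitude `a((1-t)x + ty, ξ) f(y)`. -/
def opAmplitude (t : ℝ) (b : Schw (d + d)) (f : Schw d) (x : V) (p : V × V) : ℂ :=
  b (phasePoint ((1 - t) • x + t • p.1) p.2) * f p.1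

/-- The phase factor `e^{i⟨x-y, ξ⟩}`. -/
def opPhase (x : V) (p : V × V) : ℂ :=
  Complex.exp (Complex.I * ((inner ℝ (x - p.1) p.2 : ℝ) : ℂ))

lemma opIntegrand_eq (t : ℝ) (b : Schw (d + d)) (f : Schw d) (x : V) (p : V × V) :
    opIntegrand t b f x p = opAmplitude t b f x p * opPhase x p := rfl

lemma hasFDerivAt_opPhase (x : V) (p : V × V) :
    HasFDerivAt (opPhase x) (opPhase x p • (Complex.I • (Complex.ofRealCLM ∘L
      ((innerSL ℝ (x - p.1)) ∘L ContinuousLinearMap.snd ℝ V V -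
        (innerSL ℝ p.2) ∘L ContinuousLinearMap.fst ℝ V V)))) p := by
  have h1 : HasFDerivAt (fun p : V × V => inner ℝ (x - p.1) p.2)
      ((innerSL ℝ (x - p.1)) ∘L ContinuousLinearMap.snd ℝ V V -
        (innerSL ℝ p.2) ∘L ContinuousLinearMap.fst ℝ V V) p := by
    have := (hasFDerivAt_fst (𝕜 := ℝ) (p := p)).const_sub x |>.inner ℝ
      (hasFDerivAt_snd (𝕜 := ℝ) (p := p))
    refine this.congr_fderiv ?_
    ext v
    · simp [real_inner_comm]
    · simp [inner_sub_left, real_inner_comm]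
  exact ((Complex.ofRealCLM.hasFDerivAt.comp p h1).const_mul Complex.I).cexp

lemma hasFDerivAt_opAmplitude (t : ℝ) (b : Schw (d + d)) (f : Schw d) (x : V) (p : V × V) :
    HasFDerivAt (opAmplitude t b f x)
      (b (phasePoint ((1 - t) • x + t • p.1) p.2) •
        (fderiv ℝ f p.1 ∘L ContinuousLinearMap.fst ℝ V V) + f p.1 •
        (fderiv ℝ b (phasePoint ((1 - t) • x + t • p.1) p.2) ∘L (phaseCLM d ∘L
          ((t • ContinuousLinearMap.fst ℝ V V).prod (ContinuousLinearMap.snd ℝ V V))))) p := by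
  have h1 : HasFDerivAt (fun p : V × V => phasePoint ((1 - t) • x + t • p.1) p.2)
      (phaseCLM d ∘L
          ((t • ContinuousLinearMap.fst ℝ V V).prod (ContinuousLinearMap.snd ℝ V V))) p := by
    have h2 := (((hasFDerivAt_fst (𝕜 := ℝ) (p := p)).const_smul t).const_add
      ((1 - t) • x)).prodMk (hasFDerivAt_snd (𝕜 := ℝ) (p := p))
    exact (phaseCLM d).hasFDerivAt.comp p h2
  have h3 := (b.differentiableAt (x := phasePoint ((1 - t) • x + t • p.1) p.2)).hasFDerivAt.comp
    p h1
  have h4 := (f.differentiableAt (x := p.1)).hasFDerivAt.comp p (hasFDerivAt_fst (𝕜 := ℝ) (p := p))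
  exact h3.mul h4

/-- The position variable and the frequency variable in phase space. -/
abbrev posMul (j : Fin d) : SchwOp (d + d) := coordMul (Fin.castAdd d j)
abbrev freqMul (j : Fin d) : SchwOp (d + d) := coordMul (Fin.natAdd d j)
abbrev posDeriv (j : Fin d) : SchwOp (d + d) := coordDeriv (Fin.castAdd d j)
abbrev freqDeriv (j : Fin d) : SchwOp (d + d) := coordDeriv (Fin.natAdd d j)

/-- Integration by parts in `ξⱼ`, where the phase contributes `i (xⱼ - yⱼ)`. -/
lemma pseudoOp_freqDeriv (t : ℝ) (b : Schw (d + d)) (f : Schw d) (x : V) (j : Fin d) :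
    pseudoOp t (freqDeriv j b) f x =
      Complex.I * (pseudoOp t b (coordMul j f) x - x j * pseudoOp t b f x) := by
  set v : V × V := (0, EuclideanSpace.single j 1) with hv
  have hA : ∀ p : V × V, HasLineDerivAt ℝ (opAmplitude t b f x)
      (opAmplitude t (freqDeriv j b) f x p) p v := by
    intro p
    convert! (hasFDerivAt_opAmplitude t b f x p).hasLineDerivAt v using 1
    simp [opAmplitude, hv, coordDeriv_apply, phasePoint_zero_single, mul_comm]
  have hP : ∀ p : V × V, HasLineDerivAt ℝ (opPhase x)
      (Complex.I * (x j - p.1 j) * opPhase x p) p v := by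
    intro p
    convert! (hasFDerivAt_opPhase x p).hasLineDerivAt v using 1
    simp [hv, EuclideanSpace.inner_single_right, mul_comm]
  have e : ∀ p : V × V, opAmplitude t b f x p * (Complex.I * (x j - p.1 j) * opPhase x p) =
      Complex.I * (x j * opIntegrand t b f x p - opIntegrand t b (coordMul j f) x p) := by
    intro p
    simp only [opIntegrand_eq, opAmplitude, coordMul_apply]
    ring
  have hi1 : Integrable fun p => Complex.I * (x j * opIntegrand t b f x p -
      opIntegrand t b (coordMul j f) x p) :=
    (((opConverges_schwartz t b f x).const_mul _).sub
      (opConverges_schwartz t b (coordMul j f) x)).const_mul _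
  have h := integral_bilinear_hasLineDerivAt_right_eq_neg_left_of_integrable
    (μ := (volume : Measure (V × V))) (v := v) (B := ContinuousLinearMap.mul ℝ ℂ)
    (f := opAmplitude t b f x) (f' := opAmplitude t (freqDeriv j b) f x) (g := opPhase x)
    (g' := fun p => Complex.I * (x j - p.1 j) * opPhase x p)
    (opConverges_schwartz t (freqDeriv j b) f x)
    (by simpa only [ContinuousLinearMap.mul_apply', e] using hi1)
    (opConverges_schwartz t b f x) (fun p _ => hA p) (fun p _ => hP p)
  simp only [ContinuousLinearMap.mul_apply', e, ← opIntegrand_eq] at h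
  rw [integral_const_mul, integral_sub ((opConverges_schwartz t b f x).const_mul _)
    (opConverges_schwartz t b (coordMul j f) x), integral_const_mul] at h
  simp only [pseudoOp]
  rw [← neg_eq_iff_eq_neg.2 h]
  ring

/-- Integration by parts in `yⱼ`. The phase contributes `-i ξⱼ`, and the symbol depends on `y`
through `t y`, whence the second term. -/
lemma pseudoOp_coordDeriv (t : ℝ) (b : Schw (d + d)) (f : Schw d) (x : V) (j : Fin d) :
    pseudoOp t b (coordDeriv j f) x =
      Complex.I * pseudoOp t (freqMul j b) f x - t * pseudoOp t (posDeriv j b) f x := by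
  set v : V × V := (EuclideanSpace.single j 1, 0) with hv
  have hA : ∀ p : V × V, HasLineDerivAt ℝ (opAmplitude t b f x)
      (opAmplitude t b (coordDeriv j f) x p + t * opAmplitude t (posDeriv j b) f x p) p v := by
    intro p
    convert! (hasFDerivAt_opAmplitude t b f x p).hasLineDerivAt v using 1
    have hs : phasePoint (t • EuclideanSpace.single j (1 : ℝ)) 0 =
        t • EuclideanSpace.single (Fin.castAdd d j) (1 : ℝ) := by
      rw [← phasePoint_single_zero]
      have := (phaseCLM d).map_smul t (EuclideanSpace.single j (1 : ℝ), 0)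
      simpa using this
    simp only [opAmplitude, hv, coordDeriv_apply, add_apply, smul_apply,
      ContinuousLinearMap.comp_apply, ContinuousLinearMap.prod_apply,
      ContinuousLinearMap.coe_fst', ContinuousLinearMap.coe_snd', phaseCLM_apply, hs, map_smul,
      smul_eq_mul, Complex.real_smul]
    ring
  have hP : ∀ p : V × V, HasLineDerivAt ℝ (opPhase x)
      (-(Complex.I * p.2 j) * opPhase x p) p v := by
    intro p
    convert! (hasFDerivAt_opPhase x p).hasLineDerivAt v using 1
    simp [hv, EuclideanSpace.inner_single_right, mul_comm]
  have e : ∀ p : V × V, opAmplitude t b f x p * (-(Complex.I * p.2 j) * opPhase x p) =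
      -(Complex.I * opIntegrand t (freqMul j b) f x p) := by
    intro p
    simp only [opIntegrand_eq, opAmplitude, coordMul_apply, phasePoint_natAdd]
    ring
  have e' : ∀ p : V × V, (opAmplitude t b (coordDeriv j f) x p +
      t * opAmplitude t (posDeriv j b) f x p) * opPhase x p =
      opIntegrand t b (coordDeriv j f) x p + t * opIntegrand t (posDeriv j b) f x p := by
    intro p
    simp only [opIntegrand_eq]
    ring
  have hi1 : Integrable fun p => -(Complex.I * opIntegrand t (freqMul j b) f x p) :=
    ((opConverges_schwartz t (freqMul j b) f x).const_mul _).neg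
  have hi2 : Integrable fun p => opIntegrand t b (coordDeriv j f) x p +
      t * opIntegrand t (posDeriv j b) f x p :=
    (opConverges_schwartz t b (coordDeriv j f) x).add
      ((opConverges_schwartz t (posDeriv j b) f x).const_mul _)
  have h := integral_bilinear_hasLineDerivAt_right_eq_neg_left_of_integrable
    (μ := (volume : Measure (V × V))) (v := v) (B := ContinuousLinearMap.mul ℝ ℂ)
    (f := opAmplitude t b f x) (f' := fun p => opAmplitude t b (coordDeriv j f) x p +
      t * opAmplitude t (posDeriv j b) f x p) (g := opPhase x)
    (g' := fun p => -(Complex.I * p.2 j) * opPhase x p)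
    (by simpa only [ContinuousLinearMap.mul_apply', e'] using hi2)
    (by simpa only [ContinuousLinearMap.mul_apply', e] using hi1)
    (opConverges_schwartz t b f x) (fun p _ => hA p) (fun p _ => hP p)
  simp only [ContinuousLinearMap.mul_apply', e, e'] at h
  rw [integral_neg, integral_const_mul, integral_add (opConverges_schwartz t b (coordDeriv j f) x)
    ((opConverges_schwartz t (posDeriv j b) f x).const_mul _), integral_const_mul, neg_inj] at h
  simp only [pseudoOp]
  linear_combination -(((2 * Real.pi) ^ d : ℝ) : ℂ)⁻¹ * h

lemma pseudoOp_posMul (t : ℝ) (b : Schw (d + d)) (f : Schw d) (x : V) (j : Fin d) :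
    pseudoOp t (posMul j b) f x =
      (1 - t) * (x j * pseudoOp t b f x) + t * pseudoOp t b (coordMul j f) x := by
  have e : ∀ p : V × V, opIntegrand t (posMul j b) f x p =
      (1 - t) * x j * opIntegrand t b f x p + t * opIntegrand t b (coordMul j f) x p := by
    intro p
    simp only [opIntegrand_eq, opAmplitude, coordMul_apply, phasePoint_castAdd]
    simp
    ring
  simp only [pseudoOp]
  rw [integral_congr_ae (Filter.Eventually.of_forall e),
    integral_add ((opConverges_schwartz t b f x).const_mul _)
      ((opConverges_schwartz t b (coordMul j f) x).const_mul _), integral_const_mul,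
    integral_const_mul]
  ring

/-- The symbol of `∂ⱼ ∘ Op_t(b)`. -/
def leftDeriv (t : ℝ) (j : Fin d) : SchwOp (d + d) :=
  ((1 - t : ℝ) : ℂ) • posDeriv j + Complex.I • freqMul j

lemma hasDerivAt_opIntegrand (t : ℝ) (b : Schw (d + d)) (f : Schw d) (x : V) (j : Fin d)
    (p : V × V) (s : ℝ) : HasDerivAt
      (fun s : ℝ => opIntegrand t b f (x + s • EuclideanSpace.single j 1) p)
      (opIntegrand t (leftDeriv t j b) f (x + s • EuclideanSpace.single j 1) p) s := by
  have h0 : HasDerivAt (fun s : ℝ => x + s • EuclideanSpace.single j (1 : ℝ))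
      (EuclideanSpace.single j (1 : ℝ)) s := by
    simpa using ((hasDerivAt_id s).smul_const (EuclideanSpace.single j (1 : ℝ))).const_add x
  have h1 : HasDerivAt (fun s : ℝ => phasePoint ((1 - t) • (x + s • EuclideanSpace.single j (1 : ℝ))
      + t • p.1) p.2) ((1 - t) • EuclideanSpace.single (Fin.castAdd d j) (1 : ℝ)) s := by
    have h2 := ((h0.const_smul (1 - t)).add_const (t • p.1)).prodMk (hasDerivAt_const s p.2)
    have h3 := (phaseCLM d).hasFDerivAt.comp_hasDerivAt s h2
    have h4 : phaseCLM d ((1 - t) • EuclideanSpace.single j (1 : ℝ), 0) =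
        (1 - t) • EuclideanSpace.single (Fin.castAdd d j) (1 : ℝ) := by
      rw [← phasePoint_single_zero, ← phaseCLM_apply (EuclideanSpace.single j (1 : ℝ), 0),
        ← map_smul, Prod.smul_mk, smul_zero]
    rw [h4] at h3
    exact h3
  have h2 := (b.differentiableAt (x := phasePoint ((1 - t) • (x + s • EuclideanSpace.single j
    (1 : ℝ)) + t • p.1) p.2)).hasFDerivAt.comp_hasDerivAt s h1
  have h3 : HasDerivAt (fun s : ℝ => inner ℝ (x + s • EuclideanSpace.single j (1 : ℝ) - p.1) p.2)
      (p.2 j) s := by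
    have h4 := (h0.sub_const p.1).inner ℝ (hasDerivAt_const s p.2)
    have h5 : inner ℝ (x + s • EuclideanSpace.single j (1 : ℝ) - p.1) 0 +
        inner ℝ (EuclideanSpace.single j (1 : ℝ)) p.2 = p.2 j := by
      rw [inner_zero_right, EuclideanSpace.inner_single_left]
      simp
    rw [h5] at h4
    exact h4
  have h4 := ((h3.ofReal_comp).const_mul Complex.I).cexp
  have h5 := (h2.mul_const (f p.1)).mul h4
  refine h5.congr_deriv ?_
  simp only [opIntegrand, leftDeriv, add_apply, smul_apply, coordMul_apply, coordDeriv_apply,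
    phasePoint_natAdd, map_smul, smul_eq_mul, Complex.real_smul, Function.comp_apply]
  ring

/-- Differentiation under the integral sign, dominated by the bound of `norm_opIntegrand_le`,
uniform in the base point. -/
lemma hasDerivAt_pseudoOp (t : ℝ) (b : Schw (d + d)) (f : Schw d) (x : V) (j : Fin d) :
    HasDerivAt (fun s : ℝ => pseudoOp t b f (x + s • EuclideanSpace.single j 1))
      (pseudoOp t (leftDeriv t j b) f x) 0 := by
  have h : HasDerivAt
      (fun s : ℝ => ∫ p, opIntegrand t b f (x + s • EuclideanSpace.single j 1) p)
      (∫ p, opIntegrand t (leftDeriv t j b) f (x + (0 : ℝ) • EuclideanSpace.single j 1) p) 0 := by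
    refine (hasDerivAt_integral_of_dominated_loc_of_deriv_le (s := Set.univ)
      (F' := fun s p => opIntegrand t (leftDeriv t j b) f (x + s • EuclideanSpace.single j 1) p)
      (bound := fun p => weightSup (d + 1) (leftDeriv t j b) * weightSup (d + 1) f *
        phaseWeight d p) Filter.univ_mem ?_ ?_ ?_ ?_ ?_ ?_).2
    · exact Filter.Eventually.of_forall fun s =>
        (continuous_opIntegrand t b f _).aestronglyMeasurable
    · exact opConverges_schwartz t b f _
    · exact (continuous_opIntegrand t (leftDeriv t j b) f _).aestronglyMeasurable
    · exact Filter.Eventually.of_forall fun p s _ =>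
        norm_opIntegrand_le t (leftDeriv t j b) f _ p
    · exact (integrable_phaseWeight d).const_mul _
    · exact Filter.Eventually.of_forall fun p s _ => hasDerivAt_opIntegrand t b f x j p s
  rw [zero_smul, add_zero] at h
  exact h.const_mul (((2 * Real.pi) ^ d : ℝ) : ℂ)⁻¹

end OpCalculus

/-! ### The oscillator on phase space -/

lemma linearCombination_mul_of_canonical {R : Type*} [Ring R] [Algebra ℂ R]
    {x y u v x' y' u' v' : R} {δ : ℂ} (a b c e a' b' c' e' : ℂ)
    (hxx : x * x' = x' * x) (hxy : x * y' = y' * x) (hyx : y * x' = x' * y)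
    (hyy : y * y' = y' * y) (huu : u * u' = u' * u) (huv : u * v' = v' * u)
    (hvu : v * u' = u' * v) (hvv : v * v' = v' * v)
    (hux : u * x' = x' * u + δ • (1 : R)) (huy : u * y' = y' * u)
    (hvx : v * x' = x' * v) (hvy : v * y' = y' * v + δ • (1 : R))
    (hxu : x * u' = u' * x - δ • (1 : R)) (hxv : x * v' = v' * x)
    (hyu : y * u' = u' * y) (hyv : y * v' = v' * y - δ • (1 : R)) :
    (a • x + b • y + c • u + e • v) * (a' • x' + b' • y' + c' • u' + e' • v') =
      (a' • x' + b' • y' + c' • u' + e' • v') * (a • x + b • y + c • u + e • v) +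
        (δ * (c * a' - a * c' + e * b' - b * e')) • (1 : R) := by
  simp only [add_mul, mul_add, smul_mul_smul_comm, hxx, hxy, hyx, hyy, huu, huv, hvu, hvv, hux,
    huy, hvx, hvy, hxu, hxv, hyu, hyv]
  module

section PhaseSpace

variable {d : ℕ}

local notation "V" => EuclideanSpace ℝ (Fin d)

/-- A general first-order operator of degree one in the phase space variables with index `j`. -/
def phaseLinear (a b c e : ℂ) (j : Fin d) : SchwOp (d + d) :=
  a • posMul j + b • freqMul j + c • posDeriv j + e • freqDeriv j

/-- The commutator of two operators linear in positions and derivatives is a scalar, the symplectic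
form of their coefficient vectors. All commutation relations below reduce to evaluating it. -/
lemma phaseLinear_mul (a b c e a' b' c' e' : ℂ) (j k : Fin d) :
    phaseLinear a b c e j * phaseLinear a' b' c' e' k =
      phaseLinear a' b' c' e' k * phaseLinear a b c e j +
      (if j = k then c * a' - a * c' + e * b' - b * e' else 0) • (1 : SchwOp (d + d)) := by
  have h1 : ∀ j k : Fin d, (Fin.castAdd d j = Fin.natAdd d k) = False := fun j k =>
    eq_false (castAdd_ne_natAdd j k)
  have h2 : ∀ j k : Fin d, (Fin.natAdd d j = Fin.castAdd d k) = False := fun j k =>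
    eq_false (castAdd_ne_natAdd k j).symm
  have hs : ∀ i l : Fin (d + d), (coordMul i : SchwOp (d + d)) * coordDeriv l =
      coordDeriv l * coordMul i - if i = l then 1 else 0 := fun i l => by
    rw [coordDeriv_mul_coordMul, if_congr (eq_comm (a := l)) rfl rfl, add_sub_cancel_right]
  rw [phaseLinear, phaseLinear, linearCombination_mul_of_canonical (δ := if j = k then 1 else 0)
    a b c e a' b' c' e' (coordMul_comm _ _) (coordMul_comm _ _) (coordMul_comm _ _)
    (coordMul_comm _ _) (coordDeriv_comm _ _) (coordDeriv_comm _ _) (coordDeriv_comm _ _)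
    (coordDeriv_comm _ _)]
  · simp only [ite_mul, one_mul, zero_mul]
  all_goals
    first
    | simp only [coordDeriv_mul_coordMul, h1, h2, (Fin.castAdd_injective d d).eq_iff,
        (Fin.natAdd_injective d d).eq_iff, if_false, add_zero, ite_smul, one_smul, zero_smul]
      done
    | simp only [hs, h1, h2, (Fin.castAdd_injective d d).eq_iff,
        (Fin.natAdd_injective d d).eq_iff, if_false, sub_zero, ite_smul, one_smul, zero_smul]

lemma commute_phaseLinear {a b c e a' b' c' e' : ℂ} (h : c * a' - a * c' + e * b' - b * e' = 0)
    (j k : Fin d) : Commute (phaseLinear a b c e j) (phaseLinear a' b' c' e' k) := by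
  rw [Commute, SemiconjBy, phaseLinear_mul, h]
  simp

lemma inner_phaseLinear {a b c e a' b' c' e' : ℂ} (ha : (starRingEnd ℂ) a = a')
    (hb : (starRingEnd ℂ) b = b') (hc : (starRingEnd ℂ) c = -c') (he : (starRingEnd ℂ) e = -e')
    (j : Fin d) (f g : Schw (d + d)) :
    inner ℂ (toL2 (phaseLinear a b c e j f)) (toL2 g) =
      inner ℂ (toL2 f) (toL2 (phaseLinear a' b' c' e' j g)) := by
  simp only [phaseLinear, add_apply, smul_apply, map_add, map_smul, inner_add_left,
    inner_add_right, inner_smul_left, inner_smul_right, inner_coordMul, inner_coordDeriv, ha, hb,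
    hc, he]
  ring

/-- The symbol of `xⱼ ∘ Op_t(b)`. -/
def leftMul (t : ℝ) (j : Fin d) : SchwOp (d + d) := phaseLinear 1 0 0 (t * Complex.I) j

/-- The symbol of `Op_t(b) ∘ xⱼ`. -/
def rightMul (t : ℝ) (j : Fin d) : SchwOp (d + d) := phaseLinear 1 0 0 (-((1 - t) * Complex.I)) j

/-- The symbol of `Op_t(b) ∘ ∂ⱼ`. -/
def rightDeriv (t : ℝ) (j : Fin d) : SchwOp (d + d) := phaseLinear 0 Complex.I (-t) 0 j

lemma leftDeriv_eq (t : ℝ) (j : Fin d) :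
    leftDeriv t j = phaseLinear 0 Complex.I (1 - t) 0 j := by
  simp only [leftDeriv, phaseLinear]
  push_cast
  module

lemma neg_rightDeriv (t : ℝ) (j : Fin d) :
    -rightDeriv t j = phaseLinear 0 (-Complex.I) t 0 j := by
  simp only [rightDeriv, phaseLinear]
  module

lemma pseudoOp_phaseLinear (t : ℝ) (a b c e : ℂ) (j : Fin d) (u : Schw (d + d)) (f : Schw d)
    (x : V) : pseudoOp t (phaseLinear a b c e j u) f x =
      a * pseudoOp t (posMul j u) f x + b * pseudoOp t (freqMul j u) f x +
      c * pseudoOp t (posDeriv j u) f x + e * pseudoOp t (freqDeriv j u) f x := by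
  rw [phaseLinear]
  simp only [add_apply, smul_apply, pseudoOp_add_symbol, pseudoOp_smul_symbol]

/-- The term `t Op_t(b) xⱼ` produced by the position variable is cancelled by the frequency
derivative with coefficient `t i`. -/
lemma pseudoOp_leftMul (t : ℝ) (j : Fin d) (b : Schw (d + d)) (f : Schw d) (x : V) :
    pseudoOp t (leftMul t j b) f x = x j * pseudoOp t b f x := by
  rw [leftMul, pseudoOp_phaseLinear, pseudoOp_posMul, pseudoOp_freqDeriv]
  linear_combination t * (pseudoOp t b (coordMul j f) x - x j * pseudoOp t b f x) * Complex.I_sq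

lemma pseudoOp_rightMul (t : ℝ) (j : Fin d) (b : Schw (d + d)) (f : Schw d) (x : V) :
    pseudoOp t (rightMul t j b) f x = pseudoOp t b (coordMul j f) x := by
  rw [rightMul, pseudoOp_phaseLinear, pseudoOp_posMul, pseudoOp_freqDeriv]
  linear_combination (t - 1) * (pseudoOp t b (coordMul j f) x - x j * pseudoOp t b f x) *
    Complex.I_sq

lemma pseudoOp_rightDeriv (t : ℝ) (j : Fin d) (b : Schw (d + d)) (f : Schw d) (x : V) :
    pseudoOp t (rightDeriv t j b) f x = pseudoOp t b (coordDeriv j f) x := by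
  rw [rightDeriv, pseudoOp_phaseLinear, pseudoOp_coordDeriv]
  ring

/-- Used only where `Op_t(b) f` is already known to be a multiple of a Schwartz function. For
rank-one operators this suffices, and no mapping property of `Op_t` is required. -/
lemma pseudoOp_leftDeriv {t : ℝ} {b : Schw (d + d)} {f h : Schw d} {c : ℂ}
    (hb : ∀ x, pseudoOp t b f x = c * h x) (j : Fin d) (x : V) :
    pseudoOp t (leftDeriv t j b) f x = c * coordDeriv j h x := by
  have h1 := hasDerivAt_pseudoOp t b f x j
  have h2 : HasDerivAt (fun s : ℝ => pseudoOp t b f (x + s • EuclideanSpace.single j 1))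
      (c * coordDeriv j h x) 0 := by
    simp only [hb]
    refine HasDerivAt.const_mul c ?_
    rw [coordDeriv_apply]
    exact (h.differentiableAt.hasFDerivAt).hasLineDerivAt _
  exact h1.unique h2

/-- The positive constant `t² + (1-t)²`. -/
def spread (t : ℝ) : ℝ := t ^ 2 + (1 - t) ^ 2

lemma spread_pos (t : ℝ) : 0 < spread t := by
  unfold spread; nlinarith [sq_nonneg (2 * t - 1)]

/-- The exponent of the symbol of the projection onto the Gaussian. -/
def vacuumExponent (d : ℕ) (t : ℝ) (p : EuclideanSpace ℝ (Fin (d + d))) : ℂ :=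
  ((-(1 / (2 * spread t)) : ℝ) : ℂ) * ((‖p‖ ^ 2 : ℝ) : ℂ) +
    ((2 * t - 1) / spread t : ℝ) * Complex.I *
      ∑ j : Fin d, (p (Fin.castAdd d j) : ℂ) * (p (Fin.natAdd d j) : ℂ)

lemma hasTemperateGrowth_vacuumExponent (d : ℕ) (t : ℝ) :
    (vacuumExponent d t).HasTemperateGrowth := by
  refine (hasTemperateGrowth_const_mul_norm_sq _).add
    ((Function.HasTemperateGrowth.const _).mul (Function.HasTemperateGrowth.sum fun j _ => ?_))
  exact (hasTemperateGrowth_coord _).mul (hasTemperateGrowth_coord _)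

lemma re_vacuumExponent (d : ℕ) (t : ℝ) (p : EuclideanSpace ℝ (Fin (d + d))) :
    (vacuumExponent d t p).re = -(1 / (2 * spread t)) * ‖p‖ ^ 2 := by
  have h : (∑ j : Fin d, (p (Fin.castAdd d j) : ℂ) * (p (Fin.natAdd d j) : ℂ)) =
      ((∑ j : Fin d, p (Fin.castAdd d j) * p (Fin.natAdd d j) : ℝ) : ℂ) := by push_cast; rfl
  rw [vacuumExponent, h, mul_right_comm, ← Complex.ofReal_mul, ← Complex.ofReal_mul]
  simp only [Complex.add_re, Complex.ofReal_re, Complex.re_ofReal_mul, Complex.I_re, mul_zero,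
    add_zero]

/-- The symbol of a multiple of the projection onto the Gaussian. -/
def phaseVacuum (d : ℕ) (t : ℝ) : Schw (d + d) :=
  expSchwartz (vacuumExponent d t) (hasTemperateGrowth_vacuumExponent d t)
    (b := 1 / (2 * spread t)) (by have := spread_pos t; positivity)
    fun p => (re_vacuumExponent d t p).le

lemma hasFDerivAt_vacuumExponent (t : ℝ) (p : EuclideanSpace ℝ (Fin (d + d))) :
    HasFDerivAt (vacuumExponent d t)
      (((-(1 / (2 * spread t)) : ℝ) : ℂ) • (Complex.ofRealCLM ∘L (2 • innerSL ℝ p)) +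
        (((2 * t - 1) / spread t : ℝ) * Complex.I) • ∑ j : Fin d,
          ((p (Fin.castAdd d j) : ℂ) • (Complex.ofRealCLM ∘L (EuclideanSpace.proj (Fin.natAdd d j) :
            EuclideanSpace ℝ (Fin (d + d)) →L[ℝ] ℝ)) +
          (p (Fin.natAdd d j) : ℂ) • (Complex.ofRealCLM ∘L (EuclideanSpace.proj (Fin.castAdd d j) :
            EuclideanSpace ℝ (Fin (d + d)) →L[ℝ] ℝ)))) p := by
  have hc : ∀ i : Fin (d + d), HasFDerivAt (fun x : EuclideanSpace ℝ (Fin (d + d)) => (x i : ℂ))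
      (Complex.ofRealCLM ∘L (EuclideanSpace.proj i :
        EuclideanSpace ℝ (Fin (d + d)) →L[ℝ] ℝ)) p := fun i =>
    (Complex.ofRealCLM ∘L (EuclideanSpace.proj i :
        EuclideanSpace ℝ (Fin (d + d)) →L[ℝ] ℝ)).hasFDerivAt
  exact (hasFDerivAt_const_mul_norm_sq p _).add
    ((HasFDerivAt.fun_sum fun j _ => (hc (Fin.castAdd d j)).mul (hc (Fin.natAdd d j))).const_mul _)

lemma posDeriv_phaseVacuum (t : ℝ) (j : Fin d) (p : EuclideanSpace ℝ (Fin (d + d))) :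
    posDeriv j (phaseVacuum d t) p =
      (-(p (Fin.castAdd d j) : ℂ) / spread t +
        (2 * t - 1) / spread t * Complex.I * p (Fin.natAdd d j)) * phaseVacuum d t p := by
  rw [phaseVacuum, coordDeriv_expSchwartz, (hasFDerivAt_vacuumExponent t p).fderiv,
    expSchwartz_apply]
  have h1 : ∀ k : Fin d, (Fin.natAdd d k = Fin.castAdd d j) = False := fun k =>
    eq_false (castAdd_ne_natAdd j k).symm
  have hs : (spread t : ℂ) ≠ 0 := by exact_mod_cast (spread_pos t).ne'
  simp [-Fin.natAdd_eq_addNat, EuclideanSpace.inner_single_right, h1,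
    sum_apply, PiLp.single_apply, (Fin.castAdd_injective d d).eq_iff]
  simp only [apply_ite Complex.ofReal, Complex.ofReal_one, Complex.ofReal_zero, mul_ite, mul_one,
    mul_zero, Finset.sum_ite_eq', Finset.mem_univ, if_true]
  field_simp

lemma freqDeriv_phaseVacuum (t : ℝ) (j : Fin d) (p : EuclideanSpace ℝ (Fin (d + d))) :
    freqDeriv j (phaseVacuum d t) p =
      (-(p (Fin.natAdd d j) : ℂ) / spread t +
        (2 * t - 1) / spread t * Complex.I * p (Fin.castAdd d j)) * phaseVacuum d t p := by
  rw [phaseVacuum, coordDeriv_expSchwartz, (hasFDerivAt_vacuumExponent t p).fderiv,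
    expSchwartz_apply]
  have h1 : ∀ k : Fin d, (Fin.castAdd d k = Fin.natAdd d j) = False := fun k =>
    eq_false (castAdd_ne_natAdd k j)
  have hs : (spread t : ℂ) ≠ 0 := by exact_mod_cast (spread_pos t).ne'
  simp [-Fin.natAdd_eq_addNat, EuclideanSpace.inner_single_right, h1,
    sum_apply, PiLp.single_apply, (Fin.natAdd_injective d d).eq_iff]
  simp only [apply_ite Complex.ofReal, Complex.ofReal_one, Complex.ofReal_zero, mul_ite, mul_one,
    mul_zero, Finset.sum_ite_eq', Finset.mem_univ, if_true]
  field_simp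

/-- The position operators of the phase space oscillator. -/
def phaseP (d : ℕ) (t : ℝ) : Fin (d + d) → SchwOp (d + d) :=
  Fin.append (leftMul t) (rightMul t)

/-- The derivative operators of the phase space oscillator. -/
def phaseQ (d : ℕ) (t : ℝ) : Fin (d + d) → SchwOp (d + d) :=
  Fin.append (leftDeriv t) fun j => -rightDeriv t j

lemma forall_fin_add {p : Fin (d + d) → Prop} (h1 : ∀ j, p (Fin.castAdd d j))
    (h2 : ∀ j, p (Fin.natAdd d j)) (i : Fin (d + d)) : p i :=
  Fin.addCases h1 h2 i

lemma phaseP_left (t : ℝ) (j : Fin d) : phaseP d t (Fin.castAdd d j) = leftMul t j := by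
  rw [phaseP, Fin.append_left]

lemma phaseP_right (t : ℝ) (j : Fin d) : phaseP d t (Fin.natAdd d j) = rightMul t j := by
  rw [phaseP, Fin.append_right]

lemma phaseQ_left (t : ℝ) (j : Fin d) : phaseQ d t (Fin.castAdd d j) = leftDeriv t j := by
  rw [phaseQ, Fin.append_left]

lemma phaseQ_right (t : ℝ) (j : Fin d) : phaseQ d t (Fin.natAdd d j) = -rightDeriv t j := by
  rw [phaseQ, Fin.append_right]

/-- Left and right compositions commute with each other. Right composition reverses products, which
is why `rightDeriv` enters with a minus sign. -/
lemma phaseQ_mul_phaseP (t : ℝ) (i k : Fin (d + d)) :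
    phaseQ d t i * phaseP d t k = phaseP d t k * phaseQ d t i + if i = k then 1 else 0 := by
  revert i k
  refine forall_fin_add (fun i => forall_fin_add (fun k => ?_) fun k => ?_)
    (fun i => forall_fin_add (fun k => ?_) fun k => ?_)
  · rw [phaseP_left, phaseQ_left, leftDeriv_eq, leftMul, phaseLinear_mul]
    simp only [(Fin.castAdd_injective d d).eq_iff, add_right_inj]
    split_ifs
    · rw [show (1 - (t : ℂ)) * 1 - 0 * 0 + 0 * 0 - Complex.I * (t * Complex.I) = 1 by
        linear_combination -(t : ℂ) * Complex.I_sq, one_smul]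
    · simp
  · rw [phaseP_right, phaseQ_left, leftDeriv_eq, rightMul, phaseLinear_mul,
      if_neg (castAdd_ne_natAdd i k)]
    rw [show (1 - (t : ℂ)) * 1 - 0 * 0 + 0 * 0 - Complex.I * -((1 - t) * Complex.I) = 0 by
      linear_combination (1 - (t : ℂ)) * Complex.I_sq]
    simp
  · rw [phaseP_left, phaseQ_right, neg_rightDeriv, leftMul, phaseLinear_mul,
      if_neg (castAdd_ne_natAdd k i).symm]
    rw [show (t : ℂ) * 1 - 0 * 0 + 0 * 0 - -Complex.I * (t * Complex.I) = 0 by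
      linear_combination (t : ℂ) * Complex.I_sq]
    simp
  · rw [phaseP_right, phaseQ_right, neg_rightDeriv, rightMul, phaseLinear_mul]
    simp only [(Fin.natAdd_injective d d).eq_iff, add_right_inj]
    split_ifs
    · rw [show (t : ℂ) * 1 - 0 * 0 + 0 * 0 - -Complex.I * -((1 - t) * Complex.I) = 1 by
        linear_combination ((t : ℂ) - 1) * Complex.I_sq, one_smul]
    · simp

/-- Once the exponential is factored out, this is an identity between linear forms in the
coordinates; it holds because of the value of `spread t`. -/
lemma phase_vacuum_annih (t : ℝ) (i : Fin (d + d)) :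
    phaseP d t i (phaseVacuum d t) + phaseQ d t i (phaseVacuum d t) = 0 := by
  have hs : (spread t : ℂ) ≠ 0 := by exact_mod_cast (spread_pos t).ne'
  have hs' : (spread t : ℂ) = t ^ 2 + (1 - t) ^ 2 := by rw [spread]; push_cast; rfl
  revert i
  refine forall_fin_add (fun i => ?_) fun i => ?_
  · rw [phaseP_left, phaseQ_left, leftMul, leftDeriv_eq]
    ext p
    simp only [phaseLinear, add_apply, smul_apply, posDeriv_phaseVacuum, freqDeriv_phaseVacuum,
      coordMul_apply, smul_eq_mul, zero_apply]
    field_simp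
    ring_nf
    simp only [hs', Complex.I_sq]
    ring
  · rw [phaseP_right, phaseQ_right, neg_rightDeriv, rightMul]
    ext p
    simp only [phaseLinear, add_apply, smul_apply, posDeriv_phaseVacuum, freqDeriv_phaseVacuum,
      coordMul_apply, smul_eq_mul, zero_apply]
    field_simp
    ring_nf
    simp only [hs', Complex.I_sq]
    ring

/-- The four linear relations are invertible: for instance position is `(1 - t)` times left plus `t`
times right multiplication, and the position derivative is left minus right differentiation. -/
lemma weylGen_phase (t : ℝ) (l : Fin (d + d) ⊕ Fin (d + d)) : ∃ p q : Fin (d + d) → ℂ,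
    weylGen l = ∑ j, p j • phaseP d t j + ∑ j, q j • phaseQ d t j := by
  have key : ∀ (j : Fin d) (p₁ p₂ q₁ q₂ : ℂ), ∑ i, (Fin.append (Pi.single j p₁ : Fin d → ℂ)
      (Pi.single j p₂) : Fin (d + d) → ℂ) i • phaseP d t i +
      ∑ i, (Fin.append (Pi.single j q₁ : Fin d → ℂ)
      (Pi.single j q₂) : Fin (d + d) → ℂ) i • phaseQ d t i =
      p₁ • leftMul t j + p₂ • rightMul t j + (q₁ • leftDeriv t j + q₂ • -rightDeriv t j) := by
    intro j p₁ p₂ q₁ q₂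
    rw [Fin.sum_univ_add, Fin.sum_univ_add]
    simp only [Fin.append_left, Fin.append_right, phaseP_left, phaseP_right, phaseQ_left,
      phaseQ_right]
    simp [Pi.single_apply, ite_smul]
  rcases l with i | i
  · revert i
    refine forall_fin_add (fun j => ?_) fun j => ?_
    · refine ⟨_, _, .trans ?_ (key j (1 - t) t 0 0).symm⟩
      simp only [leftMul, rightMul, phaseLinear, weylGen, Sum.elim_inl]
      module
    · refine ⟨_, _, .trans ?_ (key j 0 0 (-(Complex.I * t)) (Complex.I * (1 - t))).symm⟩
      rw [leftDeriv_eq, neg_rightDeriv]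
      simp only [phaseLinear, weylGen, Sum.elim_inl]
      match_scalars <;> first | ring1 | linear_combination Complex.I_sq
  · revert i
    refine forall_fin_add (fun j => ?_) fun j => ?_
    · refine ⟨_, _, .trans ?_ (key j 0 0 1 1).symm⟩
      rw [leftDeriv_eq, neg_rightDeriv]
      simp only [phaseLinear, weylGen, Sum.elim_inr]
      module
    · refine ⟨_, _, .trans ?_ (key j (-Complex.I) Complex.I 0 0).symm⟩
      simp only [leftMul, rightMul, phaseLinear, weylGen, Sum.elim_inr]
      match_scalars <;> first | ring1 | linear_combination Complex.I_sq

/-- The oscillator on phase space whose excited states are the symbols of the rank-one operators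
built from Hermite functions. -/
def phaseOscillator (d : ℕ) (t : ℝ) : Oscillator (d + d) :=
  Oscillator.ofCanonical (phaseP d t) (phaseQ d t) (phaseVacuum d t)
    (by
      refine forall_fin_add (fun i => forall_fin_add (fun k => ?_) fun k => ?_)
        (fun i => forall_fin_add (fun k => ?_) fun k => ?_) <;>
      simp only [phaseP_left, phaseP_right, leftMul, rightMul] <;>
      exact commute_phaseLinear (by ring) _ _)
    (by
      refine forall_fin_add (fun i => forall_fin_add (fun k => ?_) fun k => ?_)
        (fun i => forall_fin_add (fun k => ?_) fun k => ?_) <;>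
      simp only [phaseQ_left, phaseQ_right, leftDeriv_eq, neg_rightDeriv] <;>
      exact commute_phaseLinear (by ring) _ _)
    (phaseQ_mul_phaseP t)
    (by
      refine forall_fin_add (fun i f g => ?_) fun i f g => ?_ <;>
      simp only [phaseP_left, phaseP_right, leftMul, rightMul] <;>
      exact inner_phaseLinear (by simp) (by simp) (by simp) (by simp) _ _ _)
    (by
      refine forall_fin_add (fun i f g => ?_) fun i f g => ?_
      · rw [phaseQ_left, leftDeriv_eq, ← inner_neg_right, ← map_neg,
          inner_phaseLinear (a' := 0) (b' := -Complex.I) (c' := -(1 - t)) (e' := 0) (by simp)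
          (by simp) (by simp) (by simp)]
        congr 2
        simp only [phaseLinear, add_apply, smul_apply]
        module
      · rw [phaseQ_right, neg_rightDeriv, ← inner_neg_right, ← map_neg,
          inner_phaseLinear (a' := 0) (b' := Complex.I) (c' := -t) (e' := 0) (by simp)
          (by simp) (by simp) (by simp)]
        congr 2
        simp only [phaseLinear, add_apply, smul_apply]
        module)
    (phase_vacuum_annih t) (weylGen_phase t)

end PhaseSpace

namespace Oscillator

variable {n : ℕ} (O : Oscillator n)

lemma coeff_annih (j : Fin n) (f : Schw n) (k : Fin n → ℕ) :
    O.coeff (O.annih j f) k = (Real.sqrt (k j + 1) : ℂ) * O.coeff f (k + Pi.single j 1) := by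
  have h : O.coeff (O.annih j f) k = inner ℂ (toL2 (O.create j (O.state k))) (toL2 f) := by
    rw [coeff, ← inner_conj_symm _ (toL2 f), ← O.adjoint, inner_conj_symm]
  rw [h, create_state, map_smul, inner_smul_left, Complex.conj_ofReal]
  rfl

end Oscillator

/-! ### Excited states as symbols of rank-one operators -/

section RankOne

variable {d : ℕ}

local notation "V" => EuclideanSpace ℝ (Fin d)

/-- The normalisation of the rank-one operators. -/
def rankOneConst (d : ℕ) (t : ℝ) : ℂ :=
  (((2 * Real.pi) ^ d : ℝ) : ℂ)⁻¹ * (Real.pi / ((1 / (2 * spread t) : ℝ) : ℂ)) ^ (d / 2 : ℂ)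

lemma rankOneConst_ne_zero (d : ℕ) (t : ℝ) : rankOneConst d t ≠ 0 := by
  have hs := spread_pos t
  have hp := Real.pi_pos
  refine mul_ne_zero (inv_ne_zero ?_) ?_
  · exact_mod_cast (by positivity : (2 * Real.pi) ^ d ≠ 0)
  · rw [Complex.cpow_ne_zero_iff]
    left
    refine div_ne_zero (by exact_mod_cast hp.ne') ?_
    exact_mod_cast (by positivity : 1 / (2 * spread t) ≠ 0)

lemma vacuumExponent_phasePoint (t : ℝ) (X ξ : V) :
    vacuumExponent d t (phasePoint X ξ) =
      -((1 / (2 * spread t) : ℝ) : ℂ) * (‖X‖ ^ 2 : ℝ) +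
      (-((1 / (2 * spread t) : ℝ) : ℂ) * (‖ξ‖ : ℂ) ^ 2 + Complex.I *
        ((inner ℝ (((2 * t - 1) / spread t) • X) ξ : ℝ) : ℂ)) := by
  have h : ((∑ j : Fin d, (X j : ℂ) * (ξ j : ℂ)) : ℂ) = ((inner ℝ X ξ : ℝ) : ℂ) := by
    rw [PiLp.inner_apply]
    push_cast
    exact Finset.sum_congr rfl fun j _ => by simp [mul_comm]
  rw [vacuumExponent, norm_phasePoint_sq]
  simp only [phasePoint_castAdd, phasePoint_natAdd, h, real_inner_smul_left]
  push_cast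
  ring

/-- After the Gaussian integral in `ξ` the exponent has to split into a function of `x` plus a
function of `y`. This identity is that splitting, and it accounts for the coefficients in
`vacuumExponent`. -/
lemma vacuum_exponent_identity (t : ℝ) (x y : V) :
    1 / (2 * spread t) * ‖(1 - t) • x + t • y‖ ^ 2 +
      ‖((2 * t - 1) / spread t) • ((1 - t) • x + t • y) + (x - y)‖ ^ 2 /
        (4 * (1 / (2 * spread t))) = 1 / 2 * ‖x‖ ^ 2 + 1 / 2 * ‖y‖ ^ 2 := by
  have hs := (spread_pos t).ne'
  simp only [EuclideanSpace.real_norm_sq_eq, Finset.mul_sum, Finset.sum_div,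
    ← Finset.sum_add_distrib]
  refine Finset.sum_congr rfl fun j _ => ?_
  simp only [PiLp.add_apply, PiLp.smul_apply, PiLp.sub_apply, smul_eq_mul]
  field_simp
  rw [spread]
  ring

lemma integral_opIntegrand_phaseVacuum (t : ℝ) (f : Schw d) (x y : V) :
    ∫ ξ, opIntegrand t (phaseVacuum d t) f x (y, ξ) =
      (Real.pi / ((1 / (2 * spread t) : ℝ) : ℂ)) ^ (d / 2 : ℂ) *
        ((starRingEnd ℂ) (stdGaussian d y) * f y) * stdGaussian d x := by
  set b : ℂ := ((1 / (2 * spread t) : ℝ) : ℂ) with hb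
  have hs := spread_pos t
  set X : V := (1 - t) • x + t • y with hX
  have e : ∀ ξ : V, opIntegrand t (phaseVacuum d t) f x (y, ξ) =
      Complex.exp (-b * (‖X‖ ^ 2 : ℝ)) * f y * Complex.exp (-b * (‖ξ‖ : ℂ) ^ 2 + Complex.I *
        ((inner ℝ (((2 * t - 1) / spread t) • X + (x - y)) ξ : ℝ) : ℂ)) := by
    intro ξ
    rw [opIntegrand, phaseVacuum, expSchwartz_apply, vacuumExponent_phasePoint, inner_add_left,
      Complex.exp_add, ← hb, ← hX, Complex.ofReal_add, mul_add, ← add_assoc,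
      Complex.exp_add _ (Complex.I * ((inner ℝ (x - y) ξ : ℝ) : ℂ))]
    ring
  simp only [e]
  have hbre : 0 < b.re := by
    rw [hb, Complex.ofReal_re]; positivity
  rw [integral_const_mul, GaussianFourier.integral_cexp_neg_mul_sq_norm_add hbre,
    finrank_euclideanSpace, Fintype.card_fin, stdGaussian_apply, stdGaussian_apply, Complex.conj_ofReal,
    Complex.ofReal_exp, Complex.ofReal_exp]
  have key : Complex.exp (-b * (‖X‖ ^ 2 : ℝ)) * Complex.exp (Complex.I ^ 2 *
      (‖((2 * t - 1) / spread t) • X + (x - y)‖ : ℂ) ^ 2 / (4 * b)) =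
      Complex.exp ((-1 / 2 * ‖y‖ ^ 2 : ℝ) : ℂ) * Complex.exp ((-1 / 2 * ‖x‖ ^ 2 : ℝ) : ℂ) := by
    rw [← Complex.exp_add, ← Complex.exp_add, Complex.I_sq, hb]
    congr 1
    have h := congrArg (fun r : ℝ => (r : ℂ)) (vacuum_exponent_identity t x y)
    push_cast at h ⊢
    linear_combination -h
  linear_combination ((Real.pi : ℂ) / b) ^ (d / 2 : ℂ) * f y * key

lemma pseudoOp_phaseVacuum (t : ℝ) (f : Schw d) (x : V) :
    pseudoOp t (phaseVacuum d t) f x =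
      rankOneConst d t * (stdOscillator d).coeff f 0 * stdGaussian d x := by
  have h0 : (stdOscillator d).coeff f 0 = ∫ y, (starRingEnd ℂ) (stdGaussian d y) * f y := by
    rw [Oscillator.coeff, Oscillator.state_zero, inner_toL2]
    rfl
  have hi := opConverges_schwartz t (phaseVacuum d t) f x
  rw [Measure.volume_eq_prod] at hi
  rw [pseudoOp, Measure.volume_eq_prod, integral_prod _ hi]
  simp only [integral_opIntegrand_phaseVacuum]
  rw [integral_mul_const, integral_const_mul, h0, rankOneConst]
  ring

lemma phaseOscillator_create_left (t : ℝ) (j : Fin d) :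
    (phaseOscillator d t).create (Fin.castAdd d j) =
      (Real.sqrt 2 : ℂ)⁻¹ • (leftMul t j - leftDeriv t j) := by
  rw [← phaseP_left, ← phaseQ_left]
  rfl

lemma phaseOscillator_create_right (t : ℝ) (j : Fin d) :
    (phaseOscillator d t).create (Fin.natAdd d j) =
      (Real.sqrt 2 : ℂ)⁻¹ • (rightMul t j + rightDeriv t j) := by
  rw [← sub_neg_eq_add, ← phaseP_right, ← phaseQ_right]
  rfl

lemma phaseOscillator_annih_right (t : ℝ) (j : Fin d) :
    (phaseOscillator d t).annih (Fin.natAdd d j) =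
      (Real.sqrt 2 : ℂ)⁻¹ • (rightMul t j - rightDeriv t j) := by
  rw [sub_eq_add_neg, ← phaseP_right, ← phaseQ_right]
  rfl

lemma pseudoOp_sub_symbol (t : ℝ) (b b' : Schw (d + d)) (f : Schw d) (x : V) :
    pseudoOp t (b - b' : Schw (d + d)) f x = pseudoOp t b f x - pseudoOp t b' f x := by
  simpa only [opSymbolCLM_apply] using map_sub (opSymbolCLM t f x) b b'

lemma pseudoOp_sub_function (t : ℝ) (b : Schw (d + d)) (f f' : Schw d) (x : V) :
    pseudoOp t b (f - f' : Schw d) x = pseudoOp t b f x - pseudoOp t b f' x := by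
  simpa only [opFunctionCLM_apply] using map_sub (opFunctionCLM t b x) f f'

lemma pseudoOp_create_left {t : ℝ} {b : Schw (d + d)} {f h : Schw d} {c : ℂ}
    (hb : ∀ x, pseudoOp t b f x = c * h x) (j : Fin d) (x : V) :
    pseudoOp t ((phaseOscillator d t).create (Fin.castAdd d j) b) f x =
      c * (stdOscillator d).create j h x := by
  rw [phaseOscillator_create_left, smul_apply, sub_apply, pseudoOp_smul_symbol,
    pseudoOp_sub_symbol, pseudoOp_leftMul, pseudoOp_leftDeriv hb, hb]
  change _ = c * ((Real.sqrt 2 : ℂ)⁻¹ * (coordMul j h x - coordDeriv j h x))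
  rw [coordMul_apply]
  ring

/-- The second block of variables describes the right factor, on which creation turns into
annihilation of the argument. -/
lemma pseudoOp_create_right (t : ℝ) (b : Schw (d + d)) (f : Schw d) (j : Fin d) (x : V) :
    pseudoOp t ((phaseOscillator d t).create (Fin.natAdd d j) b) f x =
      pseudoOp t b ((stdOscillator d).annih j f) x := by
  rw [phaseOscillator_create_right, smul_apply, add_apply, pseudoOp_smul_symbol,
    pseudoOp_add_symbol, pseudoOp_rightMul, pseudoOp_rightDeriv, ← pseudoOp_add_function,
    ← pseudoOp_smul_function]
  rfl

lemma pseudoOp_annih_right (t : ℝ) (b : Schw (d + d)) (f : Schw d) (j : Fin d) (x : V) :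
    pseudoOp t ((phaseOscillator d t).annih (Fin.natAdd d j) b) f x =
      pseudoOp t b ((stdOscillator d).create j f) x := by
  rw [phaseOscillator_annih_right, smul_apply, sub_apply, pseudoOp_smul_symbol,
    pseudoOp_sub_symbol, pseudoOp_rightMul, pseudoOp_rightDeriv, ← pseudoOp_sub_function,
    ← pseudoOp_smul_function]
  rfl

lemma add_single_comp_castAdd (m : Fin (d + d) → ℕ) (j : Fin d) :
    (fun i => (m + Pi.single (Fin.castAdd d j) 1 : Fin (d + d) → ℕ) (Fin.castAdd d i)) =
      (fun i => m (Fin.castAdd d i)) + Pi.single j 1 := by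
  ext i
  simp [Pi.single_apply, (Fin.castAdd_injective d d).eq_iff]

lemma add_single_comp_natAdd (m : Fin (d + d) → ℕ) (j : Fin d) :
    (fun i => (m + Pi.single (Fin.natAdd d j) 1 : Fin (d + d) → ℕ) (Fin.natAdd d i)) =
      (fun i => m (Fin.natAdd d i)) + Pi.single j 1 := by
  ext i
  simp [Pi.single_apply, (Fin.natAdd_injective d d).eq_iff, -Fin.natAdd_eq_addNat]

lemma add_single_castAdd_comp_natAdd (m : Fin (d + d) → ℕ) (j : Fin d) :
    (fun i => (m + Pi.single (Fin.castAdd d j) 1 : Fin (d + d) → ℕ) (Fin.natAdd d i)) =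
      fun i => m (Fin.natAdd d i) := by
  ext i
  simp [(castAdd_ne_natAdd j i).symm, -Fin.natAdd_eq_addNat]

lemma add_single_natAdd_comp_castAdd (m : Fin (d + d) → ℕ) (j : Fin d) :
    (fun i => (m + Pi.single (Fin.natAdd d j) 1 : Fin (d + d) → ℕ) (Fin.castAdd d i)) =
      fun i => m (Fin.castAdd d i) := by
  ext i
  simp [castAdd_ne_natAdd i j, -Fin.natAdd_eq_addNat]

/-- The excited states of the phase space oscillator are symbols of rank-one operators. -/
lemma pseudoOp_phaseState (t : ℝ) (m : Fin (d + d) → ℕ) (f : Schw d) (x : V) :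
    pseudoOp t ((phaseOscillator d t).state m) f x =
      rankOneConst d t * (stdOscillator d).coeff f (fun i => m (Fin.natAdd d i)) *
        (stdOscillator d).state (fun i => m (Fin.castAdd d i)) x := by
  induction m using Oscillator.multiIndex_induction generalizing f x with
  | h0 =>
    rw [Oscillator.state_zero]
    refine (pseudoOp_phaseVacuum t f x).trans ?_
    change _ = _ * (stdOscillator d).state 0 x
    rw [Oscillator.state_zero]
    rfl
  | hs m i ih =>
    have hne : (Real.sqrt (m i + 1) : ℂ) ≠ 0 := by
      exact_mod_cast (Real.sqrt_pos.2 (by positivity)).ne'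
    have h1 : (Real.sqrt (m i + 1) : ℂ) *
        pseudoOp t ((phaseOscillator d t).state (m + Pi.single i 1)) f x =
        pseudoOp t ((phaseOscillator d t).create i ((phaseOscillator d t).state m)) f x := by
      rw [Oscillator.create_state, pseudoOp_smul_symbol]
    refine mul_left_cancel₀ hne (h1.trans ?_)
    clear h1 hne
    revert i
    refine forall_fin_add (fun j => ?_) fun j => ?_
    · rw [pseudoOp_create_left (ih f), Oscillator.create_state, add_single_comp_castAdd,
        add_single_castAdd_comp_natAdd, smul_apply, smul_eq_mul]
      ring
    · rw [pseudoOp_create_right, ih, Oscillator.coeff_annih, add_single_comp_natAdd,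
        add_single_natAdd_comp_castAdd]
      ring

/-- The symbol of `Op_t(b) ∘ N`, where `N` is the number operator. -/
def rightNumber (d : ℕ) (t : ℝ) : SchwOp (d + d) :=
  ∑ j : Fin d, (phaseOscillator d t).create (Fin.natAdd d j) *
    (phaseOscillator d t).annih (Fin.natAdd d j)

/-- Passing to the right swaps creators with annihilators and also reverses their order, so the
number operator is reproduced without a constant. -/
lemma pseudoOp_rightNumber (t : ℝ) (b : Schw (d + d)) (f : Schw d) (x : V) :
    pseudoOp t (rightNumber d t b) f x = pseudoOp t b ((stdOscillator d).number f) x := by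
  have h1 : rightNumber d t b = ∑ j : Fin d, (phaseOscillator d t).create (Fin.natAdd d j)
      ((phaseOscillator d t).annih (Fin.natAdd d j) b) := by simp [rightNumber, sum_apply]
  have h2 : (stdOscillator d).number f = ∑ j : Fin d, (stdOscillator d).create j
      ((stdOscillator d).annih j f) := by simp [Oscillator.number, sum_apply]
  rw [h1, h2, ← opSymbolCLM_apply, ← opFunctionCLM_apply, map_sum, map_sum]
  refine Finset.sum_congr rfl fun j _ => ?_
  rw [opSymbolCLM_apply, opFunctionCLM_apply, pseudoOp_create_right, pseudoOp_annih_right]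

lemma pseudoOp_rightNumber_pow_state (t : ℝ) (b : Schw (d + d)) (m : ℕ) (k : Fin d → ℕ) (x : V) :
    pseudoOp t ((rightNumber d t ^ m) b) ((stdOscillator d).state k) x =
      (multiLength k : ℂ) ^ m * pseudoOp t b ((stdOscillator d).state k) x := by
  induction m generalizing b with
  | zero => simp
  | succ m ih =>
    rw [pow_succ, mul_apply_eq_comp, ih, pseudoOp_rightNumber, Oscillator.number_apply_state,
      pseudoOp_smul_function]
    ring

end RankOne

/-! ### Weyl order of differential operators -/

section OrderBound

variable {n : ℕ}

/-- The operator `T` has Weyl order at most `r` with constant `A`. -/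
def OrderBound (T : SchwOp n) (r : ℕ) (A : ℝ) : Prop :=
  ∀ (f : Schw n) (M : ℕ → ℝ), (∀ m, 0 ≤ M m) → WordBound f M →
    WordBound (T f) fun m => A * M (m + r)

lemma OrderBound.mono {T : SchwOp n} {r : ℕ} {A B : ℝ} (h : OrderBound T r A) (hAB : A ≤ B) :
    OrderBound T r B := fun f M hM hf w x =>
  (h f M hM hf w x).trans (mul_le_mul_of_nonneg_right hAB (hM _))

lemma orderBound_weylGen (l : Fin n ⊕ Fin n) : OrderBound (weylGen l) 1 1 := by
  intro f M _ hf w x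
  have h := hf (w ++ [l]) x
  rw [weylWord_append, weylWord_cons, weylWord_nil, List.length_append,
    List.length_singleton] at h
  simpa using h

lemma orderBound_zero (r : ℕ) : OrderBound (0 : SchwOp n) r 0 := by
  intro f M _ hf w x
  simp

lemma OrderBound.add {S T : SchwOp n} {r : ℕ} {A B : ℝ} (hS : OrderBound S r A)
    (hT : OrderBound T r B) : OrderBound (S + T) r (A + B) := by
  intro f M hM hf w x
  beta_reduce
  rw [add_apply, map_add, add_apply, add_mul]
  exact (norm_add_le _ _).trans (add_le_add (hS f M hM hf w x) (hT f M hM hf w x))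

lemma OrderBound.smul {S : SchwOp n} {r : ℕ} {A : ℝ} (hS : OrderBound S r A) (c : ℂ) :
    OrderBound (c • S) r (‖c‖ * A) := by
  intro f M hM hf w x
  beta_reduce
  rw [smul_apply, map_smul, smul_apply, norm_smul, mul_assoc]
  exact mul_le_mul_of_nonneg_left (hS f M hM hf w x) (norm_nonneg _)

lemma OrderBound.mul {S T : SchwOp n} {r s : ℕ} {A B : ℝ} (hS : OrderBound S r A)
    (hT : OrderBound T s B) (hB : 0 ≤ B) : OrderBound (S * T) (r + s) (A * B) := by
  intro f M hM hf w x
  have h := hS (T f) _ (fun m => mul_nonneg hB (hM _)) (hT f M hM hf) w x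
  beta_reduce
  rw [mul_apply_eq_comp, mul_assoc, ← add_assoc]
  exact h

lemma exists_orderBound_sum {ι : Type*} (s : Finset ι) (S : ι → SchwOp n) {r : ℕ}
    (h : ∀ i ∈ s, ∃ A, 0 ≤ A ∧ OrderBound (S i) r A) :
    ∃ A, 0 ≤ A ∧ OrderBound (∑ i ∈ s, S i) r A := by
  classical
  induction s using Finset.induction_on with
  | empty => exact ⟨0, le_rfl, by simpa using orderBound_zero r⟩
  | insert i s hi ih =>
    obtain ⟨A, hA, hA'⟩ := h i (Finset.mem_insert_self i s)
    obtain ⟨B, hB, hB'⟩ := ih fun j hj => h j (Finset.mem_insert_of_mem hj)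
    rw [Finset.sum_insert hi]
    exact ⟨A + B, by positivity, hA'.add hB'⟩

lemma exists_orderBound_phaseLinear {d : ℕ} (a b c e : ℂ) (j : Fin d) :
    ∃ A, 0 ≤ A ∧ OrderBound (phaseLinear a b c e j) 1 A := by
  have h1 := ((orderBound_weylGen (Sum.inl (Fin.castAdd d j))).smul a).add
    ((orderBound_weylGen (Sum.inl (Fin.natAdd d j))).smul b)
  have h2 := (h1.add ((orderBound_weylGen (Sum.inr (Fin.castAdd d j))).smul c)).add
    ((orderBound_weylGen (Sum.inr (Fin.natAdd d j))).smul e)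
  exact ⟨_, by positivity, h2⟩

/-- The operator is quadratic in the generators, hence of order two. The constant is enlarged to be
at least one for use in `growthWeight`. -/
lemma exists_orderBound_rightNumber (d : ℕ) (t : ℝ) :
    ∃ A, 1 ≤ A ∧ OrderBound (rightNumber d t) 2 A := by
  obtain ⟨A, hA, h⟩ := exists_orderBound_sum Finset.univ (fun j : Fin d =>
    (phaseOscillator d t).create (Fin.natAdd d j) *
      (phaseOscillator d t).annih (Fin.natAdd d j)) (r := 2) fun j _ => by
    obtain ⟨A, hA, hA'⟩ := exists_orderBound_phaseLinear 1 0 0 (-((1 - t) * Complex.I)) j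
    obtain ⟨B, hB, hB'⟩ := exists_orderBound_phaseLinear 0 Complex.I (-t) 0 j
    rw [phaseOscillator_create_right, phaseOscillator_annih_right, sub_eq_add_neg (rightMul t j),
      ← neg_one_smul ℂ (rightDeriv t j)]
    have h1 := (OrderBound.add (S := rightMul t j) (T := rightDeriv t j) hA' hB').smul
      (Real.sqrt 2 : ℂ)⁻¹
    have h2 := (OrderBound.add (S := rightMul t j) hA'
      (OrderBound.smul (S := rightDeriv t j) hB' (-1))).smul (Real.sqrt 2 : ℂ)⁻¹
    exact ⟨_, by positivity, h1.mul h2 (by positivity)⟩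
  exact ⟨A + 1, by linarith, h.mono (by linarith)⟩

lemma OrderBound.pow {S : SchwOp n} {r : ℕ} {A : ℝ} (hA : 0 ≤ A) (hS : OrderBound S r A) (m : ℕ) :
    OrderBound (S ^ m) (r * m) (A ^ m) := by
  induction m with
  | zero =>
    intro f M _ hf w x
    simpa using hf w x
  | succ m ih =>
    rw [pow_succ', pow_succ', mul_add, mul_one, add_comm]
    exact hS.mul ih (by positivity)

end OrderBound

/-! ### The weight `P` and its lower bounds -/

section GrowthWeight

/-- The power series `∑ₙ λⁿ / ((2A)ⁿ R₂ₙ)`. -/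
def growthWeight (A : ℝ) (R : ℕ → ℝ) (l : ℕ) : ℝ :=
  ∑' m : ℕ, ((2 * A) ^ m)⁻¹ * (R (2 * m))⁻¹ * (l : ℝ) ^ m

variable {A : ℝ} {R : ℕ → ℝ} {δ : ℝ}

/-- Because `(m!)² ≤ (2m)!`; hence the series of the weight is dominated by an exponential series.
-/
lemma factorial_le_of_sqrt_factorial_le (hδ : ∀ m : ℕ, δ * Real.sqrt (m.factorial) ≤ R m)
    (hδ0 : 0 < δ) (m : ℕ) : δ * m.factorial ≤ R (2 * m) := by
  refine le_trans ?_ (hδ (2 * m))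
  gcongr
  refine Real.le_sqrt_of_sq_le ?_
  have h : m.factorial * m.factorial ∣ (m + m).factorial :=
    Nat.factorial_mul_factorial_dvd_factorial_add m m
  rw [two_mul, sq]
  exact_mod_cast Nat.le_of_dvd (Nat.factorial_pos _) h

lemma summable_growthWeight (hA : 1 ≤ A) (hδ0 : 0 < δ)
    (hδ : ∀ m : ℕ, δ * Real.sqrt (m.factorial) ≤ R m) (hR : ∀ m, 0 < R m) (l : ℕ) :
    Summable fun m : ℕ => ((2 * A) ^ m)⁻¹ * (R (2 * m))⁻¹ * (l : ℝ) ^ m := by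
  refine Summable.of_nonneg_of_le (fun m => ?_) (fun m => ?_)
    ((Real.summable_pow_div_factorial (l : ℝ)).mul_left δ⁻¹)
  · have := hR (2 * m)
    positivity
  · have h1 : ((2 * A) ^ m)⁻¹ ≤ 1 := inv_le_one_of_one_le₀ (one_le_pow₀ (by linarith))
    have h2 : (R (2 * m))⁻¹ ≤ (δ * m.factorial)⁻¹ :=
      inv_anti₀ (by positivity) (factorial_le_of_sqrt_factorial_le hδ hδ0 m)
    have h3 : 0 ≤ (R (2 * m))⁻¹ := (inv_pos.2 (hR _)).le
    calc _ ≤ 1 * (δ * m.factorial)⁻¹ * (l : ℝ) ^ m := by gcongr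
      _ = _ := by rw [mul_inv]; ring

lemma le_growthWeight (hA : 1 ≤ A) (hδ0 : 0 < δ)
    (hδ : ∀ m : ℕ, δ * Real.sqrt (m.factorial) ≤ R m) (hR : ∀ m, 0 < R m) (l m : ℕ) :
    ((2 * A) ^ m)⁻¹ * (R (2 * m))⁻¹ * (l : ℝ) ^ m ≤ growthWeight A R l :=
  (summable_growthWeight hA hδ0 hδ hR l).le_tsum m fun j _ => by
    have := hR (2 * j)
    positivity

lemma growthWeight_pos (hA : 1 ≤ A) (hδ0 : 0 < δ)
    (hδ : ∀ m : ℕ, δ * Real.sqrt (m.factorial) ≤ R m) (hR : ∀ m, 0 < R m) (l : ℕ) :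
    0 < growthWeight A R l := by
  refine lt_of_lt_of_le ?_ (le_growthWeight hA hδ0 hδ hR l 0)
  have := hR 0
  simpa using this

/-- A series with nonnegative terms dominates each single term. With `m = 0` it bounds the inverse
weight by `R 0`. -/
lemma inv_growthWeight_mul_pow_le (hA : 1 ≤ A) (hδ0 : 0 < δ)
    (hδ : ∀ m : ℕ, δ * Real.sqrt (m.factorial) ≤ R m) (hR : ∀ m, 0 < R m) (l m : ℕ) :
    (growthWeight A R l)⁻¹ * (l : ℝ) ^ m ≤ (2 * A) ^ m * R (2 * m) := by
  have h1 := growthWeight_pos hA hδ0 hδ hR l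
  have h2 := le_growthWeight hA hδ0 hδ hR l m
  have h3 := hR (2 * m)
  rw [inv_mul_le_iff₀ h1]
  rw [← mul_inv, inv_mul_le_iff₀ (by positivity)] at h2
  linarith

/-- Here `l = |k|` and `2 l` is the length of the diagonal index `(k, k)`; the power `r` buys
summability over `k`. The square root and this power combine to at most `Y^p`, which splits into a
power of `l`, absorbed by the weight, and a power of `p`, absorbed by `p! ≤ δ⁻¹ R (2 p)`. -/
lemma inv_growthWeight_mul_sqrt_le (hA : 1 ≤ A) (hδ0 : 0 < δ)
    (hδ : ∀ m : ℕ, δ * Real.sqrt (m.factorial) ≤ R m) (hR : ∀ m, 0 < R m) (l q r p : ℕ)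
    (hp1 : q + 2 * r ≤ 2 * p) :
    (growthWeight A R l)⁻¹ * (Real.sqrt ((2 * l + q : ℝ) ^ q) * ((1 + l : ℕ) : ℝ) ^ r) ≤
      (1 + R 0 * Real.exp 1 * δ⁻¹) * (8 * A + 2 * Real.exp 2) ^ p * R (2 * p) := by
  have h1 := growthWeight_pos hA hδ0 hδ hR l
  set Y : ℝ := 2 * l + (2 * p + 1) with hY
  have hqp : (q : ℝ) + 2 * r ≤ 2 * p := by exact_mod_cast hp1
  have hl0 : (0 : ℝ) ≤ l := by positivity
  have hr0 : (0 : ℝ) ≤ r := by positivity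
  have hq0 : (0 : ℝ) ≤ q := by positivity
  have hY1 : 1 ≤ Y := by rw [hY]; linarith
  have h2 : Real.sqrt ((2 * l + q : ℝ) ^ q) * ((1 + l : ℕ) : ℝ) ^ r ≤ Y ^ p := by
    have e1 : ((1 + l : ℕ) : ℝ) ^ r ≤ Real.sqrt (Y ^ (2 * r)) := by
      rw [mul_comm 2 r, pow_mul, Real.sqrt_sq (by positivity)]
      gcongr
      rw [hY]; push_cast; linarith
    have e2 : Real.sqrt ((2 * l + q : ℝ) ^ q) ≤ Real.sqrt (Y ^ q) := by
      refine Real.sqrt_le_sqrt ?_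
      gcongr
      rw [hY]; linarith
    calc _ ≤ Real.sqrt (Y ^ q) * Real.sqrt (Y ^ (2 * r)) := by gcongr
      _ = Real.sqrt (Y ^ (q + 2 * r)) := by rw [← Real.sqrt_mul (by positivity), ← pow_add]
      _ ≤ Real.sqrt (Y ^ (2 * p)) := Real.sqrt_le_sqrt (pow_le_pow_right₀ hY1 hp1)
      _ = Y ^ p := by rw [mul_comm 2 p, pow_mul, Real.sqrt_sq (by positivity)]
  have h3 : Y ^ p ≤ 2 ^ p * ((2 * l : ℝ) ^ p + (2 * p + 1 : ℝ) ^ p) := by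
    refine (add_pow_le (by positivity) (by positivity) p).trans ?_
    gcongr
    · norm_num
    · omega
  -- From `y^p ≤ p! exp y` at `y = 2 p + 1`.
  have h4 : (2 * p + 1 : ℝ) ^ p ≤ Real.exp 1 * Real.exp 2 ^ p * δ⁻¹ * R (2 * p) := by
    have e1 := Real.pow_div_factorial_le_exp (x := (2 * p + 1 : ℝ)) (by positivity) p
    have e2 := factorial_le_of_sqrt_factorial_le hδ hδ0 p
    rw [div_le_iff₀ (by positivity)] at e1
    have e3 : Real.exp (2 * p + 1) = Real.exp 1 * Real.exp 2 ^ p := by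
      rw [← Real.exp_nat_mul, ← Real.exp_add]
      congr 1
      ring
    rw [e3] at e1
    refine e1.trans ?_
    rw [mul_assoc _ δ⁻¹]
    gcongr
    rw [← div_eq_inv_mul, le_div_iff₀ hδ0, mul_comm]
    exact e2
  have h5 : (growthWeight A R l)⁻¹ ≤ R 0 := by
    simpa using inv_growthWeight_mul_pow_le hA hδ0 hδ hR l 0
  have h6 := inv_growthWeight_mul_pow_le hA hδ0 hδ hR l p
  have hRp := hR (2 * p)
  have hR0 := hR 0
  have he2 := Real.exp_pos 2
  calc _ ≤ (growthWeight A R l)⁻¹ * (2 ^ p * ((2 * l : ℝ) ^ p + (2 * p + 1 : ℝ) ^ p)) := by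
        exact mul_le_mul_of_nonneg_left (h2.trans h3) (inv_pos.2 h1).le
    _ = 4 ^ p * ((growthWeight A R l)⁻¹ * (l : ℝ) ^ p) +
        2 ^ p * ((growthWeight A R l)⁻¹ * (2 * p + 1 : ℝ) ^ p) := by
        rw [mul_pow 2 (l : ℝ), show (4 : ℝ) = 2 * 2 by norm_num, mul_pow 2 2]
        ring
    _ ≤ 4 ^ p * ((2 * A) ^ p * R (2 * p)) +
        2 ^ p * (R 0 * (Real.exp 1 * Real.exp 2 ^ p * δ⁻¹ * R (2 * p))) := by
        gcongr
    _ = ((8 * A) ^ p + R 0 * Real.exp 1 * δ⁻¹ * (2 * Real.exp 2) ^ p) * R (2 * p) := by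
        rw [show (8 : ℝ) * A = 4 * (2 * A) by ring, mul_pow 4, mul_pow 2 (Real.exp 2)]
        ring
    _ ≤ ((8 * A + 2 * Real.exp 2) ^ p + R 0 * Real.exp 1 * δ⁻¹ *
          (8 * A + 2 * Real.exp 2) ^ p) * R (2 * p) := by
        gcongr <;> linarith
    _ = _ := by ring

end GrowthWeight

lemma SchwartzMap.hasSum_apply {ι : Type*} {n : ℕ} {u : ι → Schw n} {U : Schw n} (h : HasSum u U)
    (x : EuclideanSpace ℝ (Fin n)) : HasSum (fun i => u i x) (U x) :=
  (BoundedContinuousFunction.evalCLM ℂ x).hasSum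
    ((SchwartzMap.toBoundedContinuousFunctionCLM ℂ (EuclideanSpace ℝ (Fin n)) ℂ).hasSum h)

lemma WordBound.mono {n : ℕ} {f : Schw n} {M M' : ℕ → ℝ} (h : WordBound f M)
    (hM : ∀ m, M m ≤ M' m) : WordBound f M' := fun w x => (h w x).trans (hM _)

/-! ### Construction of the two factors -/

section Factorization

variable {d : ℕ}

/-- The normalised symbol of the projection onto the state with index `k`. -/
def diagonalState (t : ℝ) (k : Fin d → ℕ) : Schw (d + d) :=
  (phaseOscillator d t).state (Fin.append k k)

lemma multiLength_append (k : Fin d → ℕ) : multiLength (Fin.append k k) = 2 * multiLength k := by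
  simp only [multiLength, Fin.sum_univ_add, Fin.append_left, Fin.append_right, two_mul]

lemma pseudoOp_diagonalState (t : ℝ) (k : Fin d → ℕ) (f : Schw d)
    (x : EuclideanSpace ℝ (Fin d)) : pseudoOp t (diagonalState t k) f x =
      rankOneConst d t * (stdOscillator d).coeff f k * (stdOscillator d).state k x := by
  rw [diagonalState, pseudoOp_phaseState]
  simp only [Fin.append_left, Fin.append_right]

/-- The squared norm of the Gaussian. -/
def gaussianMass (d : ℕ) : ℂ := ((‖toL2 (stdOscillator d).vacuum‖ ^ 2 : ℝ) : ℂ)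

lemma stdOscillator_vacuum_ne_zero (d : ℕ) : (stdOscillator d).vacuum ≠ 0 := by
  intro h
  have h1 := congrArg (fun f : Schw d => f 0) h
  change stdGaussian d 0 = 0 at h1
  rw [stdGaussian_apply] at h1
  exact (Real.exp_pos _).ne' (by exact_mod_cast h1)

/-- Symbols with suitable bounds on all words factor through a negative power series in the
number operator. -/
lemma exists_factorization (t : ℝ) (a : Schw (d + d)) {M R : ℕ → ℝ} {δ : ℝ}
    (hM0 : ∀ m, 0 ≤ M m) (hM : WordBound a M) (hR : ∀ m, 0 < R m)
    (hMR : ∀ m k, M (m + k) ≤ R m * R k) (hδ0 : 0 < δ)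
    (hδ : ∀ m : ℕ, δ * Real.sqrt (m.factorial) ≤ R m) :
    ∃ (a₁ a₂ : Schw (d + d)) (C B : ℝ) (c : ℕ), 0 ≤ C ∧ 1 ≤ B ∧
      WordBound a₁ (fun m => 2 * R m) ∧
      WordBound a₂ (fun m => C * B ^ m * (R (m + c) + R (m + c + 1))) ∧
      ∀ f : Schw d, ∃ g : Schw d, pseudoOp t a₂ f = g ∧ pseudoOp t a f = pseudoOp t a₁ g := by
  obtain ⟨A, hA, hN⟩ := exists_orderBound_rightNumber d t
  have hA0 : 0 < A := by linarith
  -- The `m`-th power of `rightNumber` costs `A^m` and shifts `M` by `2 m`, hence a further factor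
  -- `R (2 m)`. These coefficients cancel both and leave `2^(-m)`.
  set c : ℕ → ℝ := fun m => ((2 * A) ^ m)⁻¹ * (R (2 * m))⁻¹ with hc
  have hc0 : ∀ m, 0 ≤ c m := fun m => by
    have := hR (2 * m)
    simp only [hc]
    positivity
  obtain ⟨a₁, ha₁, hb₁⟩ := exists_hasSum_of_wordBound
    (fun m : ℕ => (c m : ℂ) • (rightNumber d t ^ m) a) (fun m k => (1 / 2 : ℝ) ^ m * R k)
    (fun m w x => by
      have h1 := (hN.pow hA0.le m) a M hM0 hM w x
      have h2 := hR (2 * m)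
      rw [map_smul, smul_apply, norm_smul, Complex.norm_real, Real.norm_of_nonneg (hc0 m)]
      calc _ ≤ c m * (A ^ m * (R w.length * R (2 * m))) := by
            refine mul_le_mul_of_nonneg_left (h1.trans ?_) (hc0 m)
            exact mul_le_mul_of_nonneg_left (hMR _ _) (by positivity)
        _ = _ := by
            simp only [hc, mul_pow, one_div, inv_pow]
            field_simp)
    (fun m k => by have := hR k; positivity)
    (fun k => summable_geometric_two.mul_right _)
  set O := stdOscillator d with hO
  set P : (Fin d → ℕ) → ℝ := fun k => growthWeight A R (multiLength k) with hP
  have hP0 : ∀ k, 0 < P k := fun k => growthWeight_pos hA hδ0 hδ hR _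
  -- With this factor a diagonal state becomes the symbol of the orthogonal projection onto the
  -- corresponding Hermite function.
  set γ : ℂ := (rankOneConst d t)⁻¹ * (gaussianMass d)⁻¹ with hγ
  obtain ⟨C, K, hC, hK⟩ := (phaseOscillator d t).exists_wordBound_state
  set τ := (phaseOscillator d t).coeffBound with hτ
  have hτ1 : 1 ≤ τ := (phaseOscillator d t).one_le_coeffBound
  set D : ℝ := 1 + R 0 * Real.exp 1 * δ⁻¹ with hD
  set B : ℝ := 8 * A + 2 * Real.exp 2 with hB
  have hB1 : 1 ≤ B := by have := Real.exp_pos 2; rw [hB]; linarith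
  have hD0 : 0 ≤ D := by have := hR 0; positivity
  -- `K` is the Sobolev loss. The term `4 d` pays for the weight `(1 + |k|)^(2 d)`, since a full
  -- power of `|k|` counts as two letters.
  set e : ℕ := K + 4 * d with he
  set G : ℕ → ℝ := fun m => ‖γ‖ * (C * τ ^ m * (D * B ^ (m + e + 1) *
    (R (m + e) + R (m + e + 1)))) with hG
  have hG0 : ∀ m, 0 ≤ G m := fun m => by
    have := hR (m + e)
    have := hR (m + e + 1)
    positivity
  have hbound : ∀ k : Fin d → ℕ, WordBound (((P k : ℂ)⁻¹ * γ) • diagonalState t k)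
      fun m => G m * (((1 + multiLength k : ℕ) : ℝ) ^ (2 * d))⁻¹ := by
    intro k w x
    beta_reduce
    set m := w.length with hm
    have h1 := hK (Fin.append k k) w x
    rw [map_smul, smul_apply, norm_smul, norm_mul, norm_inv, Complex.norm_real,
      Real.norm_of_nonneg (hP0 k).le, ← div_eq_mul_inv, le_div_iff₀ (by positivity)]
    have h2 := inv_growthWeight_mul_sqrt_le hA hδ0 hδ hR (multiLength k) (m + K) (2 * d)
      ((m + e + 1) / 2) (by omega)
    -- The weight only involves `R` at even indices. Since `R` need not be monotone, rounding up is
    -- paid for by adding both candidate values.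
    have h3 : R (2 * ((m + e + 1) / 2)) ≤ R (m + e) + R (m + e + 1) := by
      rcases Nat.even_or_odd (m + e) with ⟨p, hp⟩ | ⟨p, hp⟩
      · rw [show 2 * ((m + e + 1) / 2) = m + e by omega]
        linarith [hR (m + e + 1)]
      · rw [show 2 * ((m + e + 1) / 2) = m + e + 1 by omega]
        linarith [hR (m + e)]
    have h4 : B ^ ((m + e + 1) / 2) ≤ B ^ (m + e + 1) := pow_le_pow_right₀ hB1 (by omega)
    have hPk := hP0 k
    have hR2 := hR (2 * ((m + e + 1) / 2))
    rw [multiLength_append] at h1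
    calc _ ≤ (P k)⁻¹ * ‖γ‖ * (C * τ ^ m * Real.sqrt (((2 * multiLength k : ℕ) + (m : ℕ) + K : ℝ) ^
          (m + K))) * ((1 + multiLength k : ℕ) : ℝ) ^ (2 * d) := by
          gcongr
          exact h1
      _ = ‖γ‖ * (C * τ ^ m * ((P k)⁻¹ * (Real.sqrt ((2 * multiLength k + (m + K : ℕ) : ℝ) ^
          (m + K)) * ((1 + multiLength k : ℕ) : ℝ) ^ (2 * d)))) := by
          push_cast
          rw [← add_assoc]
          ring
      _ ≤ ‖γ‖ * (C * τ ^ m * (D * B ^ ((m + e + 1) / 2) * R (2 * ((m + e + 1) / 2)))) := by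
          gcongr
      _ ≤ G m := by
          simp only [hG]
          gcongr
  obtain ⟨a₂, ha₂, hb₂⟩ := exists_hasSum_of_wordBound
    (fun k : Fin d → ℕ => ((P k : ℂ)⁻¹ * γ) • diagonalState t k) _ hbound
    (fun k m => mul_nonneg (hG0 m) (by positivity))
    (fun m => (summable_one_add_multiLength d).mul_left _)
  set S : ℝ := ∑' k : Fin d → ℕ, (((1 + multiLength k : ℕ) : ℝ) ^ (2 * d))⁻¹ with hS
  have hS0 : 0 ≤ S := tsum_nonneg fun k => by positivity
  refine ⟨a₁, a₂, ‖γ‖ * C * D * B ^ (e + 1) * S, τ * B, e, by positivity,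
    one_le_mul_of_one_le_of_one_le hτ1 hB1, hb₁.mono fun m => ?_, hb₂.mono fun m => ?_,
    fun f => ?_⟩
  · rw [tsum_mul_right, tsum_geometric_two]
  · rw [tsum_mul_left, ← hS]
    simp only [hG]
    refine le_of_eq ?_
    rw [add_assoc m e 1, pow_add B m (e + 1), mul_pow τ B]
    ring
  · have hexp := O.hasSum_coeff (stdOscillator_vacuum_ne_zero d) stdOscillator_complete f
    have hPinv : ∀ k, (P k)⁻¹ ≤ R 0 := fun k => by
      simpa using inv_growthWeight_mul_pow_le hA hδ0 hδ hR (multiLength k) 0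
    -- The function `g` is `P(N)⁻¹ f`, defined through its Hermite expansion.
    obtain ⟨g, hg⟩ := O.exists_hasSum_smul_state
      (fun k => (P k : ℂ)⁻¹ * ((gaussianMass d)⁻¹ * O.coeff f k)) fun r => by
        obtain ⟨E, hE, h⟩ := O.exists_coeff_le f r
        have hR0 := hR 0
        refine ⟨R 0 * ‖(gaussianMass d)⁻¹‖ * E, by positivity, fun k => ?_⟩
        have hPk := hP0 k
        rw [norm_mul, norm_mul, norm_inv (P k : ℂ), Complex.norm_real,
          Real.norm_of_nonneg hPk.le, mul_assoc _ E, mul_assoc (R 0)]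
        gcongr
        · exact hPinv k
        · exact h k
    refine ⟨g, ?_, ?_⟩
    · ext x
      have h1 := (opSymbolCLM t f x).hasSum ha₂
      refine h1.unique ?_
      convert! SchwartzMap.hasSum_apply hg x using 2 with k
      simp only [map_smul, opSymbolCLM_apply, pseudoOp_diagonalState,
        smul_apply, smul_eq_mul, hγ, hO]
      have := rankOneConst_ne_zero d t
      field_simp
    · ext x
      have h1 := (opFunctionCLM t a x).hasSum hexp
      refine h1.unique ?_
      have h2 := (opFunctionCLM t a₁ x).hasSum hg
      convert! h2 using 2 with k
      -- On the state with index `k` the series defining `a₁` sums to the scalar `P k`, which then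
      -- cancels the coefficient of `g` term by term.
      have h3 : pseudoOp t a₁ (O.state k) x = (P k : ℂ) * pseudoOp t a (O.state k) x := by
        have h4 := (opSymbolCLM t (O.state k) x).hasSum ha₁
        have h5 : HasSum (fun m => (c m : ℂ) * (multiLength k : ℂ) ^ m) (P k : ℂ) := by
          have := (Complex.ofRealCLM.hasSum
            (summable_growthWeight hA hδ0 hδ hR (multiLength k)).hasSum)
          convert! this using 2 with m
          simp [hc]
        refine h4.unique ?_
        convert! h5.mul_right (pseudoOp t a (O.state k) x) using 2 with m
        simp only [map_smul, opSymbolCLM_apply, smul_eq_mul, hO,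
          pseudoOp_rightNumber_pow_state]
        ring
      have hPk : (P k : ℂ) ≠ 0 := by exact_mod_cast (hP0 k).ne'
      simp only [map_smul, opFunctionCLM_apply, smul_eq_mul, h3, gaussianMass,
        ← hO]
      field_simp

end Factorization

/-! ### Reordering partial derivatives of smooth functions -/

section SmoothFunctions

/-- The space of smooth functions on `ℝⁿ`. -/
def smoothSubmodule (n : ℕ) : Submodule ℂ (EuclideanSpace ℝ (Fin n) → ℂ) where
  carrier := {f | ContDiff ℝ ∞ f}
  add_mem' := fun {f g} (hf : ContDiff ℝ ∞ f) (hg : ContDiff ℝ ∞ g) => hf.add hg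
  zero_mem' := (contDiff_const : ContDiff ℝ ∞ fun _ : EuclideanSpace ℝ (Fin n) => (0 : ℂ))
  smul_mem' := fun c f (hf : ContDiff ℝ ∞ f) => hf.const_smul c

/-- The partial derivative as an endomorphism of the space of smooth functions. -/
def smoothDeriv {n : ℕ} (i : Fin n) : Module.End ℂ (smoothSubmodule n) where
  toFun := fun f => ⟨partialDeriv i f, contDiff_partialDeriv f.2 i⟩
  map_add' := fun f g => by
    ext x
    have hf' : ContDiff ℝ ∞ f.1 := f.2
    have hf := hf'.differentiable (by simp) x
    have hg' : ContDiff ℝ ∞ g.1 := g.2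
    have hg := hg'.differentiable (by simp) x
    change fderiv ℝ (f.1 + g.1) x _ = fderiv ℝ f.1 x _ + fderiv ℝ g.1 x _
    rw [fderiv_add hf hg, add_apply]
  map_smul' := fun c f => by
    ext x
    have hf' : ContDiff ℝ ∞ f.1 := f.2
    have hf := hf'.differentiable (by simp) x
    change fderiv ℝ (c • f.1) x _ = c • fderiv ℝ f.1 x _
    rw [fderiv_const_smul hf, smul_apply]

lemma smoothDeriv_comm {n : ℕ} (i j : Fin n) :
    Commute (smoothDeriv i : Module.End ℂ (smoothSubmodule n)) (smoothDeriv j) := by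
  ext f x
  have hf : ContDiff ℝ ∞ f.1 := f.2
  have key : ∀ i j : Fin n, partialDeriv i (partialDeriv j f.1) x =
      fderiv ℝ (fderiv ℝ f.1) x (EuclideanSpace.single i 1) (EuclideanSpace.single j 1) := by
    intro i j
    have hd : DifferentiableAt ℝ (fderiv ℝ f.1) x :=
      ((hf.fderiv_right (m := ∞) (by simp)).differentiable (by simp)) x
    have h := fderiv_clm_apply hd (differentiableAt_const (EuclideanSpace.single j (1 : ℝ)))
    change fderiv ℝ (fun y => fderiv ℝ f.1 y (EuclideanSpace.single j 1)) x _ = _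
    rw [h]
    simp
  have hs : IsSymmSndFDerivAt ℝ f.1 x :=
    (hf.of_le (m := ((2 : ℕ∞) : WithTop ℕ∞)) (mod_cast le_top)).contDiffAt.isSymmSndFDerivAt
      (by simp)
  change partialDeriv i (partialDeriv j f.1) x = partialDeriv j (partialDeriv i f.1) x
  rw [key, key, hs.eq]

/-- The map `φ` is kept general so that the statement covers both smooth functions and Schwartz
functions. -/
lemma multiDeriv_eq_orderedPow {n : ℕ} {R E : Type*} [Ring R] [MulAction R E]
    (φ : E → EuclideanSpace ℝ (Fin n) → ℂ) (c : Fin n → R)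
    (h : ∀ i u, φ (c i • u) = partialDeriv i (φ u)) (α : Fin n → ℕ) (u : E) :
    multiDeriv α (φ u) = φ (orderedPow c α • u) := by
  have hpow : ∀ i m u, φ (c i ^ m • u) = (partialDeriv i)^[m] (φ u) := by
    intro i m
    induction m with
    | zero => simp
    | succ m ih =>
      intro u
      rw [pow_succ', mul_smul, h, ih, Function.iterate_succ_apply']
  have hl : ∀ l : List (Fin n), l.foldr (fun i g => (partialDeriv i)^[α i] g) (φ u) =
      φ ((l.map fun i => c i ^ α i).prod • u) := by
    intro l
    induction l with
    | nil => simp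
    | cons i l ih => rw [List.foldr_cons, ih, List.map_cons, List.prod_cons, mul_smul, hpow]
  exact hl _

lemma exists_multiDeriv_eq_foldr {n : ℕ} {f : EuclideanSpace ℝ (Fin n) → ℂ}
    (hf : ContDiff ℝ ∞ f) (l : List (Fin n)) :
    ∃ α : Fin n → ℕ, multiLength α = l.length ∧ l.foldr partialDeriv f = multiDeriv α f := by
  have hφ := multiDeriv_eq_orderedPow
    (fun u : smoothSubmodule n => (u : EuclideanSpace ℝ (Fin n) → ℂ)) smoothDeriv (fun _ _ => rfl)
  induction l with
  | nil =>
    refine ⟨0, by simp [multiLength], ?_⟩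
    have := hφ 0 ⟨f, hf⟩
    rw [orderedPow_zero, one_smul] at this
    exact this.symm
  | cons i l ih =>
    obtain ⟨α, hα, h⟩ := ih
    refine ⟨α + Pi.single i 1, by rw [Oscillator.multiLength_add_single, hα, List.length_cons], ?_⟩
    have h1 := hφ α ⟨f, hf⟩
    have h2 := hφ (α + Pi.single i 1) ⟨f, hf⟩
    rw [← mul_orderedPow smoothDeriv_comm, mul_smul] at h2
    rw [List.foldr_cons, h]
    exact (congrArg (partialDeriv i) h1).trans h2.symm

end SmoothFunctions

/-! ### Factorials of multi-indices -/

section Factorials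

lemma add_factorial_le (m k : ℕ) :
    (m + k).factorial ≤ 2 ^ (m + k) * (m.factorial * k.factorial) := by
  have h1 := Nat.add_choose_mul_factorial_mul_factorial m k
  rw [← h1, mul_assoc]
  exact Nat.mul_le_mul_right _ (Nat.choose_le_two_pow _ _)

lemma sum_factorial_le {ι : Type*} (s : Finset ι) (α : ι → ℕ) :
    (∑ i ∈ s, α i).factorial ≤ (2 ^ s.card) ^ (∑ i ∈ s, α i) * ∏ i ∈ s, (α i).factorial := by
  classical
  induction s using Finset.induction_on with
  | empty => simp
  | insert i s hi ih =>
    rw [Finset.sum_insert hi, Finset.prod_insert hi, Finset.card_insert_of_notMem hi]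
    set S := ∑ i ∈ s, α i
    calc (α i + S).factorial ≤ 2 ^ (α i + S) * ((α i).factorial * S.factorial) :=
          add_factorial_le _ _
      _ ≤ 2 ^ (α i + S) * ((α i).factorial * ((2 ^ s.card) ^ (α i + S) *
          ∏ i ∈ s, (α i).factorial)) := by
          gcongr
          refine ih.trans ?_
          gcongr
          · exact Nat.one_le_two_pow
          · omega
      _ = _ := by rw [pow_succ 2 s.card, mul_pow]; ring

/-- Each merging of two factorials costs a binomial coefficient, at most a power of two: `n` crude
factors per multi-index and one more for joining the two. -/
lemma factorial_multiLength_le {n : ℕ} (α β : Fin n → ℕ) :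
    (multiLength α + multiLength β).factorial ≤
      (2 ^ (n + 1)) ^ (multiLength α + multiLength β) * (multiFactorial α * multiFactorial β) := by
  have h1 := sum_factorial_le Finset.univ α
  have h2 := sum_factorial_le Finset.univ β
  rw [Finset.card_univ, Fintype.card_fin] at h1 h2
  refine (add_factorial_le _ _).trans ?_
  calc _ ≤ 2 ^ (multiLength α + multiLength β) * (((2 ^ n) ^ multiLength α * multiFactorial α) *
        ((2 ^ n) ^ multiLength β * multiFactorial β)) := by
        gcongr
        · exact h1
        · exact h2
    _ = _ := by rw [pow_succ 2 n, mul_pow, pow_add (2 ^ n)]; ring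

lemma multiFactorial_mul_le {n : ℕ} (α β : Fin n → ℕ) :
    multiFactorial α * multiFactorial β ≤ (multiLength α + multiLength β).factorial := by
  have h1 := Nat.le_of_dvd (Nat.factorial_pos _)
    (Nat.prod_factorial_dvd_factorial_sum Finset.univ α)
  have h2 := Nat.le_of_dvd (Nat.factorial_pos _)
    (Nat.prod_factorial_dvd_factorial_sum Finset.univ β)
  exact (Nat.mul_le_mul h1 h2).trans
    (Nat.le_of_dvd (Nat.factorial_pos _) (Nat.factorial_mul_factorial_dvd_factorial_add _ _))

lemma add_factorial_rpow_le {s : ℝ} (hs : 0 ≤ s) (m k : ℕ) :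
    ((m + k).factorial : ℝ) ^ s ≤
      ((2 : ℝ) ^ s) ^ (m + k) * ((m.factorial : ℝ) ^ s * (k.factorial : ℝ) ^ s) := by
  have h : ((m + k).factorial : ℝ) ≤ 2 ^ (m + k) * (m.factorial * k.factorial) := by
    exact_mod_cast add_factorial_le m k
  refine (Real.rpow_le_rpow (by positivity) h hs).trans (le_of_eq ?_)
  rw [Real.mul_rpow (by positivity) (by positivity), Real.mul_rpow (by positivity) (by positivity),
    Real.rpow_pow_comm (by norm_num)]

end Factorials

/-! ### From ordered bounds to bounds on all words -/

section StepToSchwartz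

variable {n : ℕ}

lemma multiLength_single (i : Fin n) (k : ℕ) : multiLength (Pi.single i k) = k := by
  simp [multiLength]

lemma multiPow_single (x : EuclideanSpace ℝ (Fin n)) (i : Fin n) (k : ℕ) :
    multiPow x (Pi.single i k) = x i ^ k := by
  rw [multiPow, Finset.prod_eq_single i]
  · simp
  · intro j _ hj
    simp [hj]
  · simp

lemma multiPow_zero (x : EuclideanSpace ℝ (Fin n)) : multiPow x 0 = 1 := by simp [multiPow]

/-- Smooth functions with all `x^β ∂^α f` bounded are Schwartz functions. -/
lemma exists_schwartz_of_bounded {f : EuclideanSpace ℝ (Fin n) → ℂ} (hf : ContDiff ℝ ∞ f)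
    {G : ℕ → ℝ} (h : ∀ (α β : Fin n → ℕ) (x : EuclideanSpace ℝ (Fin n)),
      ‖(multiPow x β : ℂ) * multiDeriv α f x‖ ≤ G (multiLength α + multiLength β)) :
    ∃ F : Schw n, (F : EuclideanSpace ℝ (Fin n) → ℂ) = f := by
  refine ⟨⟨f, hf, fun k m => ?_⟩, rfl⟩
  set B : ℝ := max 0 (max (G m) (G (m + k))) with hB
  refine ⟨(n : ℝ) ^ m * (((n : ℝ) ^ k + 1) * B), fun x => ?_⟩
  have hl : ∀ l : List (Fin n), l.length = m →
      ‖x‖ ^ k * ‖l.foldr partialDeriv f x‖ ≤ ((n : ℝ) ^ k + 1) * B := by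
    intro l hl
    obtain ⟨α, hα, e⟩ := exists_multiDeriv_eq_foldr hf l
    rw [e]
    refine norm_pow_mul_le_of_coord x k (norm_nonneg _) ?_ fun i => ?_
    · have := h α 0 x
      rw [multiPow_zero, Complex.ofReal_one, one_mul, hα, hl] at this
      refine this.trans ?_
      rw [hB]
      simp [multiLength]
    · have := h α (Pi.single i k) x
      rw [multiPow_single, norm_mul, Complex.norm_real, norm_pow, Real.norm_eq_abs, hα, hl,
        multiLength_single] at this
      exact this.trans ((le_max_right _ _).trans (le_max_right _ _))
  rcases (pow_nonneg (norm_nonneg x) k).eq_or_lt with h0 | h0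
  · have hB0 : 0 ≤ B := le_max_left _ _
    rw [← h0, zero_mul]
    positivity
  · have h1 := norm_iteratedFDeriv_le_of_partialDeriv m (((n : ℝ) ^ k + 1) * B / ‖x‖ ^ k) x hf
      fun l hl' => by
        rw [le_div_iff₀ h0, mul_comm]
        exact hl l hl'
    rw [← mul_div_assoc, le_div_iff₀ h0, mul_comm] at h1
    exact h1

lemma exists_bound_of_step {s h : ℝ} (hs : 0 ≤ s) (hh : 0 < h)
    {f : EuclideanSpace ℝ (Fin n) → ℂ} (hf : f ∈ gelfandShilovStep n s h) :
    ∃ C, 0 ≤ C ∧ ∀ (α β : Fin n → ℕ) (x : EuclideanSpace ℝ (Fin n)),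
      ‖(multiPow x β : ℂ) * multiDeriv α f x‖ ≤ C * (h ^ (multiLength α + multiLength β) *
        ((multiLength α + multiLength β).factorial : ℝ) ^ s) := by
  obtain ⟨-, C, hC⟩ := hf
  refine ⟨max C 0, le_max_right _ _, fun α β x => ?_⟩
  have hα : (0 : ℝ) < multiFactorial α := Oscillator.fact_pos α
  have hβ : (0 : ℝ) < multiFactorial β := Oscillator.fact_pos β
  have h1 := hC α β x
  rw [div_le_iff₀ (by positivity)] at h1
  have h2 : (multiFactorial α : ℝ) * multiFactorial β ≤
      ((multiLength α + multiLength β).factorial : ℝ) := by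
    exact_mod_cast multiFactorial_mul_le α β
  have h3 := Real.rpow_le_rpow (by positivity) h2 hs
  refine h1.trans (mul_le_mul (le_max_left _ _) ?_ (by positivity) (le_max_right _ _))
  gcongr

lemma exists_schwartz_of_step {s h : ℝ} (hs : 0 ≤ s) (hh : 0 < h)
    {f : EuclideanSpace ℝ (Fin n) → ℂ} (hf : f ∈ gelfandShilovStep n s h) :
    ∃ F : Schw n, (F : EuclideanSpace ℝ (Fin n) → ℂ) = f := by
  obtain ⟨C, -, hC⟩ := exists_bound_of_step hs hh hf
  exact exists_schwartz_of_bounded hf.1 (G := fun m => C * (h ^ m * (m.factorial : ℝ) ^ s)) hC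

lemma orderedPow_coordMul_apply (β : Fin n → ℕ) (f : Schw n) (x : EuclideanSpace ℝ (Fin n)) :
    orderedPow coordMul β f x = (multiPow x β : ℂ) * f x := by
  have hpow : ∀ (i : Fin n) (m : ℕ) (f : Schw n), ((coordMul i : SchwOp n) ^ m) f x =
      (x i : ℂ) ^ m * f x := by
    intro i m
    induction m with
    | zero => simp
    | succ m ih =>
      intro f
      rw [pow_succ, mul_apply_eq_comp, ih, coordMul_apply, pow_succ, mul_assoc]
  have hl : ∀ l : List (Fin n), (l.map fun i => (coordMul i : SchwOp n) ^ β i).prod f x =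
      (l.map fun i => (x i : ℂ) ^ β i).prod * f x := by
    intro l
    induction l with
    | nil => simp
    | cons i l ih =>
      rw [List.map_cons, List.prod_cons, mul_apply_eq_comp, hpow, ih, List.map_cons,
        List.prod_cons, mul_assoc]
  rw [orderedPow, hl, ← Fin.prod_univ_def, multiPow]
  push_cast
  rfl

lemma multiDeriv_coe (α : Fin n → ℕ) (F : Schw n) :
    multiDeriv α F = orderedPow coordDeriv α F :=
  multiDeriv_eq_orderedPow (fun F : Schw n => (F : EuclideanSpace ℝ (Fin n) → ℂ)) coordDeriv
    (fun i u => (partialDeriv_coe i u).symm) α F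

/-- Letters are absorbed one at a time into a normally ordered monomial. A multiplication costs
nothing; a derivative crossing `x^β` gives the raised monomial and a commutator term with
coefficient `β i`. The growth condition on `E` bounds that term by the same quantity, so each letter
costs at most a factor two. -/
lemma wordBound_of_orderedBound (F : Schw n) {C : ℝ} (hC : 0 ≤ C) {E : ℕ → ℝ}
    (hE0 : ∀ k, 0 ≤ E k) (hE : ∀ k : ℕ, (k + 1) * E k ≤ E (k + 2))
    (h : ∀ (α β : Fin n → ℕ) (x : EuclideanSpace ℝ (Fin n)),
      ‖(multiPow x β : ℂ) * multiDeriv α F x‖ ≤ C * E (multiLength α + multiLength β)) :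
    WordBound F fun m => C * 2 ^ m * E m := by
  -- The induction needs words applied to arbitrary ordered monomials; the claim is the case of zero
  -- exponents.
  suffices hw : ∀ (w : List (Fin n ⊕ Fin n)) (α β : Fin n → ℕ) (x : EuclideanSpace ℝ (Fin n)),
      ‖weylWord w (orderedPow coordMul β (orderedPow coordDeriv α F)) x‖ ≤
        C * 2 ^ w.length * E (w.length + (multiLength α + multiLength β)) by
    intro w x
    have := hw w 0 0 x
    simpa [orderedPow_zero, multiLength] using this
  intro w
  induction w using List.reverseRecOn with
  | nil =>
    intro α β x
    rw [weylWord_nil, orderedPow_coordMul_apply, ← multiDeriv_coe]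
    simpa using h α β x
  | append_singleton w l ih =>
    intro α β x
    set m := w.length with hm
    rw [List.length_append, List.length_singleton, ← hm, weylWord_append, weylWord_cons,
      weylWord_nil]
    have hnn : 0 ≤ C * 2 ^ m * E (m + 1 + (multiLength α + multiLength β)) :=
      mul_nonneg (by positivity) (hE0 _)
    rcases l with i | i
    · have h1 := ih α (β + Pi.single i 1) x
      rw [← mul_orderedPow coordMul_comm, mul_apply_eq_comp,
        Oscillator.multiLength_add_single] at h1
      refine h1.trans ?_
      rw [show m + (multiLength α + (multiLength β + 1)) =
        m + 1 + (multiLength α + multiLength β) by ring, pow_succ]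
      linarith
    · have e1 := congrArg (fun T : SchwOp n => T (orderedPow coordDeriv α F))
        (annihilate_orderedPow (a := (coordDeriv i : SchwOp n)) (j := i) (c := coordMul)
        (fun j hj => by
          have := coordDeriv_mul_coordMul i j
          rw [if_neg fun h => hj h.symm, add_zero] at this
          exact this) (by simpa using coordDeriv_mul_coordMul i i) β)
      simp only [mul_apply_eq_comp, add_apply, smul_apply] at e1
      have e2 : coordDeriv i (orderedPow coordDeriv α F) =
          orderedPow coordDeriv (α + Pi.single i 1) F := by
        rw [← mul_orderedPow coordDeriv_comm, mul_apply_eq_comp]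
      rw [e2] at e1
      change ‖weylWord w (coordDeriv i _) x‖ ≤ _
      rw [e1, map_add, map_nsmul, add_apply, smul_apply]
      have h1 := ih (α + Pi.single i 1) β x
      rw [Oscillator.multiLength_add_single, show m + (multiLength α + 1 + multiLength β) =
        m + 1 + (multiLength α + multiLength β) by ring] at h1
      have h2 : ‖β i • weylWord w (orderedPow coordMul (β - Pi.single i 1)
          (orderedPow coordDeriv α F)) x‖ ≤
          C * 2 ^ m * E (m + 1 + (multiLength α + multiLength β)) := by
        rcases Nat.eq_zero_or_pos (β i) with h0 | h0
        · rw [h0, zero_smul, norm_zero]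
          exact hnn
        · have hβ : β - Pi.single i 1 + Pi.single i 1 = β := by
            ext j
            by_cases hj : j = i
            · subst hj; simp; omega
            · simp [hj]
          have hlen : multiLength β = multiLength (β - Pi.single i 1) + 1 := by
            rw [← Oscillator.multiLength_add_single _ i, hβ]
          have h3 := ih α (β - Pi.single i 1) x
          have h4 := hE (m + (multiLength α + multiLength (β - Pi.single i 1)))
          rw [show m + (multiLength α + multiLength (β - Pi.single i 1)) + 2 =
            m + 1 + (multiLength α + multiLength β) by rw [hlen]; ring] at h4
          have h5 : (β i : ℝ) ≤
              (m + (multiLength α + multiLength (β - Pi.single i 1)) : ℕ) + 1 := by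
            have := Oscillator.le_multiLength β i
            exact_mod_cast (by omega)
          have h6 := hE0 (m + (multiLength α + multiLength (β - Pi.single i 1)))
          rw [nsmul_eq_mul, norm_mul, Complex.norm_natCast]
          calc _ ≤ ((m + (multiLength α + multiLength (β - Pi.single i 1)) : ℕ) + 1 : ℝ) *
                (C * 2 ^ m * E (m + (multiLength α + multiLength (β - Pi.single i 1)))) :=
                mul_le_mul h5 h3 (norm_nonneg _) (by positivity)
            _ = C * 2 ^ m * (((m + (multiLength α + multiLength (β - Pi.single i 1)) : ℕ) + 1 : ℝ) *
                E (m + (multiLength α + multiLength (β - Pi.single i 1)))) := by ring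
            _ ≤ _ := mul_le_mul_of_nonneg_left h4 (by positivity)
      refine (norm_add_le _ _).trans ((add_le_add h1 h2).trans (le_of_eq ?_))
      rw [pow_succ]
      ring

end StepToSchwartz

/-! ### A majorant with enough growth for normal ordering -/

section Majorant

/-- A majorant of `h^k (k!)^s` which grows at least like `(k!)^{1/2}`. -/
def stepMajorant (s h : ℝ) (k : ℕ) : ℝ :=
  ∏ j ∈ Finset.range k, max (h * ((j + 1 : ℕ) : ℝ) ^ s) (Real.sqrt (j + 1 : ℕ))

variable {s h : ℝ}

lemma stepMajorant_succ (k : ℕ) : stepMajorant s h (k + 1) =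
    stepMajorant s h k * max (h * ((k + 1 : ℕ) : ℝ) ^ s) (Real.sqrt (k + 1 : ℕ)) :=
  Finset.prod_range_succ _ _

lemma stepMajorant_nonneg (k : ℕ) : 0 ≤ stepMajorant s h k :=
  Finset.prod_nonneg fun _ _ => le_max_of_le_right (Real.sqrt_nonneg _)

/-- Each of the two new factors is at least `√(k + 1)`; this is the purpose of the maximum in the
definition. -/
lemma stepMajorant_growth (k : ℕ) :
    (k + 1) * stepMajorant s h k ≤ stepMajorant s h (k + 2) := by
  rw [stepMajorant_succ, stepMajorant_succ, mul_assoc, mul_comm]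
  refine mul_le_mul_of_nonneg_left ?_ (stepMajorant_nonneg k)
  have h1 : Real.sqrt (k + 1 : ℕ) ≤ Real.sqrt (k + 1 + 1 : ℕ) :=
    Real.sqrt_le_sqrt (by push_cast; linarith)
  calc (k + 1 : ℝ) = Real.sqrt (k + 1 : ℕ) * Real.sqrt (k + 1 : ℕ) := by
        rw [Real.mul_self_sqrt (by positivity)]; push_cast; rfl
    _ ≤ Real.sqrt (k + 1 : ℕ) * Real.sqrt (k + 1 + 1 : ℕ) := by gcongr
    _ ≤ _ := mul_le_mul (le_max_right _ _) (le_max_right _ _) (Real.sqrt_nonneg _)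
        (le_max_of_le_right (Real.sqrt_nonneg _))

lemma pow_mul_factorial_succ (k : ℕ) : h ^ (k + 1) * ((k + 1).factorial : ℝ) ^ s =
    h ^ k * (k.factorial : ℝ) ^ s * (h * ((k + 1 : ℕ) : ℝ) ^ s) := by
  rw [Nat.factorial_succ, Nat.cast_mul, Real.mul_rpow (by positivity) (by positivity), pow_succ]
  ring

lemma le_stepMajorant (hh : 0 ≤ h) (k : ℕ) :
    h ^ k * (k.factorial : ℝ) ^ s ≤ stepMajorant s h k := by
  induction k with
  | zero => simp [stepMajorant]
  | succ k ih =>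
    rw [pow_mul_factorial_succ, stepMajorant_succ]
    exact mul_le_mul ih (le_max_left _ _) (by positivity) (stepMajorant_nonneg k)

/-- Beyond some index the maximum is attained by its first argument, so the quotient stops growing;
the initial quotients are simply added up. -/
lemma exists_stepMajorant_le (hh : 0 < h)
    (hj : ∀ᶠ j : ℕ in Filter.atTop, Real.sqrt (j + 1 : ℕ) ≤ h * ((j + 1 : ℕ) : ℝ) ^ s) :
    ∃ D, 0 ≤ D ∧ ∀ k, stepMajorant s h k ≤ D * (h ^ k * (k.factorial : ℝ) ^ s) := by
  obtain ⟨j₀, hj₀⟩ := Filter.eventually_atTop.1 hj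
  have hnn : ∀ k, 0 ≤ stepMajorant s h k / (h ^ k * (k.factorial : ℝ) ^ s) := fun k =>
    div_nonneg (stepMajorant_nonneg k) (by positivity)
  refine ⟨∑ k ∈ Finset.range (j₀ + 1), stepMajorant s h k / (h ^ k * (k.factorial : ℝ) ^ s),
    Finset.sum_nonneg fun k _ => hnn k, fun k => ?_⟩
  induction k with
  | zero =>
    rw [← div_le_iff₀ (by positivity)]
    exact Finset.single_le_sum (f := fun k => stepMajorant s h k / (h ^ k * (k.factorial : ℝ) ^ s))
      (fun k _ => hnn k) (by simp)
  | succ k ih =>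
    rcases lt_or_ge k j₀ with hk | hk
    · rw [← div_le_iff₀ (by positivity)]
      exact Finset.single_le_sum
        (f := fun k => stepMajorant s h k / (h ^ k * (k.factorial : ℝ) ^ s))
        (fun k _ => hnn k) (by simpa using hk)
    · rw [stepMajorant_succ, max_eq_left (hj₀ k hk), pow_mul_factorial_succ]
      exact (mul_le_mul_of_nonneg_right ih (by positivity)).trans (le_of_eq (mul_assoc _ _ _))

/-- The Roumieu case enlarges `h` to make the comparison with square roots hold, the Beurling case
keeps it. The factor two in the base is the cost of normal ordering. -/
lemma exists_wordBound_of_step {n : ℕ} (hs : 0 ≤ s) {h' : ℝ} (hh : 0 < h) (hhh : h ≤ h')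
    (hj : ∀ᶠ j : ℕ in Filter.atTop, Real.sqrt (j + 1 : ℕ) ≤ h' * ((j + 1 : ℕ) : ℝ) ^ s)
    {F : Schw n} (hF : (F : EuclideanSpace ℝ (Fin n) → ℂ) ∈ gelfandShilovStep n s h) :
    ∃ C, 0 ≤ C ∧ WordBound F fun m => C * ((2 * h') ^ m * (m.factorial : ℝ) ^ s) := by
  obtain ⟨C, hC, hCF⟩ := exists_bound_of_step hs hh hF
  have hh' : 0 < h' := hh.trans_le hhh
  obtain ⟨D, hD, hDE⟩ := exists_stepMajorant_le hh' hj
  have h1 := wordBound_of_orderedBound F hC (E := stepMajorant s h') stepMajorant_nonneg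
    stepMajorant_growth fun α β x => (hCF α β x).trans (by
      gcongr
      refine le_trans ?_ (le_stepMajorant hh'.le _)
      gcongr)
  refine ⟨C * D, by positivity, h1.mono fun m => ?_⟩
  calc C * 2 ^ m * stepMajorant s h' m ≤ C * 2 ^ m * (D * (h' ^ m * (m.factorial : ℝ) ^ s)) := by
        gcongr
        exact hDE m
    _ = _ := by rw [mul_pow]; ring

end Majorant

/-! ### From word bounds back to Gelfand–Shilov bounds -/

section WordsToStep

variable {n : ℕ}

lemma exists_weylWord_eq_orderedPow (ι : Fin n → Fin n ⊕ Fin n)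
    (hι : ∀ i j, Commute (weylGen (ι i) : SchwOp n) (weylGen (ι j))) (k : Fin n → ℕ) :
    ∃ w : List (Fin n ⊕ Fin n), w.length = multiLength k ∧
      orderedPow (fun i => weylGen (ι i)) k = weylWord w := by
  induction k using Oscillator.multiIndex_induction with
  | h0 => exact ⟨[], by simp [multiLength], by rw [orderedPow_zero, weylWord]; simp⟩
  | hs k i ih =>
    obtain ⟨w, hw, e⟩ := ih
    refine ⟨ι i :: w, by rw [List.length_cons, hw, Oscillator.multiLength_add_single], ?_⟩
    rw [← mul_orderedPow hι, e, weylWord, weylWord, List.map_cons, List.prod_cons]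

/-- The operator `x^β ∂^α` is itself a word of length `|α| + |β|`; splitting the factorial of this
length into `α! β!` costs the factor in front of `h`. -/
lemma mem_gelfandShilovStep_of_wordBound {F : Schw n} {C s h : ℝ} (hs : 0 ≤ s) (hh : 0 < h)
    (hC : 0 ≤ C) (hF : WordBound F fun m => C * (h ^ m * (m.factorial : ℝ) ^ s)) :
    (F : EuclideanSpace ℝ (Fin n) → ℂ) ∈ gelfandShilovStep n s ((2 ^ (n + 1)) ^ s * h) := by
  refine ⟨F.smooth', C, fun α β x => ?_⟩
  obtain ⟨u, hu, eu⟩ := exists_weylWord_eq_orderedPow (n := n) Sum.inl coordMul_comm β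
  obtain ⟨v, hv, ev⟩ := exists_weylWord_eq_orderedPow (n := n) Sum.inr coordDeriv_comm α
  have h1 := hF (u ++ v) x
  have hfac : ∀ γ : Fin n → ℕ, (0 : ℝ) < multiFactorial γ := Oscillator.fact_pos
  have h2 := hfac α
  have h3 := hfac β
  rw [weylWord_append, ← eu, ← ev] at h1
  change ‖orderedPow coordMul β (orderedPow coordDeriv α F) x‖ ≤ _ at h1
  rw [orderedPow_coordMul_apply, ← multiDeriv_coe, List.length_append, hu, hv,
    add_comm (multiLength β)] at h1
  rw [div_le_iff₀ (by positivity)]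
  refine h1.trans (mul_le_mul_of_nonneg_left ?_ hC)
  have h4 : ((multiLength α + multiLength β).factorial : ℝ) ≤
      (2 ^ (n + 1)) ^ (multiLength α + multiLength β) *
        ((multiFactorial α : ℝ) * multiFactorial β) := by
    exact_mod_cast factorial_multiLength_le α β
  have h5 := Real.rpow_le_rpow (by positivity) h4 hs
  rw [Real.mul_rpow (by positivity) (by positivity), ← Real.rpow_pow_comm (by positivity)] at h5
  calc _ ≤ h ^ (multiLength α + multiLength β) *
        ((((2 : ℝ) ^ (n + 1)) ^ s) ^ (multiLength α + multiLength β) *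
          ((multiFactorial α : ℝ) * multiFactorial β) ^ s) := by gcongr
    _ = _ := by rw [mul_pow]; ring

end WordsToStep

/-! ### The factorization in Roumieu and Beurling spaces -/

section SharpFactors

variable {d : ℕ} {t s : ℝ}

lemma le_of_shifted_growth (hs : 0 ≤ s) {R : ℕ → ℝ} {D h : ℝ} (hh : 0 < h) (hD : 0 ≤ D)
    (hR : ∀ m, R m ≤ D * (h ^ m * (m.factorial : ℝ) ^ s)) (c m : ℕ) :
    R (m + c) ≤ D * ((h * 2 ^ s) ^ c * (c.factorial : ℝ) ^ s) *
      ((2 ^ s * h) ^ m * (m.factorial : ℝ) ^ s) := by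
  refine (hR _).trans ?_
  calc _ ≤ D * (h ^ (m + c) * (((2 : ℝ) ^ s) ^ (m + c) *
        ((m.factorial : ℝ) ^ s * (c.factorial : ℝ) ^ s))) := by
        gcongr
        exact add_factorial_rpow_le hs m c
    _ = _ := by rw [mul_pow, mul_pow]; ring

/-- The factors and `κ` are fixed before `D` and `h`. In the Beurling case the same pair is
therefore tested against every `h`. -/
lemma exists_sharp_factors (hs : 0 ≤ s) (a : Schw (d + d)) {M R : ℕ → ℝ} {δ : ℝ}
    (hM0 : ∀ m, 0 ≤ M m) (hM : WordBound a M) (hR : ∀ m, 0 < R m)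
    (hMR : ∀ m k, M (m + k) ≤ R m * R k) (hδ0 : 0 < δ)
    (hδ : ∀ m : ℕ, δ * Real.sqrt (m.factorial) ≤ R m) :
    ∃ (a₁ a₂ : EuclideanSpace ℝ (Fin (d + d)) → ℂ) (κ : ℝ), 0 < κ ∧
      (∀ D h, 0 ≤ D → 0 < h → (∀ m, R m ≤ D * (h ^ m * (m.factorial : ℝ) ^ s)) →
        a₁ ∈ gelfandShilovStep (d + d) s (κ * h) ∧ a₂ ∈ gelfandShilovStep (d + d) s (κ * h)) ∧
      IsSharpProduct t a₁ a₂ a := by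
  obtain ⟨a₁, a₂, C, B, c, hC, hB, h₁, h₂, hprod⟩ :=
    exists_factorization t a hM0 hM hR hMR hδ0 hδ
  have hs1 : (1 : ℝ) ≤ 2 ^ s := Real.one_le_rpow (by norm_num) hs
  refine ⟨a₁, a₂, (2 ^ (d + d + 1)) ^ s * (B * 2 ^ s), by positivity, fun D h hD hh hRD => ?_,
    fun f hf => ?_⟩
  · rw [mul_assoc]
    constructor
    · refine mem_gelfandShilovStep_of_wordBound (C := 2 * D) hs (by positivity) (by positivity)
        (h₁.mono fun m => ?_)
      calc 2 * R m ≤ 2 * (D * ((1 * h) ^ m * (m.factorial : ℝ) ^ s)) := by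
            rw [one_mul]; gcongr; exact hRD m
        _ ≤ 2 * (D * ((B * 2 ^ s * h) ^ m * (m.factorial : ℝ) ^ s)) := by
            gcongr
            exact one_le_mul_of_one_le_of_one_le hB hs1
        _ = _ := by ring
    · have key := le_of_shifted_growth hs hh hD hRD
      refine mem_gelfandShilovStep_of_wordBound
        (C := C * (D * ((h * 2 ^ s) ^ c * (c.factorial : ℝ) ^ s) +
          D * ((h * 2 ^ s) ^ (c + 1) * ((c + 1).factorial : ℝ) ^ s))) hs (by positivity)
        (by positivity) (h₂.mono fun m => ?_)
      calc C * B ^ m * (R (m + c) + R (m + c + 1)) ≤ C * B ^ m *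
            (D * ((h * 2 ^ s) ^ c * (c.factorial : ℝ) ^ s) *
              ((2 ^ s * h) ^ m * (m.factorial : ℝ) ^ s) +
            D * ((h * 2 ^ s) ^ (c + 1) * ((c + 1).factorial : ℝ) ^ s) *
              ((2 ^ s * h) ^ m * (m.factorial : ℝ) ^ s)) := by
            gcongr
            · exact key c m
            · exact key (c + 1) m
        _ = _ := by rw [mul_assoc B, mul_pow B]; ring
  · obtain ⟨h, hh, hf⟩ := hf
    obtain ⟨F, rfl⟩ := exists_schwartz_of_step (by norm_num) hh hf
    obtain ⟨g, hg, hag⟩ := hprod F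
    rw [hg]
    exact ⟨opConverges_schwartz t a₂ F, opConverges_schwartz t a₁ g, opConverges_schwartz t a F,
      hag⟩

lemma sqrt_factorial_le {m : ℕ} (hs : 1 / 2 ≤ s) :
    Real.sqrt (m.factorial) ≤ (m.factorial : ℝ) ^ s := by
  rw [Real.sqrt_eq_rpow]
  exact Real.rpow_le_rpow_of_exponent_le (by exact_mod_cast Nat.factorial_pos m) hs

lemma eventually_sqrt_le_of_one_le {h : ℝ} (hs : 1 / 2 ≤ s) (hh : 1 ≤ h) :
    ∀ᶠ j : ℕ in Filter.atTop, Real.sqrt (j + 1 : ℕ) ≤ h * ((j + 1 : ℕ) : ℝ) ^ s := by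
  refine Filter.Eventually.of_forall fun j => ?_
  rw [Real.sqrt_eq_rpow]
  have h1 : ((j + 1 : ℕ) : ℝ) ^ (1 / 2 : ℝ) ≤ ((j + 1 : ℕ) : ℝ) ^ s :=
    Real.rpow_le_rpow_of_exponent_le (by simp) hs
  exact h1.trans (le_mul_of_one_le_left (by positivity) hh)

lemma eventually_sqrt_le_of_half_lt {h : ℝ} (hs : 1 / 2 < s) (hh : 0 < h) :
    ∀ᶠ j : ℕ in Filter.atTop, Real.sqrt (j + 1 : ℕ) ≤ h * ((j + 1 : ℕ) : ℝ) ^ s := by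
  have h1 : Filter.Tendsto (fun j : ℕ => ((j + 1 : ℕ) : ℝ) ^ (s - 1 / 2)) Filter.atTop
      Filter.atTop :=
    (tendsto_rpow_atTop (sub_pos.2 hs)).comp
      (tendsto_natCast_atTop_atTop.comp (Filter.tendsto_add_atTop_nat 1))
  filter_upwards [h1.eventually_ge_atTop h⁻¹] with j hj
  have hj0 : (0 : ℝ) < ((j + 1 : ℕ) : ℝ) := by positivity
  rw [Real.sqrt_eq_rpow, show s = (s - 1 / 2) + 1 / 2 by ring, Real.rpow_add hj0, ← mul_assoc]
  refine le_mul_of_one_le_left (by positivity) ?_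
  rwa [inv_le_iff_one_le_mul₀' hh] at hj

/-- Factorization of symbols in Gelfand–Shilov spaces of Roumieu type. -/
lemma exists_sharp_factors_roumieu (hs : 1 / 2 ≤ s) {a : EuclideanSpace ℝ (Fin (d + d)) → ℂ}
    (ha : a ∈ gelfandShilovS (d + d) s) :
    ∃ a₁ ∈ gelfandShilovS (d + d) s, ∃ a₂ ∈ gelfandShilovS (d + d) s,
      IsSharpProduct t a₁ a₂ a := by
  have hs0 : 0 ≤ s := by linarith
  obtain ⟨h, hh, ha⟩ := ha
  obtain ⟨F, rfl⟩ := exists_schwartz_of_step hs0 hh ha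
  obtain ⟨C, hC, hF⟩ := exists_wordBound_of_step hs0 hh (le_max_left h 1)
    (eventually_sqrt_le_of_one_le hs (le_max_right h 1)) ha
  set η : ℝ := 2 * max h 1 with hη
  have hη1 : 1 ≤ η := by linarith [le_max_right h 1]
  have hs1 : (1 : ℝ) ≤ 2 ^ s := Real.one_le_rpow (by norm_num) hs0
  -- The factor `2^s` in the base of `R` pays for splitting the factorial of `m + k`; the constant
  -- `C + 1` ensures both `C ≤ (C + 1)²` and the lower bound with `δ = 1`.
  obtain ⟨a₁, a₂, κ, hκ, hmem, hprod⟩ := exists_sharp_factors (t := t) (δ := 1) hs0 F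
    (R := fun m => (C + 1) * ((2 ^ s * η) ^ m * (m.factorial : ℝ) ^ s)) (fun m => by positivity) hF
    (fun m => by positivity) (fun m k => by
      calc C * (η ^ (m + k) * ((m + k).factorial : ℝ) ^ s) ≤ ((C + 1) * (C + 1)) *
            (η ^ (m + k) * (((2 : ℝ) ^ s) ^ (m + k) *
              ((m.factorial : ℝ) ^ s * (k.factorial : ℝ) ^ s))) := by
            gcongr
            · nlinarith
            · exact add_factorial_rpow_le hs0 m k
        _ = _ := by rw [mul_pow, mul_pow]; ring) one_pos fun m => by
      rw [one_mul, ← mul_assoc]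
      refine (sqrt_factorial_le hs).trans (le_mul_of_one_le_left (by positivity) ?_)
      exact one_le_mul_of_one_le_of_one_le (by linarith)
        (one_le_pow₀ (one_le_mul_of_one_le_of_one_le hs1 hη1))
  obtain ⟨h₁, h₂⟩ := hmem (C + 1) (2 ^ s * η) (by positivity) (by positivity) fun m => le_rfl
  exact ⟨a₁, ⟨_, by positivity, h₁⟩, a₂, ⟨_, by positivity, h₂⟩, hprod⟩

/-! ### Envelopes of bounds and the Beurling case -/

/-- The lower envelope of the geometric sequences `D h * h^m`, `h > 0`. -/
def geometricEnvelope (D : {h : ℝ // 0 < h} → ℝ) (m : ℕ) : ℝ := ⨅ h, D h * (h : ℝ) ^ m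

section Envelope

variable {D : {h : ℝ // 0 < h} → ℝ}

instance nonempty_posReal : Nonempty {h : ℝ // 0 < h} := ⟨⟨1, one_pos⟩⟩

lemma geometricEnvelope_le (hD : ∀ h, 1 ≤ D h) (m : ℕ) (h : {h : ℝ // 0 < h}) :
    geometricEnvelope D m ≤ D h * (h : ℝ) ^ m := by
  refine ciInf_le ⟨0, ?_⟩ h
  rintro _ ⟨h, rfl⟩
  have := hD h
  have := h.2
  positivity

/-- For two competing parameters the smaller one is used at `m + k`: its powers lie below the mixed
product, and the other constant is at least one. Taking the infimum in each parameter separately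
gives the claim. -/
lemma geometricEnvelope_add_le (hD : ∀ h, 1 ≤ D h)
    (hpos : ∀ m, 0 < geometricEnvelope D m) (m k : ℕ) :
    geometricEnvelope D (m + k) ≤ geometricEnvelope D m * geometricEnvelope D k := by
  have key : ∀ h h', geometricEnvelope D (m + k) ≤ (D h * (h : ℝ) ^ m) * (D h' * (h' : ℝ) ^ k) := by
    intro h h'
    have h1 := hD h
    have h2 := hD h'
    have h3 := h.2
    have h4 := h'.2
    rcases le_total (h : ℝ) h' with hle | hle
    · calc _ ≤ D h * (h : ℝ) ^ (m + k) := geometricEnvelope_le hD _ h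
        _ = (D h * (h : ℝ) ^ m) * (1 * (h : ℝ) ^ k) := by rw [pow_add]; ring
        _ ≤ _ := by gcongr
    · calc _ ≤ D h' * (h' : ℝ) ^ (m + k) := geometricEnvelope_le hD _ h'
        _ = (1 * (h' : ℝ) ^ m) * (D h' * (h' : ℝ) ^ k) := by rw [pow_add]; ring
        _ ≤ _ := by gcongr
  rw [← div_le_iff₀' (hpos m)]
  refine le_ciInf fun h' => ?_
  have h2 := hD h'
  have h4 := h'.2
  rw [div_le_iff₀' (hpos m), ← div_le_iff₀ (by positivity)]
  refine le_ciInf fun h => ?_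
  rw [div_le_iff₀ (by positivity)]
  exact key h h'

end Envelope

/-- Factorization of symbols in Gelfand–Shilov spaces of Beurling type. -/
lemma exists_sharp_factors_beurling (hs : 1 / 2 < s) {a : EuclideanSpace ℝ (Fin (d + d)) → ℂ}
    (ha : a ∈ gelfandShilovSigma (d + d) s) :
    ∃ a₁ ∈ gelfandShilovSigma (d + d) s, ∃ a₂ ∈ gelfandShilovSigma (d + d) s,
      IsSharpProduct t a₁ a₂ a := by
  have hs0 : 0 ≤ s := by linarith
  obtain ⟨F, rfl⟩ := exists_schwartz_of_step hs0 one_pos (ha 1 one_pos)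
  -- The constant for `h` is chosen to dominate `√(m!)` as well as the words of the symbol. Since `s
  -- > 1/2` this is possible for every `h`, and it keeps the infimum positive.
  have hbound : ∀ h : {h : ℝ // 0 < h}, ∃ D : ℝ, 1 ≤ D ∧
      WordBound F (fun m => D * ((h : ℝ) ^ m * (m.factorial : ℝ) ^ s)) ∧
      ∀ m : ℕ, Real.sqrt (m.factorial) ≤ D * ((h : ℝ) ^ m * (m.factorial : ℝ) ^ s) := by
    rintro ⟨h, hh⟩
    obtain ⟨C, hC, hF⟩ := exists_wordBound_of_step hs0 (half_pos hh) le_rfl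
      (eventually_sqrt_le_of_half_lt hs (half_pos hh)) (ha _ (half_pos hh))
    rw [mul_div_cancel₀ h two_ne_zero] at hF
    obtain ⟨D, hD, hDm⟩ := exists_stepMajorant_le hh (eventually_sqrt_le_of_half_lt hs hh)
    refine ⟨C + D + 1, by linarith, hF.mono fun m => ?_, fun m => ?_⟩
    · gcongr
      linarith
    · have h1 : Real.sqrt (m.factorial) ≤ stepMajorant s h m := by
        induction m with
        | zero => simp [stepMajorant]
        | succ m ih =>
          rw [stepMajorant_succ, Nat.factorial_succ, mul_comm, Nat.cast_mul,
            Real.sqrt_mul (by positivity)]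
          exact mul_le_mul ih (le_max_right _ _) (Real.sqrt_nonneg _) (stepMajorant_nonneg m)
      refine h1.trans ((hDm m).trans ?_)
      gcongr
      linarith
  choose D hD1 hDF hDm using hbound
  have hlow : ∀ m : ℕ, Real.sqrt (m.factorial) / (m.factorial : ℝ) ^ s ≤ geometricEnvelope D m := by
    refine fun m => le_ciInf fun h => ?_
    rw [div_le_iff₀ (by positivity), mul_assoc]
    exact hDm h m
  have hpos : ∀ m, 0 < geometricEnvelope D m := fun m =>
    lt_of_lt_of_le (div_pos (Real.sqrt_pos.2 (by positivity)) (by positivity)) (hlow m)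
  have hs1 : (1 : ℝ) ≤ 2 ^ s := Real.one_le_rpow (by norm_num) hs0
  obtain ⟨a₁, a₂, κ, hκ, hmem, hprod⟩ := exists_sharp_factors (t := t) (δ := 1) hs0 F
    (M := fun m => (m.factorial : ℝ) ^ s * geometricEnvelope D m)
    (R := fun m => ((2 : ℝ) ^ s) ^ m * ((m.factorial : ℝ) ^ s * geometricEnvelope D m))
    (fun m => mul_nonneg (by positivity) (hpos m).le)
    (fun w x => by
      rw [← div_le_iff₀' (by positivity)]
      refine le_ciInf fun h => ?_
      rw [div_le_iff₀ (by positivity), mul_assoc]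
      exact hDF h w x)
    (fun m => mul_pos (by positivity) (mul_pos (by positivity) (hpos m)))
    (fun m k => by
      have h1 := hpos (m + k)
      calc ((m + k).factorial : ℝ) ^ s * geometricEnvelope D (m + k) ≤
            (((2 : ℝ) ^ s) ^ (m + k) * ((m.factorial : ℝ) ^ s * (k.factorial : ℝ) ^ s)) *
              (geometricEnvelope D m * geometricEnvelope D k) :=
            mul_le_mul (add_factorial_rpow_le hs0 m k) (geometricEnvelope_add_le hD1 hpos m k) h1.le
              (by positivity)
        _ = _ := by rw [pow_add]; ring) one_pos fun m => by
      have h1 := hlow m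
      rw [div_le_iff₀' (by positivity)] at h1
      rw [one_mul]
      exact h1.trans (le_mul_of_one_le_left (mul_nonneg (by positivity) (hpos m).le)
        (one_le_pow₀ hs1))
  have hstep : ∀ h : ℝ, 0 < h → a₁ ∈ gelfandShilovStep (d + d) s h ∧
      a₂ ∈ gelfandShilovStep (d + d) s h := by
    intro h hh
    -- The envelope is compared with the member of the family whose losses `κ` and `2^s` lead back
    -- to exactly `h`.
    have h0 : 0 < h / (κ * 2 ^ s) := by positivity
    have h1 := hmem (D ⟨_, h0⟩) (2 ^ s * (h / (κ * 2 ^ s)))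
      (zero_le_one.trans (hD1 _)) (by positivity) fun m => by
        calc _ ≤ ((2 : ℝ) ^ s) ^ m * ((m.factorial : ℝ) ^ s *
              (D ⟨_, h0⟩ * (h / (κ * 2 ^ s)) ^ m)) := by
              gcongr
              exact geometricEnvelope_le hD1 m ⟨_, h0⟩
          _ = _ := by rw [mul_pow]; ring
    rwa [show κ * (2 ^ s * (h / (κ * 2 ^ s))) = h by field_simp] at h1
  exact ⟨a₁, fun h hh => (hstep h hh).1, a₂, fun h hh => (hstep h hh).2, hprod⟩

end SharpFactors

end

theorem theorem3p4 (d : ℕ) (t s₁ s₂ : ℝ) (hs₁ : 1 / 2 ≤ s₁) (hs₂ : 1 / 2 < s₂) :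
    (∀ a ∈ gelfandShilovS (d + d) s₁,
      ∃ a₁ ∈ gelfandShilovS (d + d) s₁, ∃ a₂ ∈ gelfandShilovS (d + d) s₁,
        IsSharpProduct t a₁ a₂ a) ∧
    (∀ a ∈ gelfandShilovSigma (d + d) s₂,
      ∃ a₁ ∈ gelfandShilovSigma (d + d) s₂, ∃ a₂ ∈ gelfandShilovSigma (d + d) s₂,
        IsSharpProduct t a₁ a₂ a) :=
  ⟨fun _ ha => exists_sharp_factors_roumieu hs₁ ha,
    fun _ ha => exists_sharp_factors_beurling hs₂ ha⟩
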